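/- Let $n\ge 2$ be an integer and let $q\ne 1$ be a positive real number. Let $U'_q({\rm so}_n)$ be the associative unital complex algebra generated by $I_{i,i-1}$, $i=2,\dots,n$, with the defining relations $$I_{i,i-1}I_{i-1,i-2}^2-(q+q^{-1})I_{i-1,i-2}I_{i,i-1}I_{i-1,i-2}+I_{i-1,i-2}^2I_{i,i-1}=-I_{i,i-1},\tag{1}$$ $$I_{i,i-1}^2I_{i-1,i-2}-(q+q^{-1})I_{i,i-1}I_{i-1,i-2}I_{i,i-1}+I_{i-1,i-2}I_{i,i-1}^2=-I_{i-1,i-2}\tag{2}$$ for $3\le i\le n$, and $[I_{i,i-1},I_{j,j-1}]=0$ for $|i-j|>1$ (3). Put $[a]=\frac{q^a-q^{-a}}{q-q^{-1}}$ and $[a]_+=\frac{q^a+q^{-a}}{q-q^{-1}}$. Let $\epsilon=(\epsilon_2,\dots,\epsilon_n)$ with $\epsilon_i=\pm1$, and let ${\bf m}_n=(m_{1,n},\dots,m_{\lfloor n/2\rfloor,n})$ consist of half-integral numbers (elements of $\frac12+\mathbb Z$) with $m_{1,n}\ge m_{2,n}\ge\dots\ge m_{\lfloor n/2\rfloor,n}\ge\frac12$.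 Let $V_{{\bf m}_n}$ be the complex vector space with basis $|\xi_n\rangle$, where $\xi_n=({\bf m}_n,{\bf m}_{n-1},\dots,{\bf m}_2)$ runs over the tableaux with top row ${\bf m}_n$ and rows ${\bf m}_k=(m_{1,k},\dots,m_{\lfloor k/2\rfloor,k})$ of half-integral numbers such that, for all rows that occur, $$m_{1,2p+1}\ge m_{1,2p}\ge m_{2,2p+1}\ge m_{2,2p}\ge\dots\ge m_{p,2p+1}\ge m_{p,2p}\ge\tfrac12,$$ $$m_{1,2p}\ge m_{1,2p-1}\ge m_{2,2p}\ge m_{2,2p-1}\ge\dots\ge m_{p-1,2p-1}\ge m_{p,2p}.$$ Put $l_{j,2p+1}=m_{j,2p+1}+p-j+1$ and $l_{j,2p}=m_{j,2p}+p-j$. Let $(\xi_n)^{\pm j}_k$ be $\xi_n$ with $m_{j,k}$ replaced by $m_{j,k}\pm1$; the corresponding vector, and the term that contains it, is zero if the result is not an admissible tableau. Put $$A^j_{2p}(\xi_n)=\left(\frac{\prod_{i=1}^p[l_{i,2p+1}+l_{j,2p}][l_{i,2p+1}-l_{j,2p}-1]\prod_{i=1}^{p-1}[l_{i,2p-1}+l_{j,2p}][l_{i,2p-1}-l_{j,2p}-1]}{\prod_{i\ne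 j}^p[l_{i,2p}+l_{j,2p}][l_{i,2p}-l_{j,2p}][l_{i,2p}+l_{j,2p}+1][l_{i,2p}-l_{j,2p}-1]}\right)^{1/2},$$ $$B^j_{2p-1}(\xi_n)=\left(\frac{\prod_{i=1}^p[l_{i,2p}+l_{j,2p-1}][l_{i,2p}-l_{j,2p-1}]\prod_{i=1}^{p-1}[l_{i,2p-2}+l_{j,2p-1}][l_{i,2p-2}-l_{j,2p-1}]}{\prod_{i\ne j}^{p-1}[l_{i,2p-1}+l_{j,2p-1}][l_{i,2p-1}-l_{j,2p-1}][l_{i,2p-1}+l_{j,2p-1}-1][l_{i,2p-1}-l_{j,2p-1}-1]}\right)^{1/2},$$ $$\hat C_{2p-1}(\xi_n)=\frac{\prod_{s=1}^p[l_{s,2p}]_+\prod_{s=1}^{p-1}[l_{s,2p-2}]_+}{\prod_{s=1}^{p-1}[l_{s,2p-1}]_+[l_{s,2p-1}-1]_+},\qquad D_{2p}(\xi_n)=\frac{\prod_{i=1}^p[l_{i,2p+1}-\frac12]\prod_{i=1}^{p-1}[l_{i,2p-1}-\frac12]}{\prod_{i=1}^{p-1}[l_{i,2p}+\frac12][l_{i,2p}-\frac12]}.$$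 Define operators on $V_{{\bf m}_n}$ by $$T_{\epsilon,{\bf m}_n}(I_{2p+1,2p})|\xi_n\rangle=\delta_{m_{p,2p},1/2}\frac{\epsilon_{2p+1}}{q^{1/2}-q^{-1/2}}D_{2p}(\xi_n)|\xi_n\rangle+\sum_{j=1}^p\frac{A^j_{2p}(\xi_n)}{q^{l_{j,2p}}-q^{-l_{j,2p}}}|(\xi_n)^{+j}_{2p}\rangle-\sum_{j=1}^{p}\frac{A^j_{2p}((\xi_n)^{-j}_{2p})}{q^{l_{j,2p}}-q^{-l_{j,2p}}}|(\xi_n)^{-j}_{2p}\rangle,\tag{21}$$ where the last sum runs only to $p-1$ if $m_{p,2p}=\frac12$, and $$T_{\epsilon,{\bf m}_n}(I_{2p,2p-1})|\xi_n\rangle=\sum_{j=1}^{p-1}\frac{B^j_{2p-1}(\xi_n)}{[2l_{j,2p-1}-1][l_{j,2p-1}]_+}|(\xi_n)^{+j}_{2p-1}\rangle-\sum_{j=1}^{p-1}\frac{B^j_{2p-1}((\xi_n)^{-j}_{2p-1})}{[2l_{j,2p-1}-1][l_{j,2p-1}-1]_+}|(\xi_n)^{-j}_{2p-1}\rangle+\epsilon_{2p}\hat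 C_{2p-1}(\xi_n)|\xi_n\rangle.\tag{22}$$ (i) The operators $T_{\epsilon,{\bf m}_n}(I_{k,k-1})$, $k=2,\dots,n$, satisfy the relations (1)–(3), and so they define a unique representation $T_{\epsilon,{\bf m}_n}$ of $U'_q({\rm so}_n)$. (ii) Let now ${\bf m}_n$ be half-integral with $m_{1,n}\ge\dots\ge m_{p,n}\ge0$ if $n=2p+1$, and $m_{1,n}\ge\dots\ge m_{p-1,n}\ge|m_{p,n}|$ if $n=2p$. Let $\mathcal H$ be the complex vector space whose basis is indexed by the half-integral Gel'fand–Tsetlin tableaux with top row ${\bf m}_n$, that is, the betweenness conditions above with $m_{p,2p}\ge\frac12$ replaced by $m_{p,2p}\ge-m_{p,2p+1}$ and $m_{p-1,2p-1}\ge m_{p,2p}$ by $m_{p-1,2p-1}\ge|m_{p,2p}|$. Let $T'_{{\bf m}_n}(I_{2p+1,2p})$ act on $\mathcal H$ by (21) without the $D_{2p}$-term and with both sums from $1$ to $p$, and let $T'_{{\bf m}_n}(I_{2p,2p-1})$ act by (22). These operators also satisfy (1)–(3) and define a unique representation $T'_{{\bf m}_n}$ of $U'_q({\rm so}_n)$ (it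 depends on $\epsilon_2,\epsilon_4,\dots$). (iii) Let ${\bf m}_n$ be as in (i). For signs $\delta=(\delta_p)$, $1\le p\le N:=\lfloor(n-1)/2\rfloor$, and a tableau $\xi_n$ as in (i), let $|\xi_n\rangle_\delta\in\mathcal H$ be the vector obtained from $|\xi_n\rangle$ by applying successively, for $p=1,\dots,N$, the operation $|\xi\rangle\mapsto|\xi\rangle-\delta_p|\xi'\rangle$, where $\xi'$ is $\xi$ with $m_{p,2p}$ replaced by $-m_{p,2p}$, and let $\mathcal H_\delta$ be the span of these vectors. Then $\mathcal H$ is the direct sum of the $2^{N}$ nonzero subspaces $\mathcal H_\delta$; each $\mathcal H_\delta$ is invariant under all operators $T'_{{\bf m}_n}(I_{k,k-1})$; the vectors $|\xi_n\rangle_\delta$ form a basis of $\mathcal H_\delta$; and in this basis the operators $T'_{{\bf m}_n}(I_{k,k-1})$ act by (21)–(22) with $\epsilon_{2p+1}=\delta_p$, that is, as $T_{\epsilon,{\bf m}_n}(I_{k,k-1})$. -/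

import Mathlib

noncomputable section

namespace QSo

/-! ### The algebra `U'_q(so_n)`

The generator `I_{i,i-1}` (`i = 2, …, n`) is indexed by its first subscript `i`. -/

/-- The defining relations of `U'_q(so_n)`, for a family `I i` (standing for `I_{i,i-1}`,
`i = 2, …, n`) of elements of a complex algebra; values of `I` at other indices play no role. -/
structure SatisfiesRelations {A : Type*} [Ring A] [Algebra ℂ A] (q : ℝ) (n : ℕ) (I : ℕ → A) :
    Prop where
  rel₁ : ∀ i, 3 ≤ i → i ≤ n →
    I i * I (i - 1) ^ 2 - ((q + q⁻¹ : ℝ) : ℂ) • (I (i - 1) * I i * I (i - 1))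
      + I (i - 1) ^ 2 * I i = -I i
  rel₂ : ∀ i, 3 ≤ i → i ≤ n →
    I i ^ 2 * I (i - 1) - ((q + q⁻¹ : ℝ) : ℂ) • (I i * I (i - 1) * I i)
      + I (i - 1) * I i ^ 2 = -I (i - 1)
  rel₃ : ∀ i j, 2 ≤ i → i ≤ n → 2 ≤ j → j ≤ n → 1 < |(i : ℤ) - (j : ℤ)| →
    I i * I j - I j * I i = 0

/-- Indices of the generators `I_{i,i-1}`, `2 ≤ i ≤ n`. -/
abbrev GenIndex (n : ℕ) : Type := {i : ℕ // 2 ≤ i ∧ i ≤ n}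

/-- The free generator with index `i`. -/
def freeGen {n : ℕ} (i : GenIndex n) : FreeAlgebra ℂ (GenIndex n) := FreeAlgebra.ι ℂ i

/-- The relations imposed on the free algebra; in the first two, `b.1 = a.1 - 1`. -/
inductive Rel (q : ℝ) (n : ℕ) :
    FreeAlgebra ℂ (GenIndex n) → FreeAlgebra ℂ (GenIndex n) → Prop
  | rel₁ (a b : GenIndex n) (h : a.1 = b.1 + 1) : Rel q n
      (freeGen a * freeGen b ^ 2
        - ((q + q⁻¹ : ℝ) : ℂ) • (freeGen b * freeGen a * freeGen b)
        + freeGen b ^ 2 * freeGen a) (-freeGen a)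
  | rel₂ (a b : GenIndex n) (h : a.1 = b.1 + 1) : Rel q n
      (freeGen a ^ 2 * freeGen b
        - ((q + q⁻¹ : ℝ) : ℂ) • (freeGen a * freeGen b * freeGen a)
        + freeGen b * freeGen a ^ 2) (-freeGen b)
  | rel₃ (a b : GenIndex n) (h : 1 < |(a.1 : ℤ) - (b.1 : ℤ)|) : Rel q n
      (freeGen a * freeGen b - freeGen b * freeGen a) 0

/-- The associative unital complex algebra `U'_q(so_n)`. -/
abbrev Uq (q : ℝ) (n : ℕ) : Type := RingQuot (Rel q n)

/-- The generator `I_{i,i-1}` of `U'_q(so_n)`. -/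
def Uq.gen (q : ℝ) {n : ℕ} (i : GenIndex n) : Uq q n :=
  RingQuot.mkAlgHom ℂ (Rel q n) (freeGen i)

/-! ### `q`-numbers, weights and tableaux -/

/-- `[a] = (q^a - q^{-a}) / (q - q^{-1})`. -/
def qnum (q a : ℝ) : ℝ := (q ^ a - q ^ (-a)) / (q - q⁻¹)

/-- `[a]_+ = (q^a + q^{-a}) / (q - q^{-1})`. -/
def qnumPlus (q a : ℝ) : ℝ := (q ^ a + q ^ (-a)) / (q - q⁻¹)

/-- Half-integral numbers: `…, -3/2, -1/2, 1/2, 3/2, …`. -/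
def IsHalfIntegral (x : ℝ) : Prop := ∃ a : ℤ, x = a + 1 / 2

/-- An array of numbers; `m j k` is the component `m_{j,k}` (the `j`-th one in row `k`),
with `j` and `k` counted as usual from `1`. -/
abbrev Pattern : Type := ℕ → ℕ → ℝ

/-- `m_n = (M 1, …, M ⌊n/2⌋)` is half-integral with `M 1 ≥ M 2 ≥ ⋯ ≥ M ⌊n/2⌋ ≥ 1/2`. -/
structure IsNonclassicalWeight (n : ℕ) (M : ℕ → ℝ) : Prop where
  half : ∀ j, 1 ≤ j → j ≤ n / 2 → IsHalfIntegral (M j)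
  anti : ∀ j, 1 ≤ j → j + 1 ≤ n / 2 → M (j + 1) ≤ M j
  last : 1 / 2 ≤ M (n / 2)

/-- `m_n` is half-integral and dominant for `so_n` in the classical sense:
`M 1 ≥ ⋯ ≥ M p ≥ 0` if `n = 2p + 1` and `M 1 ≥ ⋯ ≥ M (p-1) ≥ |M p|` if `n = 2p`. -/
structure IsClassicalHalfWeight (n : ℕ) (M : ℕ → ℝ) : Prop where
  half : ∀ j, 1 ≤ j → j ≤ n / 2 → IsHalfIntegral (M j)
  anti : ∀ j, 1 ≤ j → j + 1 ≤ n / 2 → M (j + 1) ≤ M j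
  odd_last : ∀ p, n = 2 * p + 1 → 0 ≤ M p
  even_last : ∀ p, 2 ≤ p → n = 2 * p → |M p| ≤ M (p - 1)

/-- What all tableaux with top row `M` share: the rows are `k = n, n-1, …, 2`, row `k` has the
components `j = 1, …, ⌊k/2⌋` (other entries of the array are set to `0`), all components are
half-integral, and row `n` is `M`. -/
structure IsHalfArray (n : ℕ) (M : ℕ → ℝ) (m : Pattern) : Prop where
  supp : ∀ j k, ¬ (2 ≤ k ∧ k ≤ n ∧ 1 ≤ j ∧ j ≤ k / 2) → m j k = 0
  half : ∀ j k, 2 ≤ k → k ≤ n → 1 ≤ j → j ≤ k / 2 → IsHalfIntegral (m j k)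
  top : ∀ j, 1 ≤ j → j ≤ n / 2 → m j n = M j

/-- The tableaux of the nonclassical type representations:
`m_{1,2p+1} ≥ m_{1,2p} ≥ m_{2,2p+1} ≥ m_{2,2p} ≥ ⋯ ≥ m_{p,2p+1} ≥ m_{p,2p} ≥ 1/2` and
`m_{1,2p} ≥ m_{1,2p-1} ≥ m_{2,2p} ≥ m_{2,2p-1} ≥ ⋯ ≥ m_{p-1,2p-1} ≥ m_{p,2p}`. -/
structure IsTableau (n : ℕ) (M : ℕ → ℝ) (m : Pattern) : Prop extends IsHalfArray n M m where
  odd_upper : ∀ p j, 2 * p + 1 ≤ n → 1 ≤ j → j ≤ p → m j (2 * p) ≤ m j (2 * p + 1)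
  odd_lower : ∀ p j, 2 * p + 1 ≤ n → 1 ≤ j → j + 1 ≤ p → m (j + 1) (2 * p + 1) ≤ m j (2 * p)
  odd_last : ∀ p, 1 ≤ p → 2 * p + 1 ≤ n → 1 / 2 ≤ m p (2 * p)
  even_upper : ∀ p j, 2 * p ≤ n → 1 ≤ j → j + 1 ≤ p → m j (2 * p - 1) ≤ m j (2 * p)
  even_lower : ∀ p j, 2 * p ≤ n → 1 ≤ j → j + 1 ≤ p → m (j + 1) (2 * p) ≤ m j (2 * p - 1)

/-- The (half-integral) Gel'fand–Tsetlin tableaux of the classical type representations: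
`m_{1,2p+1} ≥ m_{1,2p} ≥ ⋯ ≥ m_{p,2p+1} ≥ m_{p,2p} ≥ -m_{p,2p+1}` and
`m_{1,2p} ≥ m_{1,2p-1} ≥ m_{2,2p} ≥ ⋯ ≥ m_{p-1,2p-1} ≥ |m_{p,2p}|`. -/
structure IsGTTableau (n : ℕ) (M : ℕ → ℝ) (m : Pattern) : Prop extends IsHalfArray n M m where
  odd_upper : ∀ p j, 2 * p + 1 ≤ n → 1 ≤ j → j ≤ p → m j (2 * p) ≤ m j (2 * p + 1)
  odd_lower : ∀ p j, 2 * p + 1 ≤ n → 1 ≤ j → j + 1 ≤ p → m (j + 1) (2 * p + 1) ≤ m j (2 * p)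
  odd_last : ∀ p, 1 ≤ p → 2 * p + 1 ≤ n → -m p (2 * p + 1) ≤ m p (2 * p)
  even_upper : ∀ p j, 2 * p ≤ n → 1 ≤ j → j + 1 ≤ p → m j (2 * p - 1) ≤ m j (2 * p)
  even_lower : ∀ p j, 2 * p ≤ n → 1 ≤ j → j + 1 ≤ p → m (j + 1) (2 * p) ≤ m j (2 * p - 1)
  even_last : ∀ p, 2 ≤ p → 2 * p ≤ n → |m p (2 * p)| ≤ m (p - 1) (2 * p - 1)

/-- The complex vector space with basis `|ξ⟩`, `ξ` a tableau with top row `M`. -/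
abbrev Space (n : ℕ) (M : ℕ → ℝ) : Type := {m : Pattern // IsTableau n M m} →₀ ℂ

/-- The complex vector space with basis `|ξ⟩`, `ξ` a half-integral Gel'fand–Tsetlin tableau
with top row `M`. -/
abbrev GTSpace (n : ℕ) (M : ℕ → ℝ) : Type := {m : Pattern // IsGTTableau n M m} →₀ ℂ

open Classical in
/-- The vector `|m⟩`; as usual, `|m⟩ = 0` if the array `m` is not an admissible tableau. -/
def ket (P : Pattern → Prop) (m : Pattern) : {m : Pattern // P m} →₀ ℂ :=
  if h : P m then Finsupp.single ⟨m, h⟩ 1 else 0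

/-- The array in which the component `m_{j,k}` is replaced by `m_{j,k} + s`. -/
def shift (m : Pattern) (j k : ℕ) (s : ℝ) : Pattern :=
  fun j' k' => if j' = j ∧ k' = k then m j' k' + s else m j' k'

/-- The `l`-coordinates `l_{j,2p+1} = m_{j,2p+1} + p - j + 1`, `l_{j,2p} = m_{j,2p} + p - j`. -/
def lcoord (m : Pattern) (j k : ℕ) : ℝ :=
  m j k + ((k / 2 : ℕ) : ℝ) - (j : ℝ) + (if Odd k then 1 else 0)

/-! ### Matrix elements -/

/-- `A^j_{2p}`. -/
def coeffA (q : ℝ) (p j : ℕ) (m : Pattern) : ℝ :=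
  Real.sqrt
    (((∏ i ∈ Finset.Icc 1 p,
          qnum q (lcoord m i (2 * p + 1) + lcoord m j (2 * p)) *
          qnum q (lcoord m i (2 * p + 1) - lcoord m j (2 * p) - 1)) *
      (∏ i ∈ Finset.Icc 1 (p - 1),
          qnum q (lcoord m i (2 * p - 1) + lcoord m j (2 * p)) *
          qnum q (lcoord m i (2 * p - 1) - lcoord m j (2 * p) - 1))) /
      (∏ i ∈ (Finset.Icc 1 p).erase j,
          qnum q (lcoord m i (2 * p) + lcoord m j (2 * p)) *
          qnum q (lcoord m i (2 * p) - lcoord m j (2 * p)) *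
          qnum q (lcoord m i (2 * p) + lcoord m j (2 * p) + 1) *
          qnum q (lcoord m i (2 * p) - lcoord m j (2 * p) - 1)))

/-- `B^j_{2p-1}`. -/
def coeffB (q : ℝ) (p j : ℕ) (m : Pattern) : ℝ :=
  Real.sqrt
    (((∏ i ∈ Finset.Icc 1 p,
          qnum q (lcoord m i (2 * p) + lcoord m j (2 * p - 1)) *
          qnum q (lcoord m i (2 * p) - lcoord m j (2 * p - 1))) *
      (∏ i ∈ Finset.Icc 1 (p - 1),
          qnum q (lcoord m i (2 * p - 2) + lcoord m j (2 * p - 1)) *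
          qnum q (lcoord m i (2 * p - 2) - lcoord m j (2 * p - 1)))) /
      (∏ i ∈ (Finset.Icc 1 (p - 1)).erase j,
          qnum q (lcoord m i (2 * p - 1) + lcoord m j (2 * p - 1)) *
          qnum q (lcoord m i (2 * p - 1) - lcoord m j (2 * p - 1)) *
          qnum q (lcoord m i (2 * p - 1) + lcoord m j (2 * p - 1) - 1) *
          qnum q (lcoord m i (2 * p - 1) - lcoord m j (2 * p - 1) - 1)))

/-- `Ĉ_{2p-1}`. -/
def coeffC (q : ℝ) (p : ℕ) (m : Pattern) : ℝ :=
  ((∏ s ∈ Finset.Icc 1 p, qnumPlus q (lcoord m s (2 * p))) *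
    (∏ s ∈ Finset.Icc 1 (p - 1), qnumPlus q (lcoord m s (2 * p - 2)))) /
  (∏ s ∈ Finset.Icc 1 (p - 1),
    qnumPlus q (lcoord m s (2 * p - 1)) * qnumPlus q (lcoord m s (2 * p - 1) - 1))

/-- `D_{2p}`. -/
def coeffD (q : ℝ) (p : ℕ) (m : Pattern) : ℝ :=
  ((∏ i ∈ Finset.Icc 1 p, qnum q (lcoord m i (2 * p + 1) - 1 / 2)) *
    (∏ i ∈ Finset.Icc 1 (p - 1), qnum q (lcoord m i (2 * p - 1) - 1 / 2))) /
  (∏ i ∈ Finset.Icc 1 (p - 1),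
    qnum q (lcoord m i (2 * p) + 1 / 2) * qnum q (lcoord m i (2 * p) - 1 / 2))

/-- A sign, as a complex number. -/
def sgn (e : ℤˣ) : ℂ := ((e : ℤ) : ℂ)

/-- The coefficient of `|ξ^{+j}_{2p}⟩` in the action of `I_{2p+1,2p}` on `|ξ⟩`. -/
def oddUp (q : ℝ) (p j : ℕ) (m : Pattern) : ℝ :=
  coeffA q p j m / (q ^ lcoord m j (2 * p) - q ^ (-lcoord m j (2 * p)))

/-- The coefficient, up to sign, of `|ξ^{-j}_{2p}⟩` in the action of `I_{2p+1,2p}` on `|ξ⟩`. -/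
def oddDown (q : ℝ) (p j : ℕ) (m : Pattern) : ℝ :=
  coeffA q p j (shift m j (2 * p) (-1)) /
    (q ^ lcoord m j (2 * p) - q ^ (-lcoord m j (2 * p)))

/-- The coefficient of `|ξ^{+j}_{2p-1}⟩` in the action of `I_{2p,2p-1}` on `|ξ⟩`. -/
def evenUp (q : ℝ) (p j : ℕ) (m : Pattern) : ℝ :=
  coeffB q p j m /
    (qnum q (2 * lcoord m j (2 * p - 1) - 1) * qnumPlus q (lcoord m j (2 * p - 1)))

/-- The coefficient, up to sign, of `|ξ^{-j}_{2p-1}⟩` in the action of `I_{2p,2p-1}` on `|ξ⟩`. -/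
def evenDown (q : ℝ) (p j : ℕ) (m : Pattern) : ℝ :=
  coeffB q p j (shift m j (2 * p - 1) (-1)) /
    (qnum q (2 * lcoord m j (2 * p - 1) - 1) * qnumPlus q (lcoord m j (2 * p - 1) - 1))

/-- The action of `I_{2p,2p-1}` on `|m⟩` (the same formula for both kinds of tableaux). -/
def evenAction (q : ℝ) (ε : ℕ → ℤˣ) (P : Pattern → Prop) (p : ℕ) (m : Pattern) :
    {m : Pattern // P m} →₀ ℂ :=
  (∑ j ∈ Finset.Icc 1 (p - 1), (evenUp q p j m : ℂ) • ket P (shift m j (2 * p - 1) 1))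
  - (∑ j ∈ Finset.Icc 1 (p - 1), (evenDown q p j m : ℂ) • ket P (shift m j (2 * p - 1) (-1)))
  + (sgn (ε (2 * p)) * (coeffC q p m : ℂ)) • ket P m

open Classical in
/-- The action of `I_{2p+1,2p}` on `|m⟩` in the nonclassical type representation: the diagonal
term is present only if `m_{p,2p} = 1/2`, and then the last sum is from `1` to `p - 1`. -/
def oddAction (q : ℝ) (ε : ℕ → ℤˣ) (P : Pattern → Prop) (p : ℕ) (m : Pattern) :
    {m : Pattern // P m} →₀ ℂ :=
  (if m p (2 * p) = 1 / 2 then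
    (sgn (ε (2 * p + 1)) / ((q ^ (1 / 2 : ℝ) - q ^ (-(1 / 2) : ℝ) : ℝ) : ℂ)
      * (coeffD q p m : ℂ)) • ket P m else 0)
  + (∑ j ∈ Finset.Icc 1 p, (oddUp q p j m : ℂ) • ket P (shift m j (2 * p) 1))
  - (∑ j ∈ Finset.Icc 1 (if m p (2 * p) = 1 / 2 then p - 1 else p),
      (oddDown q p j m : ℂ) • ket P (shift m j (2 * p) (-1)))

/-- The action of `I_{2p+1,2p}` on `|m⟩` in the representation `T'`. -/
def oddAction' (q : ℝ) (P : Pattern → Prop) (p : ℕ) (m : Pattern) :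
    {m : Pattern // P m} →₀ ℂ :=
  (∑ j ∈ Finset.Icc 1 p, (oddUp q p j m : ℂ) • ket P (shift m j (2 * p) 1))
  - (∑ j ∈ Finset.Icc 1 p, (oddDown q p j m : ℂ) • ket P (shift m j (2 * p) (-1)))

/-- The operator `T_{ε,m_n}(I_{k,k-1})`. -/
def opT (q : ℝ) (n : ℕ) (ε : ℕ → ℤˣ) (M : ℕ → ℝ) (k : ℕ) : Module.End ℂ (Space n M) :=
  Finsupp.linearCombination ℂ fun ξ : {m : Pattern // IsTableau n M m} =>
    if Odd k then oddAction q ε (IsTableau n M) (k / 2) ξ.1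
    else evenAction q ε (IsTableau n M) (k / 2) ξ.1

/-- The operator `T'_{m_n}(I_{k,k-1})`; only the signs `ε_2, ε_4, …` enter. -/
def opT' (q : ℝ) (n : ℕ) (ε : ℕ → ℤˣ) (M : ℕ → ℝ) (k : ℕ) : Module.End ℂ (GTSpace n M) :=
  Finsupp.linearCombination ℂ fun ξ : {m : Pattern // IsGTTableau n M m} =>
    if Odd k then oddAction' q (IsGTTableau n M) (k / 2) ξ.1
    else evenAction q ε (IsGTTableau n M) (k / 2) ξ.1

/-- The operators `T k` define a (necessarily unique) representation of `U'_q(so_n)` in which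
`I_{k,k-1}` acts by `T k`. -/
def DefinesRepresentation {V : Type*} [AddCommGroup V] [Module ℂ V] (q : ℝ) (n : ℕ)
    (T : ℕ → Module.End ℂ V) : Prop :=
  ∃! ρ : Uq q n →ₐ[ℂ] Module.End ℂ V, ∀ i : GenIndex n, ρ (Uq.gen q i) = T i.1

/-! ### The invariant subspaces of `T'` -/

/-- A choice of the signs `ε_{2p+1}`, `p = 1, …, ⌊(n-1)/2⌋`. -/
abbrev OddSigns (n : ℕ) : Type := {p : ℕ // p ∈ Finset.Icc 1 ((n - 1) / 2)} → ℤˣ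

/-- The sequence of signs with even-indexed members those of `ε` and with `ε_{2p+1} = δ_p`. -/
def mergeSigns (n : ℕ) (ε : ℕ → ℤˣ) (δ : OddSigns n) (i : ℕ) : ℤˣ :=
  if h : Odd i ∧ i / 2 ∈ Finset.Icc 1 ((n - 1) / 2) then δ ⟨i / 2, h.2⟩ else ε i

/-- The array in which `m_{p,2p}` is replaced by `-m_{p,2p}` for all `p` in `S`. -/
def flip (S : Finset ℕ) (m : Pattern) : Pattern :=
  fun j k => if Even k ∧ j = k / 2 ∧ k / 2 ∈ S then -m j k else m j k

/-- The result of applying `|ξ⟩ ↦ |ξ⟩ - ε_{2p+1} |ξ'⟩` (where `ξ'` is `ξ` with `m_{p,2p}` replaced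
by `-m_{p,2p}`) successively for all `p = 1, …, ⌊(n-1)/2⌋`, written out. -/
def splitVec (n : ℕ) (M : ℕ → ℝ) (δ : OddSigns n) (m : Pattern) : GTSpace n M :=
  ∑ S : Finset {p : ℕ // p ∈ Finset.Icc 1 ((n - 1) / 2)},
    (∏ p ∈ S, -sgn (δ p)) • ket (IsGTTableau n M) (flip (S.map (Function.Embedding.subtype _)) m)

/-- The subspace spanned by the vectors `splitVec`, where `ξ` runs over the tableaux with
`m_{p,2p} ≥ 1/2`. -/
def splitSpace (n : ℕ) (M : ℕ → ℝ) (δ : OddSigns n) : Submodule ℂ (GTSpace n M) :=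
  Submodule.span ℂ (Set.range fun ξ : {m : Pattern // IsTableau n M m} => splitVec n M δ ξ.1)

end QSo

end

/-!
The theorem is first proved for the operators `T'` of the classical type, whose matrix elements
become uniform after a change of coordinates. With `lam m j k = m_{j,k} + k/2 - j` the betweenness
conditions read `|lam m j k| + 1/2 ≤ lam m j (k+1)` and `|lam m (j+1) (k+1)| + 1/2 ≤ lam m j k` for
rows of both parities (`isGTTableau_iff`), and, with `cc q a = q^{2a} + q^{-2a}`, the matrix element
of the move of `y = lam m j k` to `y + 1` is, up to a factor depending on `y` only,
`∏ √|cc a - cc (y + 1/2)| / ∏ √(|cc b - cc y| |cc b - cc (y + 1)|)`, where `a` runs over the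
components of the two adjacent rows and `b` over the other components of the row (`coef`,
`IsGTTableau.coef_step_eq`); a move to `y - 1` is that of `-y` to `-y + 1`. The generators moving odd
rows have, in addition, a diagonal term, which is treated as one more move. A matrix element vanishes
if the move leaves the set of tableaux (`IsGTTableau.coef_eq_zero`), so that products of operators
are sums over all paths of moves.

Let `S` and `T` move two adjacent rows. The matrix elements of `S² T - (q + q⁻¹) S T S + T S²` are
sums of contributions `pathSum` of a move `t` of the row of `T` and two moves `s₁`, `s₂` of the row
of `S`. If `s₁` and `s₂` are not opposite, then exchanging them changes the sign of the contribution,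
by an identity of `q`-numbers which involves only the moving components
(`AdjacentRows.pathSum_add_pathSum`). If they are opposite, all square roots disappear, and the
contribution is minus the matrix element of `t` times `P(v_s) / ∏ (v_s - v_{s'})` for a monic
polynomial `P`, where the node `v_s` is `cc (y + 1/2)`, or `-2` for the diagonal term. The sum of
these quotients over all moves of the row is the leading coefficient of `P`, which is `1`, by
Lagrange interpolation (`sum_eval_div_prod_sub`, `AdjacentRows.sum_pathSum_opp`). Nodes may coincide,
but only if components of the adjacent rows are squeezed between two components of the row; then `P`
vanishes there (`IsGTTableau.prod_X_sub_C_node_dvd`), and the terms drop out. Hence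
`S² T - (q + q⁻¹) S T S + T S² = -T`, which for the two orders of the rows gives both cubic
relations.

For the other two assertions, note that `lam m p (2p) = m_{p,2p}`, and that all conditions and matrix
elements involve `m_{p,2p}` only up to sign; so the reflections `m_{p,2p} ↦ -m_{p,2p}` of tableaux
commute with the operators `T'` (`opT'_reflect`). Their joint eigenspaces are the subspaces
`splitSpace n M δ` (`splitSpace_isInternal`). The tableaux of the nonclassical type are
those with all `m_{p,2p}` positive, one in each orbit of the reflections, and in the basis `splitVec`
which they give of an eigenspace the operators `T'` act as `T`: the only move which leads to a negative
`m_{p,2p}` is that of `1/2` to `-1/2`, which is the reflection, hence gives a multiple of the original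
vector, the diagonal term with `D_{2p}` (`IsGTTableau.coeffD_eq`, `splitMap_opT`). The relations for
`T` follow, as `splitMap` is injective and intertwines `T` with `T'`.
-/

noncomputable section

namespace QSo

open Finset

/-! ### `q`-numbers -/

section

/-- `q^a - q^{-a}`. -/
def sn (q a : ℝ) : ℝ := q ^ a - q ^ (-a)

/-- `q^a + q^{-a}`. -/
def cs (q a : ℝ) : ℝ := q ^ a + q ^ (-a)

/-- `q^{2a} + q^{-2a}`. -/
def cc (q a : ℝ) : ℝ := cs q (2 * a)

theorem sn_neg (q a : ℝ) : sn q (-a) = -sn q a := by simp [sn]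

theorem cs_neg (q a : ℝ) : cs q (-a) = cs q a := by simp [cs, add_comm]

theorem cc_neg (q a : ℝ) : cc q (-a) = cc q a := by
  rw [cc, cc, mul_neg, cs_neg]

theorem cs_zero (q : ℝ) : cs q 0 = 2 := by simp [cs]; norm_num

theorem sn_zero (q : ℝ) : sn q 0 = 0 := by simp [sn]

theorem cs_one (q : ℝ) : cs q 1 = q + q⁻¹ := by simp [cs, Real.rpow_neg_one]

theorem sn_one (q : ℝ) : sn q 1 = q - q⁻¹ := by simp [sn, Real.rpow_neg_one]

theorem cc_abs (q a : ℝ) : cc q |a| = cc q a := by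
  rcases abs_choice a with h | h <;> rw [h]
  exact cc_neg _ _

section
variable {q : ℝ} (hq : 0 < q)
include hq

theorem cs_pos (a : ℝ) : 0 < cs q a := by unfold cs; positivity

theorem sn_mul_sn (a b : ℝ) : sn q a * sn q b = cs q (a + b) - cs q (a - b) := by
  have := Real.rpow_pos_of_pos hq a
  have := Real.rpow_pos_of_pos hq b
  simp only [sn, cs, neg_add, neg_sub, Real.rpow_add hq, Real.rpow_sub hq, Real.rpow_neg hq.le]
  field_simp
  ring

theorem cs_mul_cs (a b : ℝ) : cs q a * cs q b = cs q (a + b) + cs q (a - b) := by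
  have := Real.rpow_pos_of_pos hq a
  have := Real.rpow_pos_of_pos hq b
  simp only [cs, neg_add, neg_sub, Real.rpow_add hq, Real.rpow_sub hq, Real.rpow_neg hq.le]
  field_simp
  ring

theorem sn_mul_cs (a b : ℝ) : sn q a * cs q b = sn q (a + b) + sn q (a - b) := by
  have := Real.rpow_pos_of_pos hq a
  have := Real.rpow_pos_of_pos hq b
  simp only [sn, cs, neg_add, neg_sub, Real.rpow_add hq, Real.rpow_sub hq, Real.rpow_neg hq.le]
  field_simp
  ring

theorem sn_two_mul (a : ℝ) : sn q (2 * a) = sn q a * cs q a := by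
  rw [sn_mul_cs hq, sub_self, sn_zero, add_zero, two_mul]

theorem cc_sub_cc (a b : ℝ) : cc q a - cc q b = sn q (a + b) * sn q (a - b) := by
  rw [sn_mul_sn hq, cc, cc]; congr 2 <;> ring

theorem cc_add_cc (a b : ℝ) : cc q a + cc q b = cs q (a + b) * cs q (a - b) := by
  rw [cs_mul_cs hq, cc, cc]; congr 2 <;> ring

theorem cc_add_two (a : ℝ) : cc q a + 2 = cs q a ^ 2 := by
  rw [sq, cs_mul_cs hq, sub_self, cs_zero, cc, two_mul]

theorem cc_pos (a : ℝ) : 0 < cc q a := cs_pos hq _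

end

section
variable {q : ℝ} (hq : 0 < q) (hq1 : q ≠ 1)
include hq hq1

theorem sn_eq_zero_iff {a : ℝ} : sn q a = 0 ↔ a = 0 := by
  rw [sn, sub_eq_zero]
  constructor
  · intro h
    have := (Real.rpow_right_inj hq hq1).1 h
    linarith
  · rintro rfl; simp

theorem sn_one_ne_zero : sn q 1 ≠ 0 := by
  rw [Ne, sn_eq_zero_iff hq hq1]; norm_num

theorem sn_mul_sn_nonneg {a b : ℝ} (ha : 0 ≤ a) (hb : 0 ≤ b) : 0 ≤ sn q a * sn q b := by
  rcases lt_or_gt_of_ne hq1 with h | h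
  · refine mul_nonneg_of_nonpos_of_nonpos ?_ ?_ <;> rw [sn, sub_nonpos] <;>
      exact Real.rpow_le_rpow_of_exponent_ge hq h.le (by linarith)
  · refine mul_nonneg ?_ ?_ <;> rw [sn, sub_nonneg] <;>
      exact Real.rpow_le_rpow_of_exponent_le h.le (by linarith)

theorem cc_le_cc {a b : ℝ} (h : |a| ≤ |b|) : cc q a ≤ cc q b := by
  rw [← cc_abs q a, ← cc_abs q b, ← sub_nonneg, cc_sub_cc hq]
  exact sn_mul_sn_nonneg hq hq1 (by positivity) (by linarith)

theorem cc_eq_cc_iff {a b : ℝ} : cc q a = cc q b ↔ |a| = |b| := by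
  rw [← sub_eq_zero, cc_sub_cc hq, mul_eq_zero, sn_eq_zero_iff hq hq1, sn_eq_zero_iff hq hq1,
    abs_eq_abs, add_eq_zero_iff_eq_neg, sub_eq_zero, or_comm]

/-- A sign that makes all `sn q a` with `a ≥ 0` nonnegative. -/
theorem exists_abs_sn_of_nonneg : ∃ θ : ℝ, θ * θ = 1 ∧ ∀ a, 0 ≤ a → |sn q a| = θ * sn q a := by
  rcases lt_or_gt_of_ne hq1 with h | h
  · refine ⟨-1, by norm_num, fun a ha => ?_⟩
    rw [neg_one_mul, abs_of_nonpos]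
    rw [sn, sub_nonpos]
    exact Real.rpow_le_rpow_of_exponent_ge hq h.le (by linarith)
  · refine ⟨1, by norm_num, fun a ha => ?_⟩
    rw [one_mul, abs_of_nonneg]
    rw [sn, sub_nonneg]
    exact Real.rpow_le_rpow_of_exponent_le h.le (by linarith)

/-- Over numbers which are all nonnegative or all nonpositive, `|sn q a|` is `sn q a` times a
common sign. -/
theorem exists_abs_sn {p : ℝ → Prop} (h : (∀ a, p a → 0 ≤ a) ∨ ∀ a, p a → a ≤ 0) :
    ∃ θ : ℝ, θ * θ = 1 ∧ ∀ a, p a → |sn q a| = θ * sn q a := by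
  obtain ⟨θ, h1, h2⟩ := exists_abs_sn_of_nonneg hq hq1
  rcases h with h | h
  · exact ⟨θ, h1, fun a ha => h2 a (h a ha)⟩
  · refine ⟨-θ, by linarith, fun a ha => ?_⟩
    have := h2 (-a) (by linarith [h a ha])
    rw [sn_neg, abs_neg] at this
    linarith

end

section
variable {q : ℝ} (hq : 0 < q)
include hq

/-- The identity behind the exchange of the moves of two components of a row past the move of
a component of an adjacent row. -/
theorem exchange_identity (a b h : ℝ) :
    (sn q (b - a + (h + h)) + sn q (b - a - (h + h))) *
      (sn q (a - h) * sn q (b - h) + sn q (a + h) * sn q (b + h)) =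
    cs q (h + h) * (sn q (b - a + (h + h)) * sn q (a + h) * sn q (b - h)
      + sn q (b - a - (h + h)) * sn q (b + h) * sn q (a - h)) := by
  have := Real.rpow_pos_of_pos hq a
  have := Real.rpow_pos_of_pos hq b
  have := Real.rpow_pos_of_pos hq h
  simp only [sn, cs, neg_add, neg_sub, Real.rpow_add hq, Real.rpow_sub hq, Real.rpow_neg hq.le]
  field_simp
  ring

/-- The variant of `exchange_identity` in which the adjacent row contributes its diagonal term. -/
theorem exchange_identity_cs (a b h : ℝ) :
    (sn q (b - a + h) + sn q (b - a - h)) *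
      (cs q a * cs q b + cs q (a + h) * cs q (b + h)) =
    cs q h * (sn q (b - a + h) * cs q (a + h) * cs q b
      + sn q (b - a - h) * cs q (b + h) * cs q a) := by
  have := Real.rpow_pos_of_pos hq a
  have := Real.rpow_pos_of_pos hq b
  have := Real.rpow_pos_of_pos hq h
  simp only [sn, cs, neg_add, neg_sub, Real.rpow_add hq, Real.rpow_sub hq, Real.rpow_neg hq.le]
  field_simp
  ring

/-- The variant of `exchange_identity` in which one of the two components is replaced by the
diagonal term of their row. -/
theorem exchange_identity_loop (x y h : ℝ) :
    (cs q (y + h + h + h) + cs q (y - h)) *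
      (cs q (x + h + h) * sn q (y - x - h) + cs q x * sn q (y - x + h)) =
    cs q (h + h) * (cs q (y + h + h + h) * cs q x * sn q (y - x - h)
      + cs q (y - h) * sn q (y - x + h) * cs q (x + h + h)) := by
  have := Real.rpow_pos_of_pos hq x
  have := Real.rpow_pos_of_pos hq y
  have := Real.rpow_pos_of_pos hq h
  simp only [sn, cs, neg_add, neg_sub, Real.rpow_add hq, Real.rpow_sub hq, Real.rpow_neg hq.le]
  field_simp
  ring

end

end

/-! ### Tableaux and betweenness -/

section

/-- The shifted component `m_{j,k} + k/2 - j`: this is `l_{j,k}` for even `k` and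
`l_{j,k} - 1/2` for odd `k`. With this choice of the origin rows of both parities obey the same
rules. -/
def lam (m : Pattern) (j k : ℕ) : ℝ := m j k + (k : ℝ) / 2 - j

theorem lam_shift (m : Pattern) (j k : ℕ) (s : ℝ) (j' k' : ℕ) :
    lam (shift m j k s) j' k' = lam m j' k' + if j' = j ∧ k' = k then s else 0 := by
  unfold lam shift
  split_ifs <;> ring

theorem lam_shift_self (m : Pattern) (j k : ℕ) (s : ℝ) :
    lam (shift m j k s) j k = lam m j k + s := by simp [lam_shift]

theorem lam_shift_of_ne_row (m : Pattern) (j k : ℕ) (s : ℝ) (j' : ℕ) {k' : ℕ} (h : k' ≠ k) :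
    lam (shift m j k s) j' k' = lam m j' k' := by simp [lam_shift, h]

theorem lam_shift_of_ne (m : Pattern) {j : ℕ} (k : ℕ) (s : ℝ) {j' : ℕ} (k' : ℕ) (h : j' ≠ j) :
    lam (shift m j k s) j' k' = lam m j' k' := by simp [lam_shift, h]

theorem shift_zero (m : Pattern) (j k : ℕ) : shift m j k 0 = m := by
  funext j' k'; simp [shift]

theorem shift_comm (m : Pattern) (j k : ℕ) (s : ℝ) (j' k' : ℕ) (s' : ℝ) :
    shift (shift m j k s) j' k' s' = shift (shift m j' k' s') j k s := by
  funext a b; simp only [shift]; split_ifs <;> ring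

theorem shift_shift_neg (m : Pattern) (j k : ℕ) (s : ℝ) :
    shift (shift m j k s) j k (-s) = m := by
  funext a b; simp only [shift]; split_ifs <;> ring

theorem exists_lam_eq {n : ℕ} {M : ℕ → ℝ} {m : Pattern} (h : IsHalfArray n M m) {j k : ℕ}
    (hk : 2 ≤ k) (hkn : k ≤ n) (hj : 1 ≤ j) (hjk : j ≤ k / 2) :
    ∃ a : ℤ, lam m j k = a + 1 / 2 + (k : ℝ) / 2 := by
  obtain ⟨a, ha⟩ := h.half j k hk hkn hj hjk
  exact ⟨a - j, by rw [lam, ha]; push_cast; ring⟩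

theorem exists_two_mul_lam_eq {n : ℕ} {M : ℕ → ℝ} {m : Pattern} (h : IsHalfArray n M m)
    {j k : ℕ} (hk : 2 ≤ k) (hkn : k ≤ n) (hj : 1 ≤ j) (hjk : j ≤ k / 2) :
    ∃ a : ℤ, lam m j k = a / 2 ∧ a % 2 = (k + 1) % 2 := by
  obtain ⟨a, ha⟩ := exists_lam_eq h hk hkn hj hjk
  exact ⟨2 * a + 1 + k, by rw [ha]; push_cast; ring, by omega⟩

/-- The betweenness conditions in terms of the shifted components; it is the same for the pairs
of rows `2p+1, 2p` and `2p, 2p-1`. -/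
structure Interlaces (n : ℕ) (m : Pattern) : Prop where
  upper : ∀ k j, 2 ≤ k → k + 1 ≤ n → 1 ≤ j → j ≤ k / 2 →
    |lam m j k| + 1 / 2 ≤ lam m j (k + 1)
  lower : ∀ k j, 2 ≤ k → k + 1 ≤ n → 1 ≤ j → j + 1 ≤ (k + 1) / 2 →
    |lam m (j + 1) (k + 1)| + 1 / 2 ≤ lam m j k

namespace IsGTTableau
variable {n : ℕ} {M : ℕ → ℝ} {m : Pattern} (h : IsGTTableau n M m)
include h

theorem nonneg_odd (p j : ℕ) (hp : 2 * p + 1 ≤ n) (hj : 1 ≤ j) (hjp : j ≤ p) :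
    0 ≤ m j (2 * p + 1) := by
  induction hjp using Nat.decreasingInduction with
  | self =>
    have h1 := h.odd_upper p p hp hj le_rfl
    have h2 := h.odd_last p hj hp
    linarith
  | of_succ i hi ih =>
    have h1 := h.odd_upper p i hp hj hi.le
    have h2 := h.odd_lower p i hp hj hi
    linarith [ih (by omega)]

theorem interlaces : Interlaces n m where
  upper := by
    intro k j hk hkn hj hjk
    rcases Nat.even_or_odd' k with ⟨p, rfl | rfl⟩
    · have hjp : j ≤ p := by omega
      have h1 := h.odd_upper p j hkn hj hjp
      have h2 : -m j (2 * p + 1) ≤ m j (2 * p) := by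
        rcases hjp.eq_or_lt with rfl | hlt
        · exact h.odd_last _ hj hkn
        · have := h.odd_lower p j hkn hj hlt
          have h3 := h.nonneg_odd p (j + 1) hkn (by omega) hlt
          have h4 := h.nonneg_odd p j hkn (by omega) hjp
          linarith
      have hj' : (j : ℝ) ≤ p := by exact_mod_cast hjp
      rw [← le_sub_iff_add_le, abs_le]
      simp only [lam]; push_cast
      constructor <;> linarith
    · have hjp : j ≤ p := by omega
      have h1 := h.even_upper (p + 1) j hkn hj (by omega)
      have h2 := h.nonneg_odd p j (by omega) hj hjp
      have hj' : (j : ℝ) ≤ p := by exact_mod_cast hjp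
      rw [show 2 * (p + 1) - 1 = 2 * p + 1 by omega] at h1
      rw [abs_of_nonneg] <;> simp only [lam] <;> push_cast
      · rw [show 2 * p + 1 + 1 = 2 * (p + 1) by ring]; linarith
      · linarith
  lower := by
    intro k j hk hkn hj hjk
    rcases Nat.even_or_odd' k with ⟨p, rfl | rfl⟩
    · have hjp : j + 1 ≤ p := by omega
      have h1 := h.odd_lower p j hkn hj hjp
      have h2 := h.nonneg_odd p (j + 1) hkn (by omega) hjp
      have hj' : (j : ℝ) + 1 ≤ p := by exact_mod_cast hjp
      rw [abs_of_nonneg] <;> simp only [lam] <;> push_cast <;> linarith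
    · have hjp : j ≤ p := by omega
      have hj' : (j : ℝ) ≤ p := by exact_mod_cast hjp
      have h1 := h.even_lower (p + 1) j hkn hj (by omega)
      rw [show 2 * (p + 1) - 1 = 2 * p + 1 by omega] at h1
      have h2 : -m (j + 1) (2 * (p + 1)) ≤ m j (2 * p + 1) + 2 * (p - j) := by
        rcases hjp.eq_or_lt with rfl | hlt
        · have := h.even_last (j + 1) (by omega) hkn
          rw [show 2 * (j + 1) - 1 = 2 * j + 1 by omega] at this
          have := neg_abs_le (m (j + 1) (2 * (j + 1)))
          simp only [Nat.add_sub_cancel] at *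
          linarith
        · have h3 := h.even_upper (p + 1) (j + 1) hkn (by omega) (by omega)
          rw [show 2 * (p + 1) - 1 = 2 * p + 1 by omega] at h3
          have h4 := h.nonneg_odd p (j + 1) (by omega) (by omega) hlt
          have h5 := h.nonneg_odd p j (by omega) (by omega) hjp
          linarith
      rw [← le_sub_iff_add_le, abs_le]
      rw [show 2 * p + 1 + 1 = 2 * (p + 1) by ring]
      simp only [lam]; push_cast
      constructor <;> linarith

end IsGTTableau

theorem isGTTableau_iff {n : ℕ} {M : ℕ → ℝ} {m : Pattern} :
    IsGTTableau n M m ↔ IsHalfArray n M m ∧ Interlaces n m := by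
  refine ⟨fun h => ⟨h.toIsHalfArray, h.interlaces⟩,
    fun ⟨h, hi⟩ => ⟨h, ?_, ?_, ?_, ?_, ?_, ?_⟩⟩
  · intro p j hp hj hjp
    have := hi.upper (2 * p) j (by omega) hp hj (by omega)
    have := le_abs_self (lam m j (2 * p))
    simp only [lam] at *; push_cast at *; linarith
  · intro p j hp hj hjp
    have := hi.lower (2 * p) j (by omega) hp hj (by omega)
    have := le_abs_self (lam m (j + 1) (2 * p + 1))
    simp only [lam] at *; push_cast at *; linarith
  · intro p hp hpn
    have := hi.upper (2 * p) p (by omega) hpn hp (by omega)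
    have := neg_abs_le (lam m p (2 * p))
    simp only [lam] at *; push_cast at *; linarith
  · intro p j hp hj hjp
    obtain ⟨p, rfl⟩ : ∃ r, p = r + 1 := ⟨p - 1, by omega⟩
    rw [show 2 * (p + 1) - 1 = 2 * p + 1 by omega]
    have := hi.upper (2 * p + 1) j (by omega) hp hj (by omega)
    have := le_abs_self (lam m j (2 * p + 1))
    rw [show 2 * p + 1 + 1 = 2 * (p + 1) by ring] at *
    simp only [lam] at *; push_cast at *; linarith
  · intro p j hp hj hjp
    obtain ⟨p, rfl⟩ : ∃ r, p = r + 1 := ⟨p - 1, by omega⟩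
    rw [show 2 * (p + 1) - 1 = 2 * p + 1 by omega]
    have := hi.lower (2 * p + 1) j (by omega) hp hj (by omega)
    have := le_abs_self (lam m (j + 1) (2 * p + 1 + 1))
    rw [show 2 * p + 1 + 1 = 2 * (p + 1) by ring] at *
    simp only [lam] at *; push_cast at *; linarith
  · intro p hp hpn
    obtain ⟨p, rfl⟩ : ∃ r, p = r + 1 := ⟨p - 1, by omega⟩
    rw [show 2 * (p + 1) - 1 = 2 * p + 1 by omega]
    have := hi.lower (2 * p + 1) p (by omega) hpn (by omega) (by omega)
    have := le_abs_self (lam m (p + 1) (2 * p + 1 + 1))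
    have := neg_abs_le (lam m (p + 1) (2 * p + 1 + 1))
    rw [show 2 * p + 1 + 1 = 2 * (p + 1) by ring] at *
    simp only [Nat.add_sub_cancel]
    rw [abs_le]
    simp only [lam] at *; push_cast at *; constructor <;> linarith

namespace Interlaces
variable {n : ℕ} {m : Pattern} (h : Interlaces n m)
include h

theorem abs_succ_le {k j : ℕ} (hkn : k + 1 ≤ n) (hj : 1 ≤ j) (hjk : j + 1 ≤ k / 2) :
    |lam m (j + 1) k| + 1 ≤ lam m j k := by
  have h1 := h.lower k j (by omega) hkn hj (by omega)
  have h2 := h.upper k (j + 1) (by omega) hkn (by omega) hjk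
  have := le_abs_self (lam m (j + 1) (k + 1))
  linarith

theorem abs_le_of_lt {k i j : ℕ} (hkn : k + 1 ≤ n) (hi : 1 ≤ i) (hij : i < j) (hjk : j ≤ k / 2) :
    |lam m j k| + 1 ≤ lam m i k := by
  induction j, hij using Nat.le_induction with
  | base => exact h.abs_succ_le hkn hi hjk
  | succ j hij ih =>
    have h1 := ih (by omega)
    have h2 := h.abs_succ_le hkn (by omega) hjk
    have := le_abs_self (lam m j k)
    linarith

theorem abs_le_of_le {k i j : ℕ} (hkn : k + 1 ≤ n) (hi : 1 ≤ i) (hij : i ≤ j) (hjk : j ≤ k / 2) :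
    |lam m j k| ≤ |lam m i k| := by
  rcases hij.eq_or_lt with rfl | h1
  · exact le_rfl
  · linarith [h.abs_le_of_lt hkn hi h1 hjk, le_abs_self (lam m i k)]

theorem abs_ne {k i j : ℕ} (hkn : k + 1 ≤ n) (hi : 1 ≤ i) (hj : 1 ≤ j) (hij : i ≠ j)
    (hik : i ≤ k / 2) (hjk : j ≤ k / 2) : |lam m i k| ≠ |lam m j k| := by
  rcases lt_or_gt_of_ne hij with h1 | h1
  · linarith [h.abs_le_of_lt hkn hi h1 hjk, le_abs_self (lam m i k)]
  · linarith [h.abs_le_of_lt hkn hj h1 hik, le_abs_self (lam m j k)]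

/-- If two components of a row are as close as possible, then they are neighbours, and the
component of the row above, as well as that of the row below, which lies between them is
determined. -/
theorem squeeze {k i j : ℕ} (hkn : k + 1 ≤ n) (hi : 1 ≤ i) (hj : 1 ≤ j)
    (hik : i ≤ k / 2) (hjk : j ≤ k / 2) (hij : |lam m i k| = |lam m j k| + 1) :
    j = i + 1 ∧ lam m j (k + 1) = |lam m j k| + 1 / 2 ∧
      lam m i (k - 1) = |lam m j k| + 1 / 2 := by
  have hlt : i < j := by
    by_contra hc
    linarith [h.abs_le_of_le hkn hj (not_lt.1 hc) hik]
  obtain rfl : j = i + 1 := by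
    by_contra hc
    have h1 := h.abs_le_of_lt hkn (by omega) (show i + 1 < j by omega) hjk
    have h2 := h.abs_le_of_lt hkn hi (Nat.lt_succ_self i) (by omega)
    have h3 := h.abs_le_of_lt hkn hi hlt hjk
    have h4 : |lam m i k| = lam m i k :=
      abs_of_nonneg (by linarith [abs_nonneg (lam m j k)])
    linarith [le_abs_self (lam m (i + 1) k)]
  refine ⟨rfl, ?_⟩
  have h3 := h.abs_le_of_lt hkn hi hlt hjk
  have h4 : |lam m i k| = lam m i k :=
    abs_of_nonneg (by linarith [abs_nonneg (lam m (i + 1) k)])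
  constructor
  · have h1 := h.lower k i (by omega) hkn hi (by omega)
    have h2 := h.upper k (i + 1) (by omega) hkn (by omega) hjk
    have := le_abs_self (lam m (i + 1) (k + 1))
    linarith
  · obtain ⟨k, rfl⟩ : ∃ r, k = r + 1 := ⟨k - 1, by omega⟩
    have h1 := h.lower k i (by omega) (by omega) hi (by omega)
    have h2 := h.upper k i (by omega) (by omega) hi (by omega)
    have := le_abs_self (lam m i k)
    simp only [Nat.add_sub_cancel]
    linarith

end Interlaces

/-- The positions of the components of the rows `k + 1` and `k - 1`. -/
def nb (k : ℕ) : Finset (ℕ × ℕ) :=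
  Icc 1 ((k + 1) / 2) ×ˢ {k + 1} ∪ Icc 1 ((k - 1) / 2) ×ˢ {k - 1}

theorem mem_nb {k : ℕ} {a : ℕ × ℕ} : a ∈ nb k ↔
    1 ≤ a.1 ∧ (a.1 ≤ (k + 1) / 2 ∧ a.2 = k + 1 ∨ a.1 ≤ (k - 1) / 2 ∧ a.2 = k - 1) := by
  simp only [nb, mem_union, mem_product, mem_Icc, mem_singleton]; tauto

theorem prod_nb {α : Type*} [CommMonoid α] (k : ℕ) (F : ℕ × ℕ → α) :
    ∏ a ∈ nb k, F a = (∏ i ∈ Icc 1 ((k + 1) / 2), F (i, k + 1)) *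
      ∏ i ∈ Icc 1 ((k - 1) / 2), F (i, k - 1) := by
  rw [nb, prod_union, prod_product, prod_product]
  · simp
  · rw [disjoint_left]
    intro a h1 h2
    simp only [mem_product, mem_singleton] at h1 h2
    omega

theorem card_nb (k : ℕ) : #(nb k) = (k + 1) / 2 + (k - 1) / 2 := by
  rw [nb, card_union_of_disjoint]
  · simp
  · rw [disjoint_left]
    intro a h1 h2
    simp only [mem_product, mem_singleton] at h1 h2
    omega

/-- The sign of `|m_a| - |m_{j,k}|` (for shifted components) for the positions `a` in the rows
next to row `k`. -/
def nbSign (j k : ℕ) (a : ℕ × ℕ) : ℝ :=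
  if a.2 = k + 1 then (if a.1 ≤ j then 1 else -1) else (if a.1 < j then 1 else -1)

theorem nbSign_mul_self (j k : ℕ) (a : ℕ × ℕ) : nbSign j k a * nbSign j k a = 1 := by
  unfold nbSign; split_ifs <;> norm_num

/-- The number of adjacent components below `m_{j,k}` is even: by the betweenness conditions both
adjacent rows have the same number of them. -/
theorem prod_nbSign {j k : ℕ} (hj : 1 ≤ j) (hk : 1 ≤ k) : ∏ a ∈ nb k, nbSign j k a = 1 := by
  have key : ∀ N, (∏ i ∈ Icc 1 (N + 1), (if i ≤ j then (1 : ℝ) else -1)) *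
      ∏ i ∈ Icc 1 N, (if i < j then (1 : ℝ) else -1) = 1 := by
    intro N
    induction N with
    | zero => simp [hj]
    | succ N ih =>
      rw [prod_Icc_succ_top (show 1 ≤ N + 1 + 1 by omega),
        prod_Icc_succ_top (show 1 ≤ N + 1 by omega)
        fun i => if i < j then (1 : ℝ) else -1, mul_mul_mul_comm, ih, one_mul]
      by_cases h : N + 1 < j
      · rw [if_pos h, if_pos (by omega)]; norm_num
      · rw [if_neg h, if_neg (by omega)]; norm_num
  rw [prod_nb, show (k + 1) / 2 = (k - 1) / 2 + 1 by omega, ← key ((k - 1) / 2)]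
  congr 1
  · simp [nbSign]
  · refine prod_congr rfl fun i _ => ?_
    rw [nbSign, if_neg (show ¬ k - 1 = k + 1 by omega)]

end

/-! ### Local identities for the matrix elements -/

section

/-- The factor by which a shifted component `a` of an adjacent row enters the matrix element of
a move of the shifted component `y` to `y + 1`. It depends only on `|a|` and `|y + 1/2|`, and
vanishes if the move crosses `a`. -/
def nf (q y a : ℝ) : ℝ := √|cc q a - cc q (y + 1 / 2)|

theorem nf_mul_self (q y x : ℝ) : nf q y x * nf q y x = |cc q x - cc q (y + 1 / 2)| :=
  Real.mul_self_sqrt (abs_nonneg _)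

theorem nf_neg_right (q y a : ℝ) : nf q y (-a) = nf q y a := by rw [nf, nf, cc_neg]

section
variable {q : ℝ} (hq : 0 < q)
include hq

theorem nf_eq (y x : ℝ) :
    nf q y x = √|sn q (x + y + 1 / 2)| * √|sn q (y - x + 1 / 2)| := by
  rw [nf, cc_sub_cc hq, abs_mul, Real.sqrt_mul (abs_nonneg _), ← add_assoc,
    show x - (y + 1 / 2) = -(y - x + 1 / 2) by ring, sn_neg, abs_neg]

theorem nf_mul_nf_right (y x : ℝ) : nf q y x * nf q x (y + 1) =
    √|sn q (x + y + 1 / 2)| * √|sn q (x + y + 3 / 2)| * |sn q (y - x + 1 / 2)| := by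
  rw [nf_eq hq, nf_eq hq, show y + 1 + x + 1 / 2 = x + y + 3 / 2 by ring,
    show x - (y + 1) + 1 / 2 = -(y - x + 1 / 2) by ring, sn_neg, abs_neg]
  linear_combination √|sn q (x + y + 1 / 2)| * √|sn q (x + y + 3 / 2)| *
    Real.mul_self_sqrt (abs_nonneg (sn q (y - x + 1 / 2)))

theorem nf_mul_nf_left (y x : ℝ) : nf q y (x + 1) * nf q x y =
    √|sn q (x + y + 1 / 2)| * √|sn q (x + y + 3 / 2)| * |sn q (y - x - 1 / 2)| := by
  rw [nf_eq hq, nf_eq hq, show x + 1 + y + 1 / 2 = x + y + 3 / 2 by ring,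
    show y - (x + 1) + 1 / 2 = y - x - 1 / 2 by ring,
    show x - y + 1 / 2 = -(y - x - 1 / 2) by ring, sn_neg, abs_neg, add_comm y x]
  linear_combination √|sn q (x + y + 1 / 2)| * √|sn q (x + y + 3 / 2)| *
    Real.mul_self_sqrt (abs_nonneg (sn q (y - x - 1 / 2)))

/-- A component `y` moves and returns, with the diagonal term for an adjacent row. -/
theorem local_loop_diag (y : ℝ) : 2 * cs q y - cs q 1 * cs q (y + 1) = -sn q 1 * sn q (y + 1) := by
  have h1 := sn_mul_sn hq (y + 1) 1
  have h2 := cs_mul_cs hq (y + 1) 1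
  rw [show y + 1 - 1 = y by ring] at h1 h2
  linear_combination h1 - h2

/-- The diagonal term twice, while a component `x` of an adjacent row moves. -/
theorem local_loop_loop (x : ℝ) : cs q (x + 1) * cs q (x + 1) - cs q 1 * (cs q x * cs q (x + 1)) +
    cs q x * cs q x = -(sn q 1 * sn q 1) := by
  have h1 := cs_mul_cs hq (x + 1) (x + 1)
  have h2 := cs_mul_cs hq x x
  have h3 := cs_mul_cs hq (x + 1) x
  have h4 := cs_mul_cs hq (x + 1 + x) 1
  have h5 := cs_mul_cs hq 1 1
  have h6 := sn_mul_sn hq 1 1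
  rw [sub_self, cs_zero] at h1 h2 h5 h6
  rw [show x + 1 - x = 1 by ring] at h3
  rw [show x + 1 + x + 1 = x + 1 + (x + 1) by ring, show x + 1 + x - 1 = x + x by ring] at h4
  linear_combination h1 + h2 - cs q 1 * h3 - h4 - h5 + h6

end

section
variable {q : ℝ} (hq : 0 < q) (hq1 : q ≠ 1)
include hq hq1

/-- Two consecutive integers do not have opposite signs. -/
theorem exists_abs_sn_pair {a : ℝ} (ha : ∃ z : ℤ, a = z) :
    ∃ θ : ℝ, θ * θ = 1 ∧ |sn q a| = θ * sn q a ∧ |sn q (a + 1)| = θ * sn q (a + 1) := by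
  obtain ⟨z, rfl⟩ := ha
  obtain ⟨θ, h1, h2⟩ := exists_abs_sn hq hq1 (p := fun b => b = z ∨ b = z + 1) (by
    rcases lt_or_ge z 0 with h | h
    · right
      have : (z : ℝ) + 1 ≤ 0 := by exact_mod_cast h
      rintro b (rfl | rfl) <;> linarith
    · left
      have : (0 : ℝ) ≤ z := by exact_mod_cast h
      rintro b (rfl | rfl) <;> linarith)
  exact ⟨θ, h1, h2 _ (Or.inl rfl), h2 _ (Or.inr rfl)⟩

/-- The two neighbours of a nonzero integer do not have opposite signs. -/
theorem exists_abs_sn_triple {a : ℝ} (ha : ∃ z : ℤ, a = z) (h0 : a ≠ 0) :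
    ∃ θ : ℝ, |sn q (a - 1)| = θ * sn q (a - 1) ∧ |sn q a| = θ * sn q a ∧
      |sn q (a + 1)| = θ * sn q (a + 1) := by
  obtain ⟨z, rfl⟩ := ha
  have hz : z ≠ 0 := by exact_mod_cast h0
  obtain ⟨θ, -, h2⟩ := exists_abs_sn hq hq1 (p := fun b => b = z - 1 ∨ b = z ∨ b = z + 1) (by
    rcases lt_or_gt_of_ne hz with h | h
    · right
      have : (z : ℝ) + 1 ≤ 0 := by exact_mod_cast h
      rintro b (rfl | rfl | rfl) <;> linarith
    · left
      have : (1 : ℝ) ≤ z := by exact_mod_cast h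
      rintro b (rfl | rfl | rfl) <;> linarith)
  exact ⟨θ, h2 _ (Or.inl rfl), h2 _ (Or.inr (Or.inl rfl)), h2 _ (Or.inr (Or.inr rfl))⟩

/-- Two different components `y₁`, `y₂` move, and so does a component `x` of an adjacent row. -/
theorem local_exchange {x y₁ y₂ U : ℝ} (h1 : ∃ z : ℤ, y₁ - x - 1 / 2 = z)
    (h2 : ∃ z : ℤ, y₂ - x - 1 / 2 = z) (hne : y₁ ≠ y₂) :
    (U * |sn q (y₂ - y₁ + 1)| + U * |sn q (y₂ - y₁ - 1)|) *
      (nf q y₁ (x + 1) * nf q x y₁ * (nf q y₂ (x + 1) * nf q x y₂) +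
       nf q y₁ x * nf q x (y₁ + 1) * (nf q y₂ x * nf q x (y₂ + 1))) =
    cs q 1 * (U * |sn q (y₂ - y₁ + 1)| * (nf q y₁ x * nf q x (y₁ + 1)) *
        (nf q y₂ (x + 1) * nf q x y₂) +
      U * |sn q (y₂ - y₁ - 1)| * (nf q y₂ x * nf q x (y₂ + 1)) *
        (nf q y₁ (x + 1) * nf q x y₁)) := by
  have he : ∃ z : ℤ, y₂ - y₁ = z := by
    obtain ⟨a, ha⟩ := h1
    obtain ⟨b, hb⟩ := h2
    exact ⟨b - a, by push_cast; linarith⟩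
  obtain ⟨θ₁, -, a1, b1⟩ := exists_abs_sn_pair hq hq1 h1
  obtain ⟨θ₂, -, a2, b2⟩ := exists_abs_sn_pair hq hq1 h2
  obtain ⟨θ, a, -, b⟩ := exists_abs_sn_triple hq hq1 he (sub_ne_zero.2 hne.symm)
  rw [show y₁ - x - 1 / 2 + 1 = y₁ - x + 1 / 2 by ring] at b1
  rw [show y₂ - x - 1 / 2 + 1 = y₂ - x + 1 / 2 by ring] at b2
  have key := exchange_identity hq (y₁ - x) (y₂ - x) (1 / 2)
  rw [show y₂ - x - (y₁ - x) = y₂ - y₁ by ring, show (1 : ℝ) / 2 + 1 / 2 = 1 by norm_num] at key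
  simp only [nf_mul_nf_right hq, nf_mul_nf_left hq, a1, b1, a2, b2, a, b]
  linear_combination U * θ * θ₁ * θ₂ * (√|sn q (x + y₁ + 1 / 2)| * √|sn q (x + y₁ + 3 / 2)|) *
    (√|sn q (x + y₂ + 1 / 2)| * √|sn q (x + y₂ + 3 / 2)|) * key

/-- One component `y` moves twice, and a component `x` of an adjacent row moves. -/
theorem local_exchange_same {x y : ℝ} (h1 : ∃ z : ℤ, y - x - 1 / 2 = z) :
    nf q y (x + 1) * nf q (y + 1) (x + 1) * nf q x y +
      nf q y x * nf q (y + 1) x * nf q x (y + 1 + 1) =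
    cs q 1 * (nf q y x * nf q x (y + 1) * nf q (y + 1) (x + 1)) := by
  have e1 : nf q y (x + 1) * nf q (y + 1) (x + 1) * nf q x y =
      √|sn q (x + y + 1 / 2)| * √|sn q (x + y + 3 / 2)| * √|sn q (x + y + 5 / 2)| *
        √|sn q (y - x + 1 / 2)| * |sn q (y - x - 1 / 2)| := by
    rw [mul_right_comm, nf_mul_nf_left hq, nf_eq hq,
      show x + 1 + (y + 1) + 1 / 2 = x + y + 5 / 2 by ring,
      show y + 1 - (x + 1) + 1 / 2 = y - x + 1 / 2 by ring]
    ring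
  have e2 : nf q y x * nf q (y + 1) x * nf q x (y + 1 + 1) =
      √|sn q (x + y + 1 / 2)| * √|sn q (x + y + 3 / 2)| * √|sn q (x + y + 5 / 2)| *
        √|sn q (y - x + 1 / 2)| * |sn q (y - x + 3 / 2)| := by
    rw [mul_assoc, nf_mul_nf_right hq, nf_eq hq,
      show x + (y + 1) + 3 / 2 = x + y + 5 / 2 by ring,
      show x + (y + 1) + 1 / 2 = x + y + 3 / 2 by ring,
      show y + 1 - x + 1 / 2 = y - x + 3 / 2 by ring]
    ring
  have e3 : nf q y x * nf q x (y + 1) * nf q (y + 1) (x + 1) =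
      √|sn q (x + y + 1 / 2)| * √|sn q (x + y + 3 / 2)| * √|sn q (x + y + 5 / 2)| *
        √|sn q (y - x + 1 / 2)| * |sn q (y - x + 1 / 2)| := by
    rw [nf_mul_nf_right hq, nf_eq hq,
      show x + 1 + (y + 1) + 1 / 2 = x + y + 5 / 2 by ring,
      show y + 1 - (x + 1) + 1 / 2 = y - x + 1 / 2 by ring]
    ring
  rw [e1, e2, e3]
  by_cases h0 : y - x + 1 / 2 = 0
  · rw [h0, sn_zero]; simp
  · obtain ⟨θ, a, b, c⟩ := exists_abs_sn_triple hq hq1 (a := y - x + 1 / 2) (by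
      obtain ⟨z, hz⟩ := h1
      exact ⟨z + 1, by push_cast; linarith⟩) h0
    rw [show y - x + 1 / 2 - 1 = y - x - 1 / 2 by ring] at a
    rw [show y - x + 1 / 2 + 1 = y - x + 3 / 2 by ring] at c
    have key := sn_mul_cs hq (y - x + 1 / 2) 1
    rw [show y - x + 1 / 2 + 1 = y - x + 3 / 2 by ring,
      show y - x + 1 / 2 - 1 = y - x - 1 / 2 by ring] at key
    generalize √|sn q (y - x + 1 / 2)| = r
    rw [a, b, c]
    linear_combination -θ * (√|sn q (x + y + 1 / 2)| * √|sn q (x + y + 3 / 2)| *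
      √|sn q (x + y + 5 / 2)| * r) * key

/-- The diagonal term for the row of `y`, a move of `y`, and a move of a component `x` of an
adjacent row. -/
theorem local_exchange_loop {x y U : ℝ} (h1 : ∃ z : ℤ, y - x - 1 / 2 = z) :
    (U * cs q (y + 3 / 2) + U * cs q (y - 1 / 2)) *
      (cs q (x + 1) * (nf q y (x + 1) * nf q x y) + cs q x * (nf q y x * nf q x (y + 1))) =
    cs q 1 * (U * cs q (y + 3 / 2) * cs q x * (nf q y (x + 1) * nf q x y) +
      U * cs q (y - 1 / 2) * (nf q y x * nf q x (y + 1)) * cs q (x + 1)) := by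
  obtain ⟨θ₁, -, a1, b1⟩ := exists_abs_sn_pair hq hq1 h1
  rw [show y - x - 1 / 2 + 1 = y - x + 1 / 2 by ring] at b1
  have key := exchange_identity_loop hq x y (1 / 2)
  rw [show y + 1 / 2 + 1 / 2 + 1 / 2 = y + 3 / 2 by ring,
    show x + 1 / 2 + 1 / 2 = x + 1 by ring, show (1 : ℝ) / 2 + 1 / 2 = 1 by norm_num] at key
  simp only [nf_mul_nf_right hq, nf_mul_nf_left hq, a1, b1]
  linear_combination U * θ₁ * (√|sn q (x + y + 1 / 2)| * √|sn q (x + y + 3 / 2)|) * key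

/-- Two different components `y₁`, `y₂` move, with the diagonal term for an adjacent row. -/
theorem local_exchange_diag {y₁ y₂ U : ℝ} (h : ∃ z : ℤ, y₂ - y₁ = z) (hne : y₁ ≠ y₂) :
    (U * |sn q (y₂ - y₁ + 1)| + U * |sn q (y₂ - y₁ - 1)|) *
      (cs q y₁ * cs q y₂ + cs q (y₁ + 1) * cs q (y₂ + 1)) =
    cs q 1 * (U * |sn q (y₂ - y₁ + 1)| * cs q (y₁ + 1) * cs q y₂ +
      U * |sn q (y₂ - y₁ - 1)| * cs q (y₂ + 1) * cs q y₁) := by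
  obtain ⟨θ, a, -, b⟩ := exists_abs_sn_triple hq hq1 h (sub_ne_zero.2 hne.symm)
  rw [a, b]
  linear_combination U * θ * exchange_identity_cs hq y₁ y₂ 1

/-- A component `y` moves and returns, while `x` moves. -/
theorem local_loop {x y e : ℝ} (h1 : ∃ z : ℤ, y - x - 1 / 2 = z) (h2 : ∃ z : ℤ, x + y + 1 / 2 = z)
    (hy : y ≠ 0)
    (hx : |cc q x - cc q (y + 1 / 2)| = e * (cc q x - cc q (y + 1 / 2)))
    (hx1 : |cc q (x + 1) - cc q (y + 1 / 2)| = e * (cc q (x + 1) - cc q (y + 1 / 2))) :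
    nf q y (x + 1) * nf q y (x + 1) * nf q x y
      - cs q 1 * (nf q y x * nf q x (y + 1) * nf q y (x + 1)) + nf q y x * nf q y x * nf q x y =
    e * sn q 1 * sn q (2 * y + 2) * nf q x y := by
  obtain ⟨θ, hθ, a1, b1⟩ := exists_abs_sn_pair hq hq1 h1
  obtain ⟨θ', hθ', a2, b2⟩ := exists_abs_sn_pair hq hq1 h2
  rw [show y - x - 1 / 2 + 1 = y - x + 1 / 2 by ring] at b1
  rw [show x + y + 1 / 2 + 1 = x + y + 3 / 2 by ring] at b2
  have p1 : sn q (x + y + 1 / 2) * sn q (y - x + 1 / 2) = -(cc q x - cc q (y + 1 / 2)) := by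
    rw [cc_sub_cc hq, ← add_assoc, show x - (y + 1 / 2) = -(y - x + 1 / 2) by ring, sn_neg]; ring
  have p2 : sn q (x + y + 3 / 2) * sn q (y - x - 1 / 2) =
      -(cc q (x + 1) - cc q (y + 1 / 2)) := by
    rw [cc_sub_cc hq, show x + 1 + (y + 1 / 2) = x + y + 3 / 2 by ring,
      show x + 1 - (y + 1 / 2) = -(y - x - 1 / 2) by ring, sn_neg]; ring
  have p3 : sn q (x + y + 3 / 2) * sn q (y - x + 1 / 2) = cc q (y + 1) - cc q (x + 1 / 2) := by
    rw [cc_sub_cc hq]; congr 2 <;> ring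
  have q1 : |cc q x - cc q (y + 1 / 2)| = |sn q (x + y + 1 / 2)| * |sn q (y - x + 1 / 2)| := by
    rw [← abs_mul, p1, abs_neg]
  have q2 : |cc q (x + 1) - cc q (y + 1 / 2)| =
      |sn q (x + y + 3 / 2)| * |sn q (y - x - 1 / 2)| := by
    rw [← abs_mul, p2, abs_neg]
  have r3 : nf q y x * nf q x (y + 1) * nf q y (x + 1) =
      |sn q (x + y + 3 / 2)| * |sn q (y - x + 1 / 2)| * nf q x y := by
    rw [nf_mul_nf_right hq, nf_eq hq, nf_eq hq, show x + 1 + y + 1 / 2 = x + y + 3 / 2 by ring,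
      show y - (x + 1) + 1 / 2 = y - x - 1 / 2 by ring,
      show x - y + 1 / 2 = -(y - x - 1 / 2) by ring, sn_neg, abs_neg, add_comm y x]
    linear_combination √|sn q (x + y + 1 / 2)| * |sn q (y - x + 1 / 2)| *
      √|sn q (y - x - 1 / 2)| * Real.mul_self_sqrt (abs_nonneg (sn q (x + y + 3 / 2)))
  -- the sign of the mixed term agrees with that of the other two terms
  have r4 : |sn q (x + y + 3 / 2)| * |sn q (y - x + 1 / 2)| =
      -e * (cc q (y + 1) - cc q (x + 1 / 2)) := by
    have hθe : ∀ c : ℝ, θ' * θ * -c = e * c → c ≠ 0 → θ' * θ = -e := fun c hc h0 => by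
      have := mul_right_cancel₀ h0 (show (θ' * θ) * c = -e * c by linarith)
      exact this
    rw [a2, b1] at q1
    rw [b2, a1] at q2
    rw [b1, b2, ← p3]
    by_cases c1 : cc q x - cc q (y + 1 / 2) = 0
    · by_cases c2 : cc q (x + 1) - cc q (y + 1 / 2) = 0
      · rw [c1, neg_zero, mul_eq_zero, sn_eq_zero_iff hq hq1, sn_eq_zero_iff hq hq1] at p1
        rw [c2, neg_zero, mul_eq_zero, sn_eq_zero_iff hq hq1, sn_eq_zero_iff hq hq1] at p2
        rcases p1 with p1 | p1
        · rcases p2 with p2 | p2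
          · linarith
          · exact absurd (by linarith) hy
        · rw [p1, sn_zero]; ring
      · have := hθe _ (by rw [← p2, ← hx1, q2, p2]; linear_combination -(θ' * θ) * p2) c2
        linear_combination (sn q (x + y + 3 / 2) * sn q (y - x + 1 / 2)) * this
    · have := hθe _ (by rw [← p1, ← hx, q1, p1]; linear_combination -(θ' * θ) * p1) c1
      linear_combination (sn q (x + y + 3 / 2) * sn q (y - x + 1 / 2)) * this
  have s1 : cs q 1 * cc q (x + 1 / 2) = cc q (x + 1) + cc q x := by
    rw [mul_comm, cc, cs_mul_cs hq, cc, cc]; congr 2 <;> ring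
  have s2 : sn q 1 * sn q (2 * y + 2) = cs q 1 * cc q (y + 1) - 2 * cc q (y + 1 / 2) := by
    rw [mul_comm, mul_comm (cs q 1), cc, cs_mul_cs hq, sn_mul_sn hq, cc,
      show 2 * (y + 1) + 1 = 2 * y + 2 + 1 by ring,
      show 2 * (y + 1) - 1 = 2 * y + 2 - 1 by ring,
      show 2 * (y + 1 / 2) = 2 * y + 2 - 1 by ring]
    ring
  rw [r3, r4, nf_mul_self, nf_mul_self, hx, hx1]
  linear_combination nf q x y * (-e * s2 - e * s1)

end

end

/-! ### Moves -/

section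

/-- The moves of a row `k`: `(j, 1)` and `(j, -1)` stand for the raising and lowering of the
`j`-th component, and `(0, 0)`, for odd `k`, for the diagonal term. -/
def mv (k : ℕ) : Finset (ℕ × ℤ) :=
  Icc 1 (k / 2) ×ˢ {1, -1} ∪ if Odd k then {(0, 0)} else ∅

theorem mem_mv {k : ℕ} {s : ℕ × ℤ} : s ∈ mv k ↔
    (1 ≤ s.1 ∧ s.1 ≤ k / 2 ∧ (s.2 = 1 ∨ s.2 = -1)) ∨ Odd k ∧ s = (0, 0) := by
  unfold mv
  split_ifs with h <;> simp [h, mem_product, and_assoc, or_comm]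

/-- The array after a move. -/
def move (m : Pattern) (k : ℕ) (s : ℕ × ℤ) : Pattern := shift m s.1 k s.2

/-- The opposite move. -/
def opp (s : ℕ × ℤ) : ℕ × ℤ := (s.1, -s.2)

theorem opp_opp (s : ℕ × ℤ) : opp (opp s) = s := by simp [opp]

theorem opp_mem_mv {k : ℕ} {s : ℕ × ℤ} (h : s ∈ mv k) : opp s ∈ mv k := by
  rw [mem_mv] at *
  rcases h with ⟨h1, h2, h3⟩ | ⟨h1, rfl⟩
  · left
    refine ⟨h1, h2, ?_⟩
    simp only [opp]; omega
  · right; exact ⟨h1, by simp [opp]⟩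

theorem move_comm (m : Pattern) (k : ℕ) (s : ℕ × ℤ) (k' : ℕ) (s' : ℕ × ℤ) :
    move (move m k s) k' s' = move (move m k' s') k s := shift_comm ..

theorem move_move_opp (m : Pattern) (k : ℕ) (s : ℕ × ℤ) : move (move m k s) k (opp s) = m := by
  simp only [move, opp]; push_cast; exact shift_shift_neg ..

theorem move_loop (m : Pattern) (k j : ℕ) : move m k (j, 0) = m := by
  simp [move, shift_zero]

theorem lam_move (m : Pattern) (k : ℕ) (s : ℕ × ℤ) (j' k' : ℕ) :
    lam (move m k s) j' k' = lam m j' k' + if j' = s.1 ∧ k' = k then (s.2 : ℝ) else 0 :=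
  lam_shift ..

theorem lam_move_self (m : Pattern) (k j : ℕ) (σ : ℤ) :
    lam (move m k (j, σ)) j k = lam m j k + σ := lam_shift_self ..

theorem lam_move_of_ne_row (m : Pattern) (k : ℕ) (s : ℕ × ℤ) (j' : ℕ) {k' : ℕ} (h : k' ≠ k) :
    lam (move m k s) j' k' = lam m j' k' := lam_shift_of_ne_row _ _ _ _ _ h

theorem lam_move_of_ne (m : Pattern) (k : ℕ) (s : ℕ × ℤ) {j' : ℕ} (k' : ℕ) (h : j' ≠ s.1) :
    lam (move m k s) j' k' = lam m j' k' := lam_shift_of_ne _ _ _ _ h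

theorem lam_move_of_pair_ne (m : Pattern) (k : ℕ) (s : ℕ × ℤ) {a b : ℕ} (h : (a, b) ≠ (s.1, k)) :
    lam (move m k s) a b = lam m a b := by
  rw [lam_move, if_neg (by simpa using h), add_zero]

/-! ### Matrix elements -/

/-- The factor of a matrix element which depends only on the moving shifted component: `y` is its
product with the sign of the move. -/
def wt (q : ℝ) (k : ℕ) (y : ℝ) : ℝ :=
  if Odd k then (|sn q 1| * (sn q (2 * y) * cs q (y + 1 / 2)))⁻¹ else (|sn q 1| * sn q y)⁻¹

/-- The factor of a matrix element of a row which depends on the components of this row;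
`e` is the sign of the diagonal term. -/
def base (q e : ℝ) (k : ℕ) (m : Pattern) (s : ℕ × ℤ) : ℝ :=
  if s.2 = 0 then e * (sn q 1)⁻¹ * ∏ i ∈ Icc 1 (k / 2), (cc q (lam m i k) + cc q (1 / 2))⁻¹
  else wt q k (s.2 * lam m s.1 k) * ∏ i ∈ (Icc 1 (k / 2)).erase s.1,
    (√(|cc q (lam m i k) - cc q (lam m s.1 k)| *
      |cc q (lam m i k) - cc q (lam m s.1 k + s.2)|))⁻¹

/-- The factor of a matrix element contributed by a component `a` of an adjacent row. -/
def fac (q : ℝ) (σ : ℤ) (y a : ℝ) : ℝ := if σ = 0 then cs q a else nf q (σ * y) a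

/-- The matrix element, of the generator moving row `k`, which belongs to the move `s`, without
the factors of the adjacent components in `A`. -/
def rest (q e : ℝ) (k : ℕ) (A : Finset (ℕ × ℕ)) (m : Pattern) (s : ℕ × ℤ) : ℝ :=
  base q e k m s * ∏ a ∈ nb k \ A, fac q s.2 (lam m s.1 k) (lam m a.1 a.2)

/-- The matrix element, of the generator moving row `k`, which belongs to the move `s`. -/
def coef (q e : ℝ) (k : ℕ) (m : Pattern) (s : ℕ × ℤ) : ℝ := rest q e k ∅ m s

variable {q : ℝ}

theorem base_congr (e : ℝ) {k : ℕ} {m m' : Pattern} (h : ∀ i, lam m' i k = lam m i k)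
    (s : ℕ × ℤ) : base q e k m' s = base q e k m s := by simp only [base, h]

theorem rest_congr (e : ℝ) {k : ℕ} {A : Finset (ℕ × ℕ)} {m m' : Pattern}
    (h : ∀ i, lam m' i k = lam m i k)
    (hA : ∀ a ∈ nb k, a ∉ A → lam m' a.1 a.2 = lam m a.1 a.2) (s : ℕ × ℤ) :
    rest q e k A m' s = rest q e k A m s := by
  rw [rest, rest, base_congr e h, h]
  congr 1
  refine prod_congr rfl fun a ha => ?_
  rw [mem_sdiff] at ha
  rw [hA a ha.1 ha.2]

theorem rest_eq (e : ℝ) {k : ℕ} {A : Finset (ℕ × ℕ)} (m : Pattern) (s : ℕ × ℤ) {a : ℕ × ℕ}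
    (ha : a ∈ nb k) (haA : a ∉ A) : rest q e k A m s =
      rest q e k (insert a A) m s * fac q s.2 (lam m s.1 k) (lam m a.1 a.2) := by
  rw [rest, rest, mul_assoc, sdiff_insert, prod_erase_mul]
  exact mem_sdiff.2 ⟨ha, haA⟩

theorem coef_eq (e : ℝ) {k : ℕ} (m : Pattern) (s : ℕ × ℤ) {a : ℕ × ℕ}
    (ha : a ∈ nb k) : coef q e k m s =
      rest q e k {a} m s * fac q s.2 (lam m s.1 k) (lam m a.1 a.2) :=
  rest_eq e m s ha (notMem_empty a)

theorem coef_eq₂ (e : ℝ) {k : ℕ} (m : Pattern) (s : ℕ × ℤ) {a b : ℕ × ℕ}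
    (ha : a ∈ nb k) (hb : b ∈ nb k) (hab : b ≠ a) : coef q e k m s =
      rest q e k {b, a} m s * (fac q s.2 (lam m s.1 k) (lam m a.1 a.2) *
        fac q s.2 (lam m s.1 k) (lam m b.1 b.2)) := by
  rw [coef_eq e m s ha, rest_eq e m s hb (by simpa using hab)]
  ring

theorem nf_sign_left {τ : ℤ} (hτ : τ = 1 ∨ τ = -1) (y a : ℝ) : nf q y (τ * a) = nf q y a := by
  rcases hτ with rfl | rfl <;> simp [nf_neg_right]

theorem nf_sign_add {τ : ℤ} (hτ : τ = 1 ∨ τ = -1) (y a : ℝ) :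
    nf q y (a + τ) = nf q y (τ * a + 1) := by
  rw [← nf_sign_left hτ y (a + τ)]
  congr 1
  rcases hτ with rfl | rfl <;> push_cast <;> ring

theorem cc_sign {τ : ℤ} (hτ : τ = 1 ∨ τ = -1) (a : ℝ) : cc q (τ * a) = cc q a := by
  rcases hτ with rfl | rfl <;> simp [cc_neg]

theorem cs_sign {τ : ℤ} (hτ : τ = 1 ∨ τ = -1) (a : ℝ) : cs q (τ * a) = cs q a := by
  rcases hτ with rfl | rfl <;> simp [cs_neg]

theorem cc_sign_add {τ : ℤ} (hτ : τ = 1 ∨ τ = -1) (a : ℝ) :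
    cc q (a + τ) = cc q (τ * a + 1) := by
  rw [← cc_sign hτ (a + τ)]
  congr 1
  rcases hτ with rfl | rfl <;> push_cast <;> ring

theorem cs_sign_add {τ : ℤ} (hτ : τ = 1 ∨ τ = -1) (a : ℝ) :
    cs q (a + τ) = cs q (τ * a + 1) := by
  rw [← cs_sign hτ (a + τ)]
  congr 1
  rcases hτ with rfl | rfl <;> push_cast <;> ring

theorem fac_of_sign {σ : ℤ} (hσ : σ = 1 ∨ σ = -1) (y a : ℝ) : fac q σ y a = nf q (σ * y) a := by
  rw [fac, if_neg]; omega

theorem fac_zero (y a : ℝ) : fac q 0 y a = cs q a := by rw [fac, if_pos rfl]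

/-! ### Arithmetic of the components of a tableau -/

theorem abs_sign_mul_add {σ : ℤ} (hσ : σ = 1 ∨ σ = -1) (a c : ℝ) :
    |σ * a + c| = |a + σ * c| := by
  rcases hσ with rfl | rfl
  · simp
  · rw [← abs_neg]; push_cast; congr 1; ring

theorem abs_sign_mul_add_half {σ : ℤ} (hσ : σ = 1 ∨ σ = -1) {a : ℝ} (ha : 1 / 2 ≤ |a|) :
    |σ * a + 1 / 2| = |a| + 1 / 2 ∨ |σ * a + 1 / 2| = |a| - 1 / 2 := by
  rcases hσ with rfl | rfl <;> rcases le_abs.1 ha with h | h <;> push_cast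
  · left; rw [abs_of_nonneg (by linarith), abs_of_nonneg (by linarith)]; ring
  · right; rw [abs_of_nonpos (by linarith), abs_of_nonpos (by linarith)]; ring
  · right; rw [abs_of_nonpos (by linarith), abs_of_nonneg (by linarith)]; ring
  · left; rw [abs_of_nonneg (by linarith), abs_of_nonpos (by linarith)]; ring

theorem abs_sign_mul_add_one {σ : ℤ} (hσ : σ = 1 ∨ σ = -1) {a : ℝ} (ha : 1 / 2 ≤ |a|) :
    |σ * a + 1| = |a| + 1 ∧ |σ * a + 1 / 2| = |a| + 1 / 2 ∨
    |σ * a + 1| = |a| - 1 ∧ |σ * a + 1 / 2| = |a| - 1 / 2 ∨ |σ * a + 1| < |a| + 1 / 2 ∧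
      |a| < 1 ∧ |σ * a + 1 / 2| = |a| - 1 / 2 := by
  rcases hσ with rfl | rfl <;> rcases le_abs.1 ha with h | h <;> push_cast
  · left; rw [abs_of_nonneg (by linarith), abs_of_nonneg (by linarith), abs_of_nonneg (by linarith)]
    constructor <;> ring
  · right
    rw [abs_of_nonpos (show a ≤ 0 by linarith), abs_of_nonpos (show 1 * a + 1 / 2 ≤ 0 by linarith)]
    rcases le_or_gt a (-1) with h1 | h1
    · left; rw [abs_of_nonpos (by linarith)]; constructor <;> ring
    · right; rw [abs_of_nonneg (by linarith)]
      refine ⟨by linarith, by linarith, by ring⟩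
  · right
    rw [abs_of_nonneg (show 0 ≤ a by linarith), abs_of_nonpos (show -1 * a + 1 / 2 ≤ 0 by linarith)]
    rcases le_or_gt 1 a with h1 | h1
    · left; rw [abs_of_nonpos (by linarith)]; constructor <;> ring
    · right; rw [abs_of_nonneg (by linarith)]
      refine ⟨by linarith, by linarith, by ring⟩
  · left
    rw [abs_of_nonneg (by linarith), abs_of_nonpos (show a ≤ 0 by linarith),
      abs_of_nonneg (by linarith)]
    constructor <;> ring

namespace IsGTTableau
variable {n : ℕ} {M : ℕ → ℝ} {m : Pattern} (h : IsGTTableau n M m)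
include h

theorem half_le_abs_lam {j k : ℕ} (hkn : k + 1 ≤ n) (hj : 1 ≤ j) (hjk : j ≤ k / 2) :
    1 / 2 ≤ |lam m j k| := by
  rcases Nat.even_or_odd' k with ⟨p, hp | hp⟩
  · obtain ⟨a, ha, ha2⟩ := exists_two_mul_lam_eq h.toIsHalfArray (j := j) (k := k) (by omega)
      (by omega) hj hjk
    have h1 : 1 ≤ |a| := Int.one_le_abs (by rintro rfl; omega)
    have h2 : (1 : ℝ) ≤ |(a : ℝ)| := by exact_mod_cast h1
    rw [ha, abs_div, abs_two]
    linarith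
  · have := h.interlaces.lower k j (by omega) hkn hj (by omega)
    have h1 := abs_nonneg (lam m (j + 1) (k + 1))
    exact le_trans (by linarith) (le_abs_self _)

theorem exists_int_sub {j l k k' : ℕ} {σ τ : ℤ} (hσ : σ = 1 ∨ σ = -1) (hτ : τ = 1 ∨ τ = -1)
    (hk : k' = k + 1 ∨ k = k' + 1) (hkn : k ≤ n) (hkn' : k' ≤ n) (hj : 1 ≤ j) (hjk : j ≤ k / 2)
    (hl : 1 ≤ l) (hlk : l ≤ k' / 2) : ∃ z : ℤ, σ * lam m j k - τ * lam m l k' - 1 / 2 = z := by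
  obtain ⟨a, ha, ha2⟩ := exists_two_mul_lam_eq h.toIsHalfArray (by omega) hkn hj hjk
  obtain ⟨b, hb, hb2⟩ := exists_two_mul_lam_eq h.toIsHalfArray (by omega) hkn' hl hlk
  obtain ⟨z, hz⟩ : ∃ z, σ * a - τ * b - 1 = 2 * z := by
    refine ⟨(σ * a - τ * b - 1) / 2, ?_⟩
    rcases hσ with rfl | rfl <;> rcases hτ with rfl | rfl <;> omega
  refine ⟨z, ?_⟩
  have : (σ : ℝ) * a - τ * b - 1 = 2 * z := by exact_mod_cast hz
  rw [ha, hb]; linarith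

theorem exists_int_sub_row {i j k : ℕ} {σ τ : ℤ} (hσ : σ = 1 ∨ σ = -1) (hτ : τ = 1 ∨ τ = -1)
    (hkn : k ≤ n) (hi : 1 ≤ i) (hik : i ≤ k / 2) (hj : 1 ≤ j) (hjk : j ≤ k / 2) :
    ∃ z : ℤ, σ * lam m j k - τ * lam m i k = z := by
  obtain ⟨a, ha, ha2⟩ := exists_two_mul_lam_eq h.toIsHalfArray (by omega) hkn hj hjk
  obtain ⟨b, hb, hb2⟩ := exists_two_mul_lam_eq h.toIsHalfArray (by omega) hkn hi hik
  obtain ⟨z, hz⟩ : ∃ z, σ * a - τ * b = 2 * z := by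
    refine ⟨(σ * a - τ * b) / 2, ?_⟩
    rcases hσ with rfl | rfl <;> rcases hτ with rfl | rfl <;> omega
  refine ⟨z, ?_⟩
  have : (σ : ℝ) * a - τ * b = 2 * z := by exact_mod_cast hz
  rw [ha, hb]; linarith

theorem sign_mul_lam_ne {i j k : ℕ} {σ τ : ℤ} (hσ : σ = 1 ∨ σ = -1) (hτ : τ = 1 ∨ τ = -1)
    (hkn : k + 1 ≤ n) (hi : 1 ≤ i) (hik : i ≤ k / 2) (hj : 1 ≤ j) (hjk : j ≤ k / 2) (hij : i ≠ j) :
    σ * lam m i k ≠ τ * lam m j k := by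
  intro hc
  refine h.interlaces.abs_ne hkn hi hj hij hik hjk ?_
  have := congrArg abs hc
  rcases hσ with rfl | rfl <;> rcases hτ with rfl | rfl <;> simpa [abs_mul] using this

/-- If a move of the `j`-th component makes it collide with the `i`-th one, then it crosses a
component of the row above and one of the row below. -/
theorem exists_nb_of_collision {i j k : ℕ} {σ : ℤ} (hσ : σ = 1 ∨ σ = -1) (hkn : k + 1 ≤ n)
    (hi : 1 ≤ i) (hik : i ≤ k / 2) (hj : 1 ≤ j) (hjk : j ≤ k / 2) (hij : i ≠ j)
    (hc : |lam m i k| = |lam m j k + σ|) (k' : ℕ) (hk' : k' = k + 1 ∨ k = k' + 1) :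
    ∃ a ∈ nb k, a.2 = k' ∧ |lam m a.1 a.2| = |σ * lam m j k + 1 / 2| := by
  have hc' : |lam m i k| = |σ * lam m j k + 1| := by
    rw [hc, abs_sign_mul_add hσ, mul_one]
  have key : ∃ b, 1 ≤ b ∧ b + 1 ≤ k / 2 ∧ lam m (b + 1) (k + 1) = |σ * lam m j k + 1 / 2| ∧
      lam m b (k - 1) = |σ * lam m j k + 1 / 2| := by
    rcases abs_sign_mul_add_one hσ (h.half_le_abs_lam hkn hj hjk) with h1 | h1 | h1
    · obtain ⟨h2, h3, h4⟩ := h.interlaces.squeeze hkn hi hj hik hjk (by rw [hc', h1.1])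
      exact ⟨i, hi, by omega, by rw [← h2, h3, h1.2], by rw [h4, h1.2]⟩
    · obtain ⟨h2, h3, h4⟩ := h.interlaces.squeeze hkn hj hi hjk hik (by rw [hc', h1.1]; ring)
      refine ⟨j, hj, by omega, by rw [← h2, h3, h1.2, hc', h1.1]; ring, ?_⟩
      rw [h4, h1.2, hc', h1.1]; ring
    · exfalso
      rw [← hc'] at h1
      have := h.half_le_abs_lam hkn hi hik
      rcases lt_or_gt_of_ne hij with h2 | h2
      · linarith [h.interlaces.abs_le_of_lt hkn hi h2 hjk, le_abs_self (lam m i k)]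
      · linarith [h.interlaces.abs_le_of_lt hkn hj h2 hik, le_abs_self (lam m j k)]
  obtain ⟨b, h1, h2, h3, h4⟩ := key
  rcases hk' with rfl | rfl
  · exact ⟨(b + 1, k + 1), mem_nb.2 ⟨by simp, Or.inl ⟨by simp; omega, rfl⟩⟩, rfl,
      by rw [h3, abs_abs]⟩
  · refine ⟨(b, k'), mem_nb.2 ⟨h1, Or.inr ⟨by simp; omega, by simp⟩⟩, rfl, ?_⟩
    simp only [Nat.add_sub_cancel] at h4
    rw [h4, abs_abs]

end IsGTTableau

theorem nf_eq_zero {y a : ℝ} (h : |a| = |y + 1 / 2|) : nf q y a = 0 := by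
  rw [nf, ← cc_abs q a, h, cc_abs, sub_self, abs_zero, Real.sqrt_zero]

theorem exists_common_factor {A C p r t W : ℝ} (hA : 0 ≤ A) (hp : 0 ≤ p)
    (hr : 0 ≤ r) (ht : 0 ≤ t) (hW : p * r = 0 ∨ p * t = 0 → W = 0) :
    ∃ U, W * ((√(A * (p * r)))⁻¹ * (√(p * r * C))⁻¹) = U * t ∧
      W * ((√(A * (p * t)))⁻¹ * (√(p * t * C))⁻¹) = U * r := by
  by_cases h0 : p * r = 0 ∨ p * t = 0
  · exact ⟨0, by simp [hW h0]⟩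
  · push Not at h0
    have hp0 : p ≠ 0 := left_ne_zero_of_mul h0.1
    have hr0 : r ≠ 0 := right_ne_zero_of_mul h0.1
    have ht0 : t ≠ 0 := right_ne_zero_of_mul h0.2
    have key : ∀ B, 0 ≤ B → (√(A * B))⁻¹ * (√(B * C))⁻¹ = (√A)⁻¹ * (√C)⁻¹ * B⁻¹ := fun B hB => by
      rw [Real.sqrt_mul hA, Real.sqrt_mul hB, mul_inv, mul_inv]
      linear_combination (√A)⁻¹ * (√C)⁻¹ *
        (mul_inv (√B) (√B)).symm.trans (congrArg _ (Real.mul_self_sqrt hB))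
    refine ⟨W * ((√A)⁻¹ * (√C)⁻¹) * (p * r * t)⁻¹, ?_, ?_⟩
    · rw [key _ (by positivity)]; field_simp
    · rw [key _ (by positivity)]; field_simp

end

/-! ### Paths of three moves -/

section

variable {q : ℝ}

theorem base_step (e : ℝ) (k : ℕ) (m : Pattern) {j i : ℕ} {σ : ℤ} (hσ : σ = 1 ∨ σ = -1)
    (hi : 1 ≤ i) (hik : i ≤ k / 2) (hij : i ≠ j) :
    base q e k m (j, σ) = wt q k (σ * lam m j k) *
      (∏ l ∈ ((Icc 1 (k / 2)).erase j).erase i, (√(|cc q (lam m l k) - cc q (lam m j k)| *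
        |cc q (lam m l k) - cc q (lam m j k + σ)|))⁻¹) *
      (√(|cc q (lam m i k) - cc q (lam m j k)| *
        |cc q (lam m i k) - cc q (lam m j k + σ)|))⁻¹ := by
  rw [base, if_neg (show σ ≠ 0 by omega), mul_assoc, prod_erase_mul]
  exact mem_erase.2 ⟨hij, mem_Icc.2 ⟨hi, hik⟩⟩

/-- The two orders of moving two components of a row have the same matrix elements up to
`|[y₂ - y₁ ± 1]|`, where `y₁`, `y₂` are the shifted components times the signs of the moves. This
needs one of the adjacent rows to be unaffected by `A`: if the components collide, both sides vanish
since a component of that row is crossed. -/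
theorem exists_rest_mul_rest (hq : 0 < q) (hq1 : q ≠ 1) {n : ℕ} {M : ℕ → ℝ} {m : Pattern}
    (h : IsGTTableau n M m) (e : ℝ) {k k' : ℕ} (hkn : k + 1 ≤ n) {A : Finset (ℕ × ℕ)}
    (hk' : k' = k + 1 ∨ k = k' + 1) (hA : ∀ a ∈ A, a.2 ≠ k')
    {i j : ℕ} {σ τ : ℤ} (hσ : σ = 1 ∨ σ = -1) (hτ : τ = 1 ∨ τ = -1)
    (hi : 1 ≤ i) (hik : i ≤ k / 2) (hj : 1 ≤ j) (hjk : j ≤ k / 2) (hij : i ≠ j) :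
    ∃ U : ℝ,
      rest q e k A m (i, σ) * rest q e k A (move m k (i, σ)) (j, τ) =
        U * |sn q (τ * lam m j k - σ * lam m i k + 1)| ∧
      rest q e k A m (j, τ) * rest q e k A (move m k (j, τ)) (i, σ) =
        U * |sn q (τ * lam m j k - σ * lam m i k - 1)| := by
  set x := lam m i k with hx
  set y := lam m j k with hy
  set N₁ := ∏ a ∈ nb k \ A, fac q σ x (lam m a.1 a.2) with hN₁
  set N₂ := ∏ a ∈ nb k \ A, fac q τ y (lam m a.1 a.2) with hN₂
  set R₁ := ∏ l ∈ ((Icc 1 (k / 2)).erase i).erase j, (√(|cc q (lam m l k) - cc q x| *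
        |cc q (lam m l k) - cc q (x + σ)|))⁻¹ with hR₁
  set R₂ := ∏ l ∈ ((Icc 1 (k / 2)).erase j).erase i, (√(|cc q (lam m l k) - cc q y| *
        |cc q (lam m l k) - cc q (y + τ)|))⁻¹ with hR₂
  have hne : ∀ a ∈ nb k \ A, a.2 ≠ k := by
    intro a ha
    have := mem_nb.1 (mem_sdiff.1 ha).1
    omega
  have f1 : rest q e k A m (i, σ) = wt q k (σ * x) * R₁ *
      (√(|cc q y - cc q x| * |cc q y - cc q (x + σ)|))⁻¹ * N₁ := by
    rw [rest, base_step e k m hσ hj hjk hij.symm]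
  have f2 : rest q e k A m (j, τ) = wt q k (τ * y) * R₂ *
      (√(|cc q x - cc q y| * |cc q x - cc q (y + τ)|))⁻¹ * N₂ := by
    rw [rest, base_step e k m hτ hi hik hij]
  have f3 : rest q e k A (move m k (i, σ)) (j, τ) = wt q k (τ * y) * R₂ *
      (√(|cc q (x + σ) - cc q y| * |cc q (x + σ) - cc q (y + τ)|))⁻¹ * N₂ := by
    rw [rest, base_step e k _ hτ hi hik hij, lam_move_self, lam_move_of_ne _ _ _ _ hij.symm]
    congr 1
    · congr 2
      refine prod_congr rfl fun l hl => ?_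
      rw [lam_move_of_ne _ _ _ _ (ne_of_mem_erase hl)]
    · refine prod_congr rfl fun a ha => ?_
      rw [lam_move_of_ne_row _ _ _ _ (hne a ha)]
  have f4 : rest q e k A (move m k (j, τ)) (i, σ) = wt q k (σ * x) * R₁ *
      (√(|cc q (y + τ) - cc q x| * |cc q (y + τ) - cc q (x + σ)|))⁻¹ * N₁ := by
    rw [rest, base_step e k _ hσ hj hjk hij.symm, lam_move_self, lam_move_of_ne _ _ _ _ hij]
    congr 1
    · congr 2
      refine prod_congr rfl fun l hl => ?_
      rw [lam_move_of_ne _ _ _ _ (ne_of_mem_erase hl)]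
    · refine prod_congr rfl fun a ha => ?_
      rw [lam_move_of_ne_row _ _ _ _ (hne a ha)]
  have g1 : |cc q y - cc q (x + σ)| =
      |sn q (σ * x + τ * y + 1)| * |sn q (τ * y - σ * x - 1)| := by
    rw [cc_sign_add hσ, ← cc_sign hτ y, cc_sub_cc hq, abs_mul]
    congr 3 <;> ring
  have g2 : |cc q x - cc q (y + τ)| =
      |sn q (σ * x + τ * y + 1)| * |sn q (τ * y - σ * x + 1)| := by
    rw [cc_sign_add hτ, ← cc_sign hσ x, cc_sub_cc hq, abs_mul, ← abs_neg (sn q (_ - _)), ← sn_neg]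
    congr 3 <;> ring
  -- when two components collide, a component of row `k'` is crossed
  have z1 : cc q y = cc q (x + σ) → N₁ = 0 := by
    intro hc
    obtain ⟨a, ha, ha2, ha3⟩ := h.exists_nb_of_collision hσ hkn hj hjk hi hik hij.symm
      ((cc_eq_cc_iff hq hq1).1 hc) k' hk'
    refine prod_eq_zero (i := a) (mem_sdiff.2 ⟨ha, fun haA => hA a haA ha2⟩) ?_
    rw [fac_of_sign hσ, nf_eq_zero ha3]
  have z2 : cc q x = cc q (y + τ) → N₂ = 0 := by
    intro hc
    obtain ⟨a, ha, ha2, ha3⟩ := h.exists_nb_of_collision hτ hkn hi hik hj hjk hij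
      ((cc_eq_cc_iff hq hq1).1 hc) k' hk'
    refine prod_eq_zero (i := a) (mem_sdiff.2 ⟨ha, fun haA => hA a haA ha2⟩) ?_
    rw [fac_of_sign hτ, nf_eq_zero ha3]
  obtain ⟨U, hU1, hU2⟩ := exists_common_factor (A := |cc q x - cc q y|)
    (C := |cc q (x + σ) - cc q (y + τ)|) (p := |sn q (σ * x + τ * y + 1)|)
    (r := |sn q (τ * y - σ * x - 1)|) (t := |sn q (τ * y - σ * x + 1)|)
    (W := wt q k (σ * x) * R₁ * N₁ * (wt q k (τ * y) * R₂ * N₂))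
    (abs_nonneg _) (abs_nonneg _) (abs_nonneg _) (abs_nonneg _) (by
      rw [← g1, ← g2, abs_eq_zero, abs_eq_zero, sub_eq_zero, sub_eq_zero]
      rintro (hc | hc)
      · rw [z1 hc]; ring
      · rw [z2 hc]; ring)
  refine ⟨U, ?_, ?_⟩
  · rw [← hU1, f1, f3, ← g1, abs_sub_comm (cc q y) (cc q x), abs_sub_comm (cc q y) (cc q (x + σ))]
    ring
  · rw [← hU2, f2, f4, ← g2, abs_sub_comm (cc q (y + τ)) (cc q (x + σ)),
      abs_sub_comm (cc q (y + τ)) (cc q x)]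
    ring

/-- The two orders of a move and the diagonal term have the same matrix elements up to
`[y + 3/2]_+` and `[y - 1/2]_+`. -/
theorem exists_rest_mul_rest_loop (hq : 0 < q) (e : ℝ) (m : Pattern) {k : ℕ}
    {A : Finset (ℕ × ℕ)} {j : ℕ} {σ : ℤ} (hσ : σ = 1 ∨ σ = -1)
    (hj : 1 ≤ j) (hjk : j ≤ k / 2) :
    ∃ U : ℝ,
      rest q e k A m (0, 0) * rest q e k A (move m k (0, 0)) (j, σ) =
        U * cs q (σ * lam m j k + 3 / 2) ∧
      rest q e k A m (j, σ) * rest q e k A (move m k (j, σ)) (0, 0) =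
        U * cs q (σ * lam m j k - 1 / 2) := by
  have hne : ∀ a ∈ nb k \ A, a.2 ≠ k := by
    intro a ha
    have := mem_nb.1 (mem_sdiff.1 ha).1
    omega
  have hmem : j ∈ Icc 1 (k / 2) := mem_Icc.2 ⟨hj, hjk⟩
  set y := lam m j k with hy
  set N := ∏ a ∈ nb k \ A, cs q (lam m a.1 a.2) with hN
  set R := ∏ i ∈ (Icc 1 (k / 2)).erase j, (cc q (lam m i k) + cc q (1 / 2))⁻¹ with hR
  have f1 : rest q e k A m (0, 0) = e * (sn q 1)⁻¹ * (R * (cc q y + cc q (1 / 2))⁻¹) * N := by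
    rw [rest, base, if_pos rfl, ← prod_erase_mul _ _ hmem]
    simp only [fac_zero]
    rfl
  have f2 : rest q e k A (move m k (j, σ)) (0, 0) =
      e * (sn q 1)⁻¹ * (R * (cc q (y + σ) + cc q (1 / 2))⁻¹) * N := by
    rw [rest, base, if_pos rfl, ← prod_erase_mul _ _ hmem, lam_move_self]
    simp only [fac_zero]
    congr 1
    · congr 2
      refine prod_congr rfl fun l hl => ?_
      rw [lam_move_of_ne _ _ _ _ (ne_of_mem_erase hl)]
    · refine prod_congr rfl fun a ha => ?_
      rw [lam_move_of_ne_row _ _ _ _ (hne a ha)]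
  have g1 : cc q y + cc q (1 / 2) = cs q (σ * y + 1 / 2) * cs q (σ * y - 1 / 2) := by
    rw [← cc_sign hσ, cc_add_cc hq]
  have g2 : cc q (y + σ) + cc q (1 / 2) = cs q (σ * y + 1 / 2) * cs q (σ * y + 3 / 2) := by
    rw [cc_sign_add hσ, cc_add_cc hq, mul_comm]
    congr 2 <;> ring
  have p1 := (cs_pos hq (σ * y + 1 / 2)).ne'
  have p2 := (cs_pos hq (σ * y - 1 / 2)).ne'
  have p3 := (cs_pos hq (σ * y + 3 / 2)).ne'
  rw [move_loop, f1, f2, g1, g2]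
  refine ⟨rest q e k A m (j, σ) * (e * (sn q 1)⁻¹ * R * N) *
    (cs q (σ * y + 1 / 2) * cs q (σ * y - 1 / 2) * cs q (σ * y + 3 / 2))⁻¹, ?_, ?_⟩ <;>
  · generalize cs q (σ * y + 1 / 2) = a at *
    generalize cs q (σ * y - 1 / 2) = b at *
    generalize cs q (σ * y + 3 / 2) = c at *
    field_simp

/-- The coefficient with which the moves `s₁`, `s₂` of row `k` and the move `t` of row `k'`
contribute to `S²T - (q + q⁻¹)STS + TS²`, where `S` and `T` are the generators moving the rows
`k` and `k'`. In the names of the lemmas on `pathSum`, a `step` is a move of a component of row `k`,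
`loop` is the diagonal term of row `k`, `diag` is the diagonal term of row `k'`, and `opp` marks a
move followed by its opposite. -/
def pathSum (q e e' : ℝ) (k k' : ℕ) (m : Pattern) (t s₁ s₂ : ℕ × ℤ) : ℝ :=
  coef q e' k' m t * coef q e k (move m k' t) s₁ * coef q e k (move (move m k s₁) k' t) s₂
  - cs q 1 * (coef q e k m s₁ * coef q e' k' (move m k s₁) t *
      coef q e k (move (move m k s₁) k' t) s₂)
  + coef q e k m s₁ * coef q e k (move m k s₁) s₂ * coef q e' k' (move (move m k s₁) k s₂) t

theorem coef_move_other (e : ℝ) {k k' : ℕ} (hkk : k ≠ k') (m : Pattern) (s : ℕ × ℤ) {l : ℕ}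
    (τ : ℤ) (ha : (l, k') ∈ nb k) :
    coef q e k (move m k' (l, τ)) s = rest q e k {(l, k')} m s *
      fac q s.2 (lam m s.1 k) (lam m l k' + τ) := by
  rw [coef_eq e _ s ha, lam_move_self, lam_move_of_ne_row _ _ _ _ hkk]
  congr 1
  refine rest_congr e (fun i => lam_move_of_ne_row _ _ _ _ hkk) (fun a _ ha2 => ?_) s
  rw [lam_move, if_neg, add_zero]
  intro hc
  exact ha2 (mem_singleton.2 (Prod.ext hc.1 hc.2))

theorem mem_nb_of_adjacent {k k' l : ℕ} (hk' : k' = k + 1 ∨ k = k' + 1) (hl : 1 ≤ l)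
    (hlk : l ≤ k' / 2) : (l, k') ∈ nb k := by
  rw [mem_nb]
  refine ⟨hl, ?_⟩
  rcases hk' with rfl | rfl
  · exact Or.inl ⟨hlk, rfl⟩
  · exact Or.inr ⟨by simpa using hlk, by simp⟩

/-- The matrix element of a move of row `k'` in terms of the factors of one component of the
adjacent row `k`. -/
theorem coef_of_row₁ (e : ℝ) {k k' : ℕ} (hkk : k ≠ k') {m m' : Pattern} (t : ℕ × ℤ) {j : ℕ}
    (ha : (j, k) ∈ nb k') (hm : ∀ a b, (a, b) ≠ (j, k) → lam m' a b = lam m a b) :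
    coef q e k' m' t = rest q e k' {(j, k)} m t * fac q t.2 (lam m t.1 k') (lam m' j k) := by
  rw [coef_eq e _ t ha, hm t.1 k' (by simp [hkk.symm])]
  congr 1
  refine rest_congr e (fun i => hm i k' (by simp [hkk.symm])) (fun a _ ha2 => ?_) t
  exact hm a.1 a.2 (by simpa using ha2)

/-- The matrix element of a move of row `k'` in terms of the factors of two components of the
adjacent row `k`. -/
theorem coef_of_row₂ (e : ℝ) {k k' : ℕ} (hkk : k ≠ k') {m m' : Pattern} (t : ℕ × ℤ) {i j : ℕ}
    (hij : i ≠ j) (ha : (i, k) ∈ nb k') (hb : (j, k) ∈ nb k')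
    (hm : ∀ a b, (a, b) ≠ (i, k) → (a, b) ≠ (j, k) → lam m' a b = lam m a b) :
    coef q e k' m' t = rest q e k' {(j, k), (i, k)} m t *
      (fac q t.2 (lam m t.1 k') (lam m' i k) * fac q t.2 (lam m t.1 k') (lam m' j k)) := by
  rw [coef_eq₂ e _ t ha hb (by simp [hij.symm]),
    hm t.1 k' (by simp [hkk.symm]) (by simp [hkk.symm])]
  congr 1
  refine rest_congr e (fun i => hm i k' (by simp [hkk.symm]) (by simp [hkk.symm]))
    (fun a _ ha2 => ?_) t
  simp only [mem_insert, mem_singleton, not_or] at ha2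
  exact hm a.1 a.2 ha2.2 ha2.1

end

/-! ### Paths whose moves of a row are not opposite -/

section

variable {q : ℝ}

/-- The hypotheses which the lemmas on a pair of adjacent rows share: the tableau `m` has rows
`k` and `k'`, these are adjacent, and both are below the top row. -/
structure AdjacentRows (n : ℕ) (M : ℕ → ℝ) (k k' : ℕ) (m : Pattern) : Prop where
  gt : IsGTTableau n M m
  adj : k' = k + 1 ∨ k = k' + 1
  le : k + 1 ≤ n
  le' : k' + 1 ≤ n
  pos : 1 ≤ k

namespace AdjacentRows
variable {n : ℕ} {M : ℕ → ℝ} {k k' : ℕ} {m : Pattern}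

theorem ne (h : AdjacentRows n M k k' m) : k ≠ k' := by
  have := h.adj; omega

/-- The row next to row `k` other than row `k'`. -/
theorem exists_other (h : AdjacentRows n M k k' m) (hk : 1 ≤ k) :
    ∃ k'', (k'' = k + 1 ∨ k = k'' + 1) ∧ k'' ≠ k' := by
  rcases h.adj with h1 | h1
  · exact ⟨k - 1, by omega, by omega⟩
  · exact ⟨k + 1, by omega, by omega⟩

variable (hq : 0 < q) (hq1 : q ≠ 1) (h : AdjacentRows n M k k' m) (e e' : ℝ)
include hq hq1 h

theorem pathSum_step_step {i j l : ℕ} {σ τ υ : ℤ} (hσ : σ = 1 ∨ σ = -1) (hτ : τ = 1 ∨ τ = -1)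
    (hυ : υ = 1 ∨ υ = -1) (hi : 1 ≤ i) (hik : i ≤ k / 2) (hj : 1 ≤ j) (hjk : j ≤ k / 2)
    (hl : 1 ≤ l) (hlk : l ≤ k' / 2) (hij : i ≠ j) :
    pathSum q e e' k k' m (l, υ) (i, σ) (j, τ) +
      pathSum q e e' k k' m (l, υ) (j, τ) (i, σ) = 0 := by
  have hkk := h.ne
  obtain ⟨k'', h1, h2⟩ := h.exists_other (by omega)
  have hl' := mem_nb_of_adjacent h.adj hl hlk
  have hi' := mem_nb_of_adjacent h.adj.symm hi hik
  have hj' := mem_nb_of_adjacent h.adj.symm hj hjk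
  obtain ⟨U, hu1, hu2⟩ := exists_rest_mul_rest hq hq1 h.gt e h.le (A := {(l, k')}) h1
    (by simpa using h2.symm) hσ hτ hi hik hj hjk hij
  have key := local_exchange hq hq1 (U := U)
    (h.gt.exists_int_sub hσ hυ h.adj (by have := h.le; omega) (by have := h.le'; omega)
      hi hik hl hlk)
    (h.gt.exists_int_sub hτ hυ h.adj (by have := h.le; omega) (by have := h.le'; omega)
      hj hjk hl hlk) (h.gt.sign_mul_lam_ne hσ hτ h.le hi hik hj hjk hij)
  rw [← hu1, ← hu2] at key
  have hT : ∀ m' : Pattern, (∀ a b, (a, b) ≠ (i, k) → (a, b) ≠ (j, k) → lam m' a b = lam m a b) →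
      coef q e' k' m' (l, υ) = rest q e' k' {(j, k), (i, k)} m (l, υ) *
        (nf q (υ * lam m l k') (lam m' i k) * nf q (υ * lam m l k') (lam m' j k)) := by
    intro m' hm'
    rw [coef_of_row₂ e' hkk (l, υ) hij hi' hj' hm']
    simp only [fac_of_sign hυ]
  rw [pathSum, pathSum, hT m (by simp),
    hT (move m k (i, σ)) (fun a b h1 _ => lam_move_of_pair_ne _ _ (i, σ) h1),
    hT (move m k (j, τ)) (fun a b _ h2 => lam_move_of_pair_ne _ _ (j, τ) h2),
    hT (move (move m k (i, σ)) k (j, τ)) (fun a b h1 h2 => by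
      rw [lam_move_of_pair_ne _ _ (j, τ) h2, lam_move_of_pair_ne _ _ (i, σ) h1]),
    hT (move (move m k (j, τ)) k (i, σ)) (fun a b h1 h2 => by
      rw [lam_move_of_pair_ne _ _ (i, σ) h1, lam_move_of_pair_ne _ _ (j, τ) h2])]
  simp only [coef_move_other e hkk _ _ _ hl', coef_eq e _ _ hl', fac_of_sign hσ, fac_of_sign hτ]
  simp only [lam_move_self, lam_move_of_ne _ _ (_, _) _ hij, lam_move_of_ne _ _ (_, _) _ hij.symm,
    lam_move_of_ne_row _ _ _ _ hkk.symm]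
  simp only [nf_sign_add hυ, nf_sign_add hσ, nf_sign_add hτ]
  simp only [← nf_sign_left hυ _ (lam m l k'), ← nf_sign_left hσ _ (lam m i k),
    ← nf_sign_left hτ _ (lam m j k)]
  linear_combination rest q e' k' {(j, k), (i, k)} m (l, υ) * key

theorem pathSum_step_same {i l : ℕ} {σ υ : ℤ} (hσ : σ = 1 ∨ σ = -1)
    (hυ : υ = 1 ∨ υ = -1) (hi : 1 ≤ i) (hik : i ≤ k / 2) (hl : 1 ≤ l) (hlk : l ≤ k' / 2) :
    pathSum q e e' k k' m (l, υ) (i, σ) (i, σ) = 0 := by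
  have hkk := h.ne
  have hl' := mem_nb_of_adjacent h.adj hl hlk
  have hi' := mem_nb_of_adjacent h.adj.symm hi hik
  have key := local_exchange_same hq hq1
    (h.gt.exists_int_sub hσ hυ h.adj (by have := h.le; omega) (by have := h.le'; omega)
      hi hik hl hlk)
  have hT : ∀ m' : Pattern, (∀ a b, (a, b) ≠ (i, k) → lam m' a b = lam m a b) →
      coef q e' k' m' (l, υ) = rest q e' k' {(i, k)} m (l, υ) *
        nf q (υ * lam m l k') (lam m' i k) := by
    intro m' hm'
    rw [coef_of_row₁ e' hkk (l, υ) hi' hm']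
    simp only [fac_of_sign hυ]
  have e1 : σ * (lam m i k + σ) = σ * lam m i k + 1 := by
    rcases hσ with rfl | rfl <;> push_cast <;> ring
  rw [pathSum, hT m (by simp),
    hT (move m k (i, σ)) (fun a b h1 => lam_move_of_pair_ne _ _ (i, σ) h1),
    hT (move (move m k (i, σ)) k (i, σ)) (fun a b h1 => by
      rw [lam_move_of_pair_ne _ _ (i, σ) h1, lam_move_of_pair_ne _ _ (i, σ) h1])]
  simp only [coef_move_other e hkk _ _ _ hl', coef_eq e _ _ hl', fac_of_sign hσ]
  simp only [lam_move_self, lam_move_of_ne_row _ _ _ _ hkk.symm]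
  simp only [nf_sign_add hυ, nf_sign_add hσ, e1]
  simp only [← nf_sign_left hυ _ (lam m l k'), ← nf_sign_left hσ _ (lam m i k)]
  linear_combination rest q e' k' {(i, k)} m (l, υ) * rest q e k {(l, k')} m (i, σ) *
    rest q e k {(l, k')} (move m k (i, σ)) (i, σ) * key

theorem pathSum_loop_step {i l : ℕ} {σ υ : ℤ} (hσ : σ = 1 ∨ σ = -1)
    (hυ : υ = 1 ∨ υ = -1) (hi : 1 ≤ i) (hik : i ≤ k / 2) (hl : 1 ≤ l) (hlk : l ≤ k' / 2) :
    pathSum q e e' k k' m (l, υ) (0, 0) (i, σ) +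
      pathSum q e e' k k' m (l, υ) (i, σ) (0, 0) = 0 := by
  have hkk := h.ne
  have hl' := mem_nb_of_adjacent h.adj hl hlk
  have hi' := mem_nb_of_adjacent h.adj.symm hi hik
  obtain ⟨U, hu1, hu2⟩ := exists_rest_mul_rest_loop hq e m (A := {(l, k')}) hσ hi hik
  have key := local_exchange_loop hq hq1 (U := U)
    (h.gt.exists_int_sub hσ hυ h.adj (by have := h.le; omega) (by have := h.le'; omega)
      hi hik hl hlk)
  rw [← hu1, ← hu2] at key
  have hT : ∀ m' : Pattern, (∀ a b, (a, b) ≠ (i, k) → lam m' a b = lam m a b) →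
      coef q e' k' m' (l, υ) = rest q e' k' {(i, k)} m (l, υ) *
        nf q (υ * lam m l k') (lam m' i k) := by
    intro m' hm'
    rw [coef_of_row₁ e' hkk (l, υ) hi' hm']
    simp only [fac_of_sign hυ]
  simp only [pathSum, move_loop] at key ⊢
  rw [hT m (by simp), hT (move m k (i, σ)) (fun a b h1 => lam_move_of_pair_ne _ _ (i, σ) h1)]
  simp only [coef_move_other e hkk _ _ _ hl', coef_eq e _ _ hl', fac_of_sign hσ, fac_zero]
  simp only [lam_move_self, lam_move_of_ne_row _ _ _ _ hkk.symm]
  simp only [nf_sign_add hυ, nf_sign_add hσ, cs_sign_add hυ]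
  simp only [← nf_sign_left hυ _ (lam m l k'), ← nf_sign_left hσ _ (lam m i k),
    ← cs_sign hυ (lam m l k')]
  linear_combination rest q e' k' {(i, k)} m (l, υ) * key

theorem pathSum_diag_step {i j : ℕ} {σ τ : ℤ} (hσ : σ = 1 ∨ σ = -1) (hτ : τ = 1 ∨ τ = -1)
    (hi : 1 ≤ i) (hik : i ≤ k / 2) (hj : 1 ≤ j) (hjk : j ≤ k / 2) (hij : i ≠ j) :
    pathSum q e e' k k' m (0, 0) (i, σ) (j, τ) +
      pathSum q e e' k k' m (0, 0) (j, τ) (i, σ) = 0 := by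
  have hkk := h.ne
  obtain ⟨k'', h1, h2⟩ := h.exists_other (by omega)
  have hi' := mem_nb_of_adjacent h.adj.symm hi hik
  have hj' := mem_nb_of_adjacent h.adj.symm hj hjk
  obtain ⟨U, hu1, hu2⟩ := exists_rest_mul_rest hq hq1 h.gt e h.le (A := ∅) h1
    (by simp) hσ hτ hi hik hj hjk hij
  have key := local_exchange_diag hq hq1 (U := U)
    (h.gt.exists_int_sub_row hτ hσ (by have := h.le; omega) hi hik hj hjk)
    (h.gt.sign_mul_lam_ne hσ hτ h.le hi hik hj hjk hij)
  rw [← hu1, ← hu2] at key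
  have hT : ∀ m' : Pattern, (∀ a b, (a, b) ≠ (i, k) → (a, b) ≠ (j, k) → lam m' a b = lam m a b) →
      coef q e' k' m' (0, 0) = rest q e' k' {(j, k), (i, k)} m (0, 0) *
        (cs q (lam m' i k) * cs q (lam m' j k)) := by
    intro m' hm'
    rw [coef_of_row₂ e' hkk (0, 0) hij hi' hj' hm']
    simp only [fac_zero]
  simp only [pathSum, move_loop] at key ⊢
  rw [hT m (by simp), hT (move m k (i, σ)) (fun a b h1 _ => lam_move_of_pair_ne _ _ (i, σ) h1),
    hT (move m k (j, τ)) (fun a b _ h2 => lam_move_of_pair_ne _ _ (j, τ) h2),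
    hT (move (move m k (i, σ)) k (j, τ)) (fun a b h1 h2 => by
      rw [lam_move_of_pair_ne _ _ (j, τ) h2, lam_move_of_pair_ne _ _ (i, σ) h1]),
    hT (move (move m k (j, τ)) k (i, σ)) (fun a b h1 h2 => by
      rw [lam_move_of_pair_ne _ _ (i, σ) h1, lam_move_of_pair_ne _ _ (j, τ) h2])]
  simp only [lam_move_self, lam_move_of_ne _ _ (_, _) _ hij, lam_move_of_ne _ _ (_, _) _ hij.symm,
    cs_sign_add hσ, cs_sign_add hτ]
  simp only [← cs_sign hσ (lam m i k), ← cs_sign hτ (lam m j k), coef]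
  linear_combination rest q e' k' {(j, k), (i, k)} m (0, 0) * key

omit hq1 in
theorem pathSum_diag_same {i : ℕ} {σ : ℤ} (hσ : σ = 1 ∨ σ = -1)
    (hi : 1 ≤ i) (hik : i ≤ k / 2) : pathSum q e e' k k' m (0, 0) (i, σ) (i, σ) = 0 := by
  have hkk := h.ne
  have hi' := mem_nb_of_adjacent h.adj.symm hi hik
  have hT : ∀ m' : Pattern, (∀ a b, (a, b) ≠ (i, k) → lam m' a b = lam m a b) →
      coef q e' k' m' (0, 0) = rest q e' k' {(i, k)} m (0, 0) * cs q (lam m' i k) := by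
    intro m' hm'
    rw [coef_of_row₁ e' hkk (0, 0) hi' hm']
    simp only [fac_zero]
  have e1 : σ * (lam m i k + σ) = σ * lam m i k + 1 := by
    rcases hσ with rfl | rfl <;> push_cast <;> ring
  simp only [pathSum, move_loop]
  rw [hT m (by simp), hT (move m k (i, σ)) (fun a b h1 => lam_move_of_pair_ne _ _ (i, σ) h1),
    hT (move (move m k (i, σ)) k (i, σ)) (fun a b h1 => by
      rw [lam_move_of_pair_ne _ _ (i, σ) h1, lam_move_of_pair_ne _ _ (i, σ) h1])]
  simp only [lam_move_self, cs_sign_add hσ, e1]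
  have key := cs_mul_cs hq (σ * lam m i k + 1) 1
  rw [add_sub_cancel_right, cs_sign hσ] at key
  linear_combination -rest q e' k' {(i, k)} m (0, 0) * coef q e k m (i, σ) *
    coef q e k (move m k (i, σ)) (i, σ) * key

/-- Paths whose moves `s₁`, `s₂` are not opposite cancel in pairs. -/
theorem pathSum_add_pathSum {s₁ s₂ t : ℕ × ℤ} (h1 : s₁ ∈ mv k) (h2 : s₂ ∈ mv k)
    (ht : t ∈ mv k') (hs : s₂ ≠ opp s₁) :
    pathSum q e e' k k' m t s₁ s₂ + pathSum q e e' k k' m t s₂ s₁ = 0 := by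
  obtain ⟨i, σ⟩ := s₁
  obtain ⟨j, τ⟩ := s₂
  obtain ⟨l, υ⟩ := t
  rw [mem_mv] at h1 h2 ht
  have hadj := h.adj
  have hs' : i = j → σ ≠ -τ := by
    rintro rfl rfl
    exact hs (by simp [opp])
  simp only [Prod.mk.injEq] at h1 h2 ht
  rcases h1 with ⟨hi, hik, hσ⟩ | ⟨ho1, rfl, rfl⟩ <;>
  rcases h2 with ⟨hj, hjk, hτ⟩ | ⟨ho2, rfl, rfl⟩ <;>
  rcases ht with ⟨hl, hlk, hυ⟩ | ⟨ho3, rfl, rfl⟩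
  · by_cases hij : i = j
    · subst hij
      obtain rfl : σ = τ := by have := hs' rfl; omega
      rw [h.pathSum_step_same hq hq1 e e' hσ hυ hi hik hl hlk, add_zero]
    · exact h.pathSum_step_step hq hq1 e e' hσ hτ hυ hi hik hj hjk hl hlk hij
  · by_cases hij : i = j
    · subst hij
      obtain rfl : σ = τ := by have := hs' rfl; omega
      rw [h.pathSum_diag_same hq e e' hσ hi hik, add_zero]
    · exact h.pathSum_diag_step hq hq1 e e' hσ hτ hi hik hj hjk hij
  · rw [add_comm]
    exact h.pathSum_loop_step hq hq1 e e' hσ hυ hi hik hl hlk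
  -- a diagonal term occurs only for odd rows, and `k`, `k'` have different parity
  · rw [Nat.odd_iff] at ho2 ho3; omega
  · exact h.pathSum_loop_step hq hq1 e e' hτ hυ hj hjk hl hlk
  · rw [Nat.odd_iff] at ho1 ho3; omega
  · exact absurd rfl (hs' rfl)
  · exact absurd rfl (hs' rfl)

end AdjacentRows

end

/-! ### An interpolation identity -/

section

/-- The leading coefficient of a polynomial in terms of its values at the points `v i`, where
points which coincide with others do not contribute, provided that they are zeros of the
polynomial (with multiplicity). -/
theorem sum_eval_div_prod_sub {ι : Type*} [DecidableEq ι] (s : Finset ι) (v : ι → ℝ)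
    {P : Polynomial ℝ} (hP : P.Monic) (hdeg : P.natDegree + 1 = #s)
    (hdvd : ∏ i ∈ s with ∃ j ∈ s, j ≠ i ∧ v j = v i, (Polynomial.X - Polynomial.C (v i)) ∣ P) :
    ∑ i ∈ s, P.eval (v i) / ∏ j ∈ s.erase i, (v i - v j) = 1 := by
  classical
  set B := s.filter fun i => ∃ j ∈ s, j ≠ i ∧ v j = v i with hB
  have hBs : B ⊆ s := filter_subset _ _
  obtain ⟨R, rfl⟩ := hdvd
  have hQ : (∏ i ∈ B, (Polynomial.X - Polynomial.C (v i))).Monic :=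
    Polynomial.monic_prod_of_monic _ _ fun i _ => Polynomial.monic_X_sub_C _
  have hR : R.Monic := hQ.of_mul_monic_left hP
  have hd : R.natDegree + 1 = #(s \ B) := by
    rw [hQ.natDegree_mul hR, Polynomial.natDegree_finsetProd_X_sub_C_eq_card] at hdeg
    rw [card_sdiff_of_subset hBs]; omega
  have hinj : Set.InjOn v (s \ B : Finset ι) := by
    intro i hi j hj hij
    by_contra hne
    rw [mem_coe, mem_sdiff] at hi hj
    exact hi.2 (mem_filter.2 ⟨hi.1, j, hj.1, Ne.symm hne, hij.symm⟩)
  have hL := Lagrange.leadingCoeff_eq_sum hinj (P := R) (by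
    rw [Polynomial.degree_eq_natDegree hR.ne_zero, ← hd]; norm_cast)
  rw [hR.leadingCoeff] at hL
  rw [hL, ← sum_sdiff hBs]
  have h0 : ∑ i ∈ B, ((∏ i ∈ B, (Polynomial.X - Polynomial.C (v i))) * R).eval (v i) /
      ∏ j ∈ s.erase i, (v i - v j) = 0 := by
    refine sum_eq_zero fun i hi => ?_
    obtain ⟨his, j, hjs, hji, hv⟩ := mem_filter.1 hi
    rw [prod_eq_zero (i := j) (mem_erase.2 ⟨hji, hjs⟩) (by rw [hv, sub_self]), div_zero]
  rw [h0, add_zero]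
  refine sum_congr rfl fun i hi => ?_
  have hi' := mem_sdiff.1 hi
  have h1 : s.erase i = B ∪ (s \ B).erase i := by
    ext a
    simp only [mem_erase, mem_union, mem_sdiff]
    constructor
    · rintro ⟨h1, h2⟩; tauto
    · rintro (h1 | h1)
      · exact ⟨by rintro rfl; exact hi'.2 h1, hBs h1⟩
      · exact ⟨h1.1, h1.2.1⟩
  have h2 : Disjoint B ((s \ B).erase i) :=
    disjoint_left.2 fun a ha hb => (mem_sdiff.1 (mem_of_mem_erase hb)).2 ha
  rw [h1, prod_union h2, Polynomial.eval_mul, Polynomial.eval_prod]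
  simp only [Polynomial.eval_sub, Polynomial.eval_X, Polynomial.eval_C]
  refine mul_div_mul_left _ _ ?_
  rw [prod_ne_zero_iff]
  intro j hj hc
  exact hi'.2 (mem_filter.2 ⟨hi'.1, j, hBs hj, by rintro rfl; exact hi'.2 hj,
    (sub_eq_zero.1 hc).symm⟩)

@[to_additive]
theorem prod_mv {α : Type*} [CommMonoid α] (k : ℕ) (F : ℕ × ℤ → α) :
    ∏ s ∈ mv k, F s = (∏ i ∈ Icc 1 (k / 2), F (i, 1) * F (i, -1)) *
      if Odd k then F (0, 0) else 1 := by
  rw [mv, prod_union, prod_product]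
  · congr 1
    · simp
    · split_ifs <;> simp
  · rw [disjoint_left]
    intro a h1 h2
    split_ifs at h2
    · simp only [mem_product, mem_Icc, mem_singleton] at h1 h2
      rw [h2] at h1; simp at h1
    · simp at h2

theorem card_mv (k : ℕ) : #(mv k) = k / 2 * 2 + if Odd k then 1 else 0 := by
  rw [mv, card_union_of_disjoint]
  · split_ifs <;> simp
  · rw [disjoint_left]
    intro a h1 h2
    split_ifs at h2
    · simp only [mem_product, mem_Icc, mem_singleton] at h1 h2
      rw [h2] at h1; simp at h1
    · simp at h2

/-- The interpolation nodes: the move of a shifted component from `y` to `y + 1` has the node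
`cc q (y + 1 / 2)`, so that the factors of the adjacent components `a` are `√|cc q a - v|` for the
node `v`. The diagonal term has the node `-2`, for which `cc q a - v` is `cs q a ^ 2`. -/
def node (q : ℝ) (k : ℕ) (m : Pattern) (s : ℕ × ℤ) : ℝ :=
  if s.2 = 0 then -2 else cc q (s.2 * lam m s.1 k + 1 / 2)

variable {q : ℝ}

theorem node_step (k : ℕ) (m : Pattern) (j : ℕ) {σ : ℤ} (hσ : σ = 1 ∨ σ = -1) :
    node q k m (j, σ) = cc q (σ * lam m j k + 1 / 2) := by
  rw [node, if_neg]; simp only; omega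

theorem node_loop (k : ℕ) (m : Pattern) (j : ℕ) : node q k m (j, 0) = -2 := if_pos rfl

section
variable (hq : 0 < q)
include hq

theorem sub_cc_add_half_mul (u a : ℝ) :
    (u - cc q (a + 1 / 2)) * (u - cc q (-a + 1 / 2)) =
      u ^ 2 - cs q 1 * cc q a * u + (cc q a ^ 2 + cs q 1 ^ 2 - 4) := by
  have h1 := cs_mul_cs hq (2 * a) 1
  have h2 := cs_mul_cs hq (2 * a + 1) (2 * a - 1)
  have h3 := cs_mul_cs hq (2 * a) (2 * a)
  have h4 := cs_mul_cs hq 1 1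
  rw [sub_self, cs_zero] at h3 h4
  rw [show 2 * a + 1 + (2 * a - 1) = 2 * a + 2 * a by ring,
    show 2 * a + 1 - (2 * a - 1) = 1 + 1 by ring] at h2
  rw [← cc_neg q (-a + 1 / 2), cc, cc, cc, show 2 * (a + 1 / 2) = 2 * a + 1 by ring,
    show 2 * -(-a + 1 / 2) = 2 * a - 1 by ring]
  linear_combination u * h1 + h2 - h3 - h4

theorem sub_cc_mul_sub_cc (b a : ℝ) :
    (cc q (b + 1 / 2) - cc q (a + 1 / 2)) * (cc q (b + 1 / 2) - cc q (-a + 1 / 2)) =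
      (cc q a - cc q b) * (cc q a - cc q (b + 1)) := by
  have h1 := cs_mul_cs hq (2 * b + 1) 1
  have h2 := cs_mul_cs hq (2 * b + 2) (2 * b)
  have h3 := cs_mul_cs hq (2 * b + 1) (2 * b + 1)
  have h4 := cs_mul_cs hq 1 1
  rw [sub_self, cs_zero] at h3 h4
  rw [show 2 * b + 1 + 1 = 2 * b + 2 by ring, show 2 * b + 1 - 1 = 2 * b by ring] at h1
  rw [show 2 * b + 2 + 2 * b = 2 * b + 1 + (2 * b + 1) by ring,
    show 2 * b + 2 - 2 * b = 1 + 1 by ring] at h2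
  rw [sub_cc_add_half_mul hq]
  rw [show cc q (b + 1 / 2) = cs q (2 * b + 1) by rw [cc]; congr 1; ring,
    show cc q (b + 1) = cs q (2 * b + 2) by rw [cc]; congr 1; ring,
    show cc q b = cs q (2 * b) from rfl]
  linear_combination -cc q a * h1 + h3 + h4 - h2

theorem cc_sub_cc_neg_add_half (y : ℝ) :
    cc q (y + 1 / 2) - cc q (-y + 1 / 2) = sn q 1 * sn q (2 * y) := by
  rw [cc_sub_cc hq]; congr 2 <;> ring

/-- The differences of the nodes reproduce the denominators of the matrix elements. -/
theorem prod_node_sub_step (k : ℕ) (m : Pattern) {j : ℕ} {σ : ℤ} (hσ : σ = 1 ∨ σ = -1)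
    (hj : 1 ≤ j) (hjk : j ≤ k / 2) :
    ∏ s ∈ (mv k).erase (j, σ), (node q k m (j, σ) - node q k m s) =
      sn q 1 * sn q (2 * (σ * lam m j k)) *
      (∏ i ∈ (Icc 1 (k / 2)).erase j, (cc q (lam m i k) - cc q (lam m j k)) *
        (cc q (lam m i k) - cc q (lam m j k + σ))) *
      if Odd k then cc q (σ * lam m j k + 1 / 2) + 2 else 1 := by
  set F : ℕ × ℤ → ℝ := fun s => if s = (j, σ) then 1 else node q k m (j, σ) - node q k m s with hF
  have h1 : ∏ s ∈ (mv k).erase (j, σ), (node q k m (j, σ) - node q k m s) = ∏ s ∈ mv k, F s := by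
    rw [← prod_erase (mv k) (a := (j, σ)) (by simp [hF])]
    refine prod_congr rfl fun s hs => ?_
    rw [hF]; simp only
    rw [if_neg (ne_of_mem_erase hs)]
  have hF0 : F (0, 0) = node q k m (j, σ) - node q k m (0, 0) := by
    rw [hF]; simp only; rw [if_neg]; simp; omega
  rw [h1, prod_mv, ← mul_prod_erase _ _ (mem_Icc.2 ⟨hj, hjk⟩), hF0, node_loop, node_step k m j hσ,
    sub_neg_eq_add]
  congr 2
  · have h2 : ∀ τ : ℤ, (τ = 1 ∨ τ = -1) → τ ≠ σ → F (j, τ) =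
        cc q (σ * lam m j k + 1 / 2) - cc q (τ * lam m j k + 1 / 2) := fun τ hτ hne => by
      rw [hF]; simp only; rw [if_neg (by simp [hne]), node_step k m j hσ, node_step k m j hτ]
    have h3 : F (j, σ) = 1 := by simp [hF]
    rw [← cc_sub_cc_neg_add_half hq]
    rcases hσ with rfl | rfl
    · rw [h3, h2 (-1) (by simp) (by simp), one_mul]; norm_num
    · rw [h3, h2 1 (by simp) (by simp), mul_one]; norm_num
  · refine prod_congr rfl fun i hi => ?_
    have hij := ne_of_mem_erase hi
    have h2 : ∀ τ : ℤ, (τ = 1 ∨ τ = -1) → F (i, τ) =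
        cc q (σ * lam m j k + 1 / 2) - cc q (τ * lam m i k + 1 / 2) := fun τ hτ => by
      rw [hF]; simp only; rw [if_neg (by simp [hij]), node_step k m j hσ, node_step k m i hτ]
    rw [h2 1 (by simp), h2 (-1) (by simp), cc_sign_add hσ, ← cc_sign hσ (lam m j k),
      ← sub_cc_mul_sub_cc hq]
    norm_num

theorem prod_node_sub_loop (k : ℕ) (m : Pattern) (hk : Odd k) :
    ∏ s ∈ (mv k).erase (0, 0), (node q k m (0, 0) - node q k m s) =
      ∏ i ∈ Icc 1 (k / 2), (cc q (lam m i k) + cc q (1 / 2)) ^ 2 := by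
  set F : ℕ × ℤ → ℝ := fun s => if s = (0, 0) then 1 else node q k m (0, 0) - node q k m s with hF
  have h1 : ∏ s ∈ (mv k).erase (0, 0), (node q k m (0, 0) - node q k m s) = ∏ s ∈ mv k, F s := by
    rw [← prod_erase (mv k) (a := (0, 0)) (by simp [hF])]
    refine prod_congr rfl fun s hs => ?_
    rw [hF]; simp only
    rw [if_neg (ne_of_mem_erase hs)]
  have hF0 : F (0, 0) = 1 := by simp [hF]
  rw [h1, prod_mv, if_pos hk, hF0, mul_one]
  refine prod_congr rfl fun i _ => ?_
  have h2 : ∀ τ : ℤ, (τ = 1 ∨ τ = -1) → F (i, τ) = -2 - cc q (τ * lam m i k + 1 / 2) :=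
    fun τ hτ => by
      rw [hF]; simp only; rw [if_neg (by simp; omega), node_step k m i hτ, node_loop]
  have h3 := sub_cc_add_half_mul hq (-2) (lam m i k)
  rw [h2 1 (by simp), h2 (-1) (by simp)]
  push_cast
  rw [one_mul, neg_one_mul, h3, show cc q (1 / 2) = cs q 1 by rw [cc]; norm_num]
  ring

end

/-! ### Signs of the factors of the matrix elements -/

namespace IsGTTableau
variable {n : ℕ} {M : ℕ → ℝ} {m : Pattern} (h : IsGTTableau n M m)
include h

/-- On which side of the node of a move of `m_{j,k}` an adjacent component lies is determined by
the betweenness conditions. -/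
theorem abs_cc_sub_cc_nb (hq : 0 < q) (hq1 : q ≠ 1) {j k : ℕ} {σ : ℤ} (hσ : σ = 1 ∨ σ = -1)
    (hkn : k + 1 ≤ n) (hj : 1 ≤ j) (hjk : j ≤ k / 2) {a : ℕ × ℕ} (ha : a ∈ nb k) :
    |cc q (lam m a.1 a.2) - cc q (σ * lam m j k + 1 / 2)| =
      nbSign j k a * (cc q (lam m a.1 a.2) - cc q (σ * lam m j k + 1 / 2)) := by
  obtain ⟨i, k'⟩ := a
  obtain ⟨hi, ha⟩ := mem_nb.1 ha
  simp only at hi ha ⊢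
  have hI := h.interlaces
  have h1 : |σ * lam m j k + 1 / 2| ≤ |lam m j k| + 1 / 2 ∧
      |lam m j k| - 1 / 2 ≤ |σ * lam m j k + 1 / 2| := by
    rcases abs_sign_mul_add_half hσ (h.half_le_abs_lam hkn hj hjk) with h2 | h2 <;> rw [h2] <;>
      constructor <;> linarith
  have hup : |lam m j k| + 1 / 2 ≤ |lam m i k'| →
      |cc q (lam m i k') - cc q (σ * lam m j k + 1 / 2)| =
        cc q (lam m i k') - cc q (σ * lam m j k + 1 / 2) := fun h2 => by
    rw [abs_of_nonneg]
    rw [sub_nonneg]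
    exact cc_le_cc hq hq1 (by linarith)
  have hdown : |lam m i k'| + 1 / 2 ≤ |lam m j k| →
      |cc q (lam m i k') - cc q (σ * lam m j k + 1 / 2)| =
        -(cc q (lam m i k') - cc q (σ * lam m j k + 1 / 2)) := fun h2 => by
    rw [abs_of_nonpos]
    rw [sub_nonpos]
    exact cc_le_cc hq hq1 (by linarith)
  rcases ha with ⟨hik, rfl⟩ | ⟨hik, rfl⟩
  · rw [nbSign, if_pos rfl]
    simp only
    split_ifs with hij
    · rw [one_mul]
      apply hup
      have h2 := hI.upper k i (by omega) hkn hi (by omega)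
      have h3 := hI.abs_le_of_le hkn hi hij hjk
      linarith [le_abs_self (lam m i (k + 1))]
    · rw [neg_one_mul]
      apply hdown
      obtain ⟨b, rfl⟩ : ∃ b, i = b + 1 := ⟨i - 1, by omega⟩
      have h2 := hI.lower k b (by omega) hkn (by omega) hik
      have h3 := hI.abs_le_of_le hkn (show 1 ≤ j from hj) (show j ≤ b by omega) (by omega)
      have h4 := le_abs_self (lam m b k)
      linarith
  · rw [nbSign, if_neg (show ¬ k - 1 = k + 1 by omega)]
    simp only
    obtain ⟨k, rfl⟩ : ∃ r, k = r + 1 := ⟨k - 1, by omega⟩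
    simp only [Nat.add_sub_cancel] at *
    split_ifs with hij
    · rw [one_mul]
      apply hup
      have h2 := hI.lower k i (by omega) (by omega) hi (by omega)
      have h3 := hI.abs_le_of_le hkn (show 1 ≤ i + 1 by omega) (show i + 1 ≤ j by omega) hjk
      linarith [le_abs_self (lam m i k)]
    · rw [neg_one_mul]
      apply hdown
      have h2 := hI.upper k i (by omega) (by omega) hi (by omega)
      have h3 := hI.abs_le_of_le hkn hj (not_lt.1 hij) (by omega)
      have h4 := le_abs_self (lam m i (k + 1))
      linarith

theorem cc_sub_mul_cc_sub_nonneg (hq : 0 < q) (hq1 : q ≠ 1) {i j k : ℕ} {σ : ℤ}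
    (hσ : σ = 1 ∨ σ = -1) (hkn : k + 1 ≤ n) (hi : 1 ≤ i) (hik : i ≤ k / 2) (hj : 1 ≤ j)
    (hjk : j ≤ k / 2) (hij : i ≠ j) :
    0 ≤ (cc q (lam m i k) - cc q (lam m j k)) * (cc q (lam m i k) - cc q (lam m j k + σ)) := by
  have h1 : |lam m j k + σ| ≤ |lam m j k| + 1 ∧ |lam m j k| - 1 ≤ |lam m j k + σ| := by
    have h2 : |(σ : ℝ)| = 1 := by rcases hσ with rfl | rfl <;> simp
    have h3 := abs_add_le (lam m j k) σ
    have h4 := abs_sub_abs_le_abs_sub (lam m j k) (-σ)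
    rw [abs_neg, sub_neg_eq_add] at h4
    constructor <;> linarith
  rcases lt_or_gt_of_ne hij with h2 | h2
  · have h3 := h.interlaces.abs_le_of_lt hkn hi h2 hjk
    have h4 := le_abs_self (lam m i k)
    refine mul_nonneg ?_ ?_ <;> rw [sub_nonneg] <;> exact cc_le_cc hq hq1 (by linarith)
  · have h3 := h.interlaces.abs_le_of_lt hkn hj h2 hik
    have h4 := le_abs_self (lam m j k)
    refine mul_nonneg_of_nonpos_of_nonpos ?_ ?_ <;> rw [sub_nonpos] <;>
      exact cc_le_cc hq hq1 (by linarith)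

/-- In the product of the matrix elements of a move and its opposite all square roots disappear. -/
theorem rest_mul_rest_opp (hq : 0 < q) (hq1 : q ≠ 1) (e : ℝ) {j k : ℕ} {σ : ℤ}
    (hσ : σ = 1 ∨ σ = -1) (hkn : k + 1 ≤ n) (hj : 1 ≤ j) (hjk : j ≤ k / 2)
    {A : Finset (ℕ × ℕ)} (hA : A ⊆ nb k) :
    rest q e k A m (j, σ) * rest q e k A (move m k (j, σ)) (j, -σ) =
      wt q k (σ * lam m j k) * wt q k (-(σ * lam m j k) - 1) *
      (∏ i ∈ (Icc 1 (k / 2)).erase j, (cc q (lam m i k) - cc q (lam m j k)) *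
        (cc q (lam m i k) - cc q (lam m j k + σ)))⁻¹ *
      ((∏ a ∈ A, nbSign j k a) *
        ∏ a ∈ nb k \ A, (cc q (lam m a.1 a.2) - cc q (σ * lam m j k + 1 / 2))) := by
  have hσ' : -σ = 1 ∨ -σ = -1 := by omega
  have hne : ∀ a ∈ nb k \ A, a.2 ≠ k := by
    intro a ha
    have := mem_nb.1 (mem_sdiff.1 ha).1
    omega
  have e1 : ((-σ : ℤ) : ℝ) * (lam m j k + σ) = -(σ * lam m j k) - 1 := by
    rcases hσ with rfl | rfl <;> push_cast <;> ring
  rw [rest, rest, base, base, if_neg (show σ ≠ 0 by omega), if_neg (show -σ ≠ 0 by omega)]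
  simp only [lam_move_self, e1, fac_of_sign hσ, fac_of_sign hσ']
  have p1 : (∏ i ∈ (Icc 1 (k / 2)).erase j, (√(|cc q (lam m i k) - cc q (lam m j k)| *
      |cc q (lam m i k) - cc q (lam m j k + σ)|))⁻¹) *
      (∏ i ∈ (Icc 1 (k / 2)).erase j, (√(|cc q (lam (move m k (j, σ)) i k) -
        cc q (lam m j k + σ)| * |cc q (lam (move m k (j, σ)) i k) -
          cc q (lam m j k + σ + ((-σ : ℤ) : ℝ))|))⁻¹) =
      (∏ i ∈ (Icc 1 (k / 2)).erase j, (cc q (lam m i k) - cc q (lam m j k)) *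
        (cc q (lam m i k) - cc q (lam m j k + σ)))⁻¹ := by
    rw [← prod_mul_distrib, ← prod_inv_distrib]
    refine prod_congr rfl fun i hi => ?_
    obtain ⟨hij, hi⟩ := mem_erase.1 hi
    obtain ⟨hi, hik⟩ := mem_Icc.1 hi
    rw [lam_move_of_ne _ _ (_, _) _ hij]
    push_cast
    rw [add_neg_cancel_right, mul_comm |cc q (lam m i k) - cc q (lam m j k + σ)|, ← mul_inv,
      Real.mul_self_sqrt (by positivity), ← abs_mul,
      abs_of_nonneg (h.cc_sub_mul_cc_sub_nonneg hq hq1 hσ hkn hi hik hj hjk hij)]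
  have p2 : (∏ a ∈ nb k \ A, nf q (σ * lam m j k) (lam m a.1 a.2)) *
      (∏ a ∈ nb k \ A, nf q (-(σ * lam m j k) - 1) (lam (move m k (j, σ)) a.1 a.2)) =
      (∏ a ∈ A, nbSign j k a) *
        ∏ a ∈ nb k \ A, (cc q (lam m a.1 a.2) - cc q (σ * lam m j k + 1 / 2)) := by
    have hs : ∏ a ∈ A, nbSign j k a = ∏ a ∈ nb k \ A, nbSign j k a := by
      have h1 := prod_nbSign (j := j) (k := k) hj (by omega)
      rw [← prod_sdiff hA] at h1
      have h2 : (∏ a ∈ A, nbSign j k a) * ∏ a ∈ A, nbSign j k a = 1 := by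
        rw [← prod_mul_distrib]
        exact prod_eq_one fun a _ => nbSign_mul_self j k a
      linear_combination (∏ a ∈ nb k \ A, nbSign j k a) * h2 - (∏ a ∈ A, nbSign j k a) * h1
    rw [hs, ← prod_mul_distrib, ← prod_mul_distrib]
    refine prod_congr rfl fun a ha => ?_
    rw [lam_move_of_ne_row _ _ _ _ (hne a ha), nf, nf,
      show -(σ * lam m j k) - 1 + 1 / 2 = -(σ * lam m j k + 1 / 2) by ring, cc_neg,
      Real.mul_self_sqrt (abs_nonneg _),
      h.abs_cc_sub_cc_nb hq hq1 hσ hkn hj hjk (mem_sdiff.1 ha).1]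
  rw [← p1, ← p2]
  ring

end IsGTTableau

end

/-! ### The interpolation polynomial of a row -/

section

variable {q : ℝ}

section
variable (hq : 0 < q) (hq1 : q ≠ 1)
include hq hq1

theorem wt_mul_wt_of_odd {k : ℕ} (hk : Odd k) {y : ℝ} (hy : y ≠ 0) (hy1 : y + 1 ≠ 0) :
    wt q k y * wt q k (-y - 1) * (sn q 1 * sn q (2 * y + 2)) =
      -(sn q 1 * sn q (2 * y) * (cc q (y + 1 / 2) + 2))⁻¹ := by
  have h1 := sn_one_ne_zero hq hq1
  have h2 : sn q (2 * y) ≠ 0 := by rw [Ne, sn_eq_zero_iff hq hq1]; simpa using hy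
  have h3 : sn q (2 * y + 2) ≠ 0 := by
    rw [Ne, sn_eq_zero_iff hq hq1]; intro h; exact hy1 (by linarith)
  have h4 := (cs_pos hq (y + 1 / 2)).ne'
  rw [wt, wt, if_pos hk, if_pos hk, cc_add_two hq, show -y - 1 + 1 / 2 = -(y + 1 / 2) by ring,
    cs_neg, show 2 * (-y - 1) = -(2 * y + 2) by ring, sn_neg, ← mul_inv,
    show |sn q 1| * (sn q (2 * y) * cs q (y + 1 / 2)) * (|sn q 1| * (-sn q (2 * y + 2) *
      cs q (y + 1 / 2))) = -(|sn q 1| * |sn q 1|) * (sn q (2 * y) * sn q (2 * y + 2) *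
        cs q (y + 1 / 2) ^ 2) by ring, abs_mul_abs_self]
  generalize cs q (y + 1 / 2) = c at *
  generalize sn q (2 * y + 2) = d at *
  field_simp

theorem wt_mul_wt_of_even {k : ℕ} (hk : ¬ Odd k) {y : ℝ} (hy : y ≠ 0) (hy1 : y + 1 ≠ 0) :
    wt q k y * wt q k (-y - 1) * (sn q 1 * sn q (y + 1)) = -(sn q 1 * sn q y)⁻¹ := by
  have h1 := sn_one_ne_zero hq hq1
  have h2 : sn q y ≠ 0 := by rwa [Ne, sn_eq_zero_iff hq hq1]
  have h3 : sn q (y + 1) ≠ 0 := by rwa [Ne, sn_eq_zero_iff hq hq1]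
  rw [wt, wt, if_neg hk, if_neg hk, show -y - 1 = -(y + 1) by ring, sn_neg, ← mul_inv,
    show |sn q 1| * sn q y * (|sn q 1| * -sn q (y + 1)) =
      -(|sn q 1| * |sn q 1|) * (sn q y * sn q (y + 1)) by ring, abs_mul_abs_self]
  field_simp

end

namespace IsGTTableau
variable {n : ℕ} {M : ℕ → ℝ} {m : Pattern} (h : IsGTTableau n M m)
include h

/-- A component of an odd row which cannot be lowered because it has reached its least possible
value `1` is next to components `±1/2` of both adjacent rows. -/
theorem exists_nb_of_add_one_eq_zero {j k : ℕ} {σ : ℤ} (hσ : σ = 1 ∨ σ = -1) (hkn : k + 1 ≤ n)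
    (hj : 1 ≤ j) (hjk : j ≤ k / 2) (hy : σ * lam m j k + 1 = 0) {k' : ℕ}
    (hk' : k' = k + 1 ∨ k = k' + 1) :
    ∃ a ∈ nb k, a.2 = k' ∧ |lam m a.1 a.2| = |σ * lam m j k + 1 / 2| := by
  have hodd : Odd k := by
    by_contra hc
    rw [Nat.not_odd_iff] at hc
    obtain ⟨a, ha, ha2⟩ := exists_two_mul_lam_eq h.toIsHalfArray (by omega) (by omega) hj hjk
    rw [ha] at hy
    have : (σ : ℝ) * a + 2 = 0 := by linarith
    have : σ * a + 2 = 0 := by exact_mod_cast this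
    rcases hσ with rfl | rfl <;> omega
  rw [Nat.odd_iff] at hodd
  have h1 := h.interlaces.lower k j (by omega) hkn hj (by omega)
  have h2 : lam m j k = 1 := by
    have := abs_nonneg (lam m (j + 1) (k + 1))
    rcases hσ with rfl | rfl <;> push_cast at hy <;> linarith
  have h3 : |σ * lam m j k + 1 / 2| = 1 / 2 := by
    rw [show σ * lam m j k + 1 / 2 = -(1 / 2) by linarith, abs_neg, abs_of_pos (by norm_num)]
  rw [h3]
  have half : ∀ i r, |lam m i r| + 1 / 2 ≤ 1 → 2 ≤ r → r ≤ n → 1 ≤ i → i ≤ r / 2 → r % 2 = 0 →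
      |lam m i r| = 1 / 2 := by
    intro i r h1 hr hrn hi hir hr2
    obtain ⟨a, ha, ha2⟩ := exists_two_mul_lam_eq h.toIsHalfArray hr hrn hi hir
    have h4 : 1 ≤ |a| := Int.one_le_abs (by rintro rfl; omega)
    have h5 : (1 : ℝ) ≤ |(a : ℝ)| := by exact_mod_cast h4
    have h6 : |lam m i r| = |(a : ℝ)| / 2 := by rw [ha, abs_div, abs_two]
    linarith
  rcases hk' with rfl | rfl
  · exact ⟨(j + 1, k + 1), mem_nb.2 ⟨by simp, Or.inl ⟨by simp; omega, rfl⟩⟩, rfl,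
      half _ _ (by rw [h2] at h1; exact h1) (by omega) hkn (by omega) (by omega) (by omega)⟩
  · have h4 := h.interlaces.upper k' j (by omega) (by omega) hj (by omega)
    exact ⟨(j, k'), mem_nb.2 ⟨hj, Or.inr ⟨by simp; omega, by simp⟩⟩, rfl,
      half _ _ (by rw [h2] at h4; exact h4) (by omega) (by omega) hj (by omega) (by omega)⟩

/-- Where nodes coincide, components of the adjacent rows are squeezed between two components of
row `k`, and their factors are zero at these nodes. None of these components belongs to a set `A`
of positions at which the entry may change with row `k` fixed. -/
theorem prod_X_sub_C_node_dvd (hq : 0 < q) (hq1 : q ≠ 1) {k : ℕ} (hkn : k + 1 ≤ n)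
    {m' : Pattern} (h' : IsGTTableau n M m') (hrow : ∀ i, lam m' i k = lam m i k)
    {A : Finset (ℕ × ℕ)} (hA : ∀ a ∈ A, lam m' a.1 a.2 ≠ lam m a.1 a.2) :
    ∏ s ∈ mv k with ∃ s' ∈ mv k, s' ≠ s ∧ node q k m s' = node q k m s,
      (Polynomial.X - Polynomial.C (node q k m s)) ∣
    ∏ a ∈ nb k \ A, (Polynomial.X - Polynomial.C (cc q (lam m a.1 a.2))) := by
  classical
  set B := (mv k).filter fun s => ∃ s' ∈ mv k, s' ≠ s ∧ node q k m s' = node q k m s with hB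
  -- an outward move that collides crosses a component of the row above, an inward one a component
  -- of the row below
  set g : ℕ × ℤ → ℕ × ℕ := fun s =>
    if |s.2 * lam m s.1 k + 1 / 2| = |lam m s.1 k| + 1 / 2 then (s.1, k + 1) else (s.1, k - 1)
    with hg
  have hBstep : ∀ s ∈ B, ∃ j σ, s = (j, σ) ∧ (σ = 1 ∨ σ = -1) ∧ 1 ≤ j ∧ j ≤ k / 2 ∧
      ∃ i, 1 ≤ i ∧ i ≤ k / 2 ∧
        ((|lam m i k| = |lam m j k| + 1 ∧ |σ * lam m j k + 1 / 2| = |lam m j k| + 1 / 2) ∨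
         (|lam m j k| = |lam m i k| + 1 ∧ |σ * lam m j k + 1 / 2| = |lam m j k| - 1 / 2)) := by
    rintro ⟨j, σ⟩ hs
    obtain ⟨hs, ⟨i, τ⟩, hs', hne, hv⟩ := mem_filter.1 hs
    rw [mem_mv] at hs hs'
    simp only [Prod.mk.injEq] at hs hs'
    rcases hs with ⟨hj, hjk, hσ⟩ | ⟨-, rfl, rfl⟩ <;>
    rcases hs' with ⟨hi, hik, hτ⟩ | ⟨-, rfl, rfl⟩
    · refine ⟨j, σ, rfl, hσ, hj, hjk, i, hi, hik, ?_⟩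
      rw [node_step k m i hτ, node_step k m j hσ, cc_eq_cc_iff hq hq1] at hv
      have a1 := abs_sign_mul_add_half hσ (h.half_le_abs_lam hkn hj hjk)
      have a2 := abs_sign_mul_add_half hτ (h.half_le_abs_lam hkn hi hik)
      by_cases hij : i = j
      · subst hij
        exfalso
        have h1 : τ = -σ := by
          have : τ ≠ σ := by rintro rfl; exact hne rfl
          omega
        subst h1
        have := h.half_le_abs_lam hkn hi hik
        rw [cc_eq_cc_iff hq hq1 |>.symm, ← sub_eq_zero] at hv
        push_cast at hv
        rw [neg_mul, ← neg_eq_zero, neg_sub, cc_sub_cc_neg_add_half hq, mul_eq_zero,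
          sn_eq_zero_iff hq hq1, sn_eq_zero_iff hq hq1] at hv
        have h2 : lam m i k = 0 := by
          rcases hσ with rfl | rfl <;> push_cast at hv <;> rcases hv with hv | hv <;> linarith
        rw [h2, abs_zero] at this
        linarith
      · have := h.interlaces.abs_ne hkn hi hj hij hik hjk
        rcases a1 with a1 | a1 <;> rcases a2 with a2 | a2
        · exact absurd (by linarith) this
        · exact Or.inl ⟨by linarith, a1⟩
        · exact Or.inr ⟨by linarith, a1⟩
        · exact absurd (by linarith) this
    · rw [node_loop, node_step k m j hσ] at hv
      linarith [cc_pos hq (σ * lam m j k + 1 / 2)]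
    · rw [node_loop, node_step k m i hτ] at hv
      linarith [cc_pos hq (τ * lam m i k + 1 / 2)]
    · exact absurd rfl hne
  have hginj : Set.InjOn g B := by
    intro s hs s' hs' hss
    obtain ⟨j, σ, rfl, hσ, hj, hjk, i, hi, hik, hc⟩ := hBstep s hs
    obtain ⟨j', σ', rfl, hσ', hj', hjk', i', hi', hik', hc'⟩ := hBstep s' hs'
    have hhalf := h.half_le_abs_lam hkn hj hjk
    have hjj : j = j' := by
      simp only [hg] at hss
      split_ifs at hss <;> simpa using (congrArg Prod.fst hss)
    subst hjj
    have hσσ : |σ * lam m j k + 1 / 2| = |σ' * lam m j k + 1 / 2| := by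
      simp only [hg] at hss
      split_ifs at hss with h1 h2 h2
      · rw [h1, h2]
      · simp only [Prod.mk.injEq] at hss; omega
      · simp only [Prod.mk.injEq] at hss; omega
      · rcases hc with hc | hc
        · exact absurd hc.2 h1
        · rcases hc' with hc' | hc'
          · exact absurd hc'.2 h2
          · rw [hc.2, hc'.2]
    by_contra hne
    have h1 : σ' = -σ := by
      have : σ' ≠ σ := by rintro rfl; exact hne rfl
      omega
    subst h1
    rw [← cc_eq_cc_iff hq hq1, ← sub_eq_zero] at hσσ
    push_cast at hσσ
    rw [neg_mul, cc_sub_cc_neg_add_half hq, mul_eq_zero, sn_eq_zero_iff hq hq1,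
      sn_eq_zero_iff hq hq1] at hσσ
    have h2 : lam m j k = 0 := by
      rcases hσ with rfl | rfl <;> push_cast at hσσ <;> rcases hσσ with h3 | h3 <;> linarith
    rw [h2, abs_zero] at hhalf
    linarith
  have hgval : ∀ s ∈ B, g s ∈ nb k \ A ∧ node q k m s = cc q (lam m (g s).1 (g s).2) := by
    intro s hs
    obtain ⟨j, σ, rfl, hσ, hj, hjk, i, hi, hik, hc⟩ := hBstep s hs
    have hhalf := h.half_le_abs_lam hkn hj hjk
    rw [node_step k m j hσ, mem_sdiff]
    rcases hc with ⟨hc1, hc2⟩ | ⟨hc1, hc2⟩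
    · have hgs : g (j, σ) = (j, k + 1) := by simp only [hg]; rw [if_pos hc2]
      rw [hgs]
      obtain ⟨-, h2, -⟩ := h.interlaces.squeeze hkn hi hj hik hjk hc1
      obtain ⟨-, h3, -⟩ := h'.interlaces.squeeze hkn hi hj hik hjk (by rw [hrow, hrow, hc1])
      refine ⟨⟨mem_nb.2 ⟨hj, Or.inl ⟨by simp; omega, rfl⟩⟩, fun ha => hA _ ha ?_⟩, ?_⟩
      · simp only; rw [h3, h2, hrow]
      · simp only; rw [cc_eq_cc_iff hq hq1, h2, hc2,
          abs_of_nonneg (show 0 ≤ |lam m j k| + 1 / 2 by positivity)]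
    · have hgs : g (j, σ) = (j, k - 1) := by
        simp only [hg]; rw [if_neg (by rw [hc2]; intro h3; linarith)]
      rw [hgs]
      obtain ⟨h1, -, h2⟩ := h.interlaces.squeeze hkn hj hi hjk hik hc1
      obtain ⟨-, -, h3⟩ := h'.interlaces.squeeze hkn hj hi hjk hik (by rw [hrow, hrow, hc1])
      refine ⟨⟨mem_nb.2 ⟨hj, Or.inr ⟨by simp; omega, rfl⟩⟩, fun ha => hA _ ha ?_⟩, ?_⟩
      · simp only; rw [h3, h2, hrow]
      · simp only; rw [cc_eq_cc_iff hq hq1, h2, hc2,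
          abs_of_nonneg (show 0 ≤ |lam m i k| + 1 / 2 by positivity)]; linarith
  have h1 : ∏ s ∈ B, (Polynomial.X - Polynomial.C (node q k m s)) =
      ∏ a ∈ B.image g, (Polynomial.X - Polynomial.C (cc q (lam m a.1 a.2))) := by
    rw [prod_image hginj]
    exact prod_congr rfl fun s hs => by rw [(hgval s hs).2]
  rw [h1]
  refine prod_dvd_prod_of_subset _ _ _ fun a ha => ?_
  obtain ⟨s, hs, rfl⟩ := mem_image.1 ha
  exact (hgval s hs).1

end IsGTTableau

/-- The polynomial whose values at the nodes give the contributions of the paths that move row `k`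
back and forth while a component in `A` moves (or, for `A = ∅`, while the diagonal term of the
adjacent row acts). The factor `X + (q + q⁻¹)`, present if `extra` is true, occurs for even `k` and
nonempty `A`: it equals `cs q (y + 1) * cs q y` at the node `cc q (y + 1 / 2)`. -/
def loopPoly (q : ℝ) (k : ℕ) (A : Finset (ℕ × ℕ)) (m : Pattern) (extra : Bool) : Polynomial ℝ :=
  (∏ a ∈ nb k \ A, (Polynomial.X - Polynomial.C (cc q (lam m a.1 a.2)))) *
    if extra then Polynomial.X + Polynomial.C (cs q 1) else 1

theorem monic_loopPoly (q : ℝ) (k : ℕ) (A : Finset (ℕ × ℕ)) (m : Pattern) (extra : Bool) :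
    (loopPoly q k A m extra).Monic := by
  refine (Polynomial.monic_prod_of_monic _ _ fun i _ => Polynomial.monic_X_sub_C _).mul ?_
  split_ifs
  · exact Polynomial.monic_X_add_C _
  · exact Polynomial.monic_one

theorem natDegree_loopPoly (q : ℝ) (k : ℕ) (A : Finset (ℕ × ℕ)) (m : Pattern) (extra : Bool) :
    (loopPoly q k A m extra).natDegree = #(nb k \ A) + if extra then 1 else 0 := by
  rw [loopPoly, Polynomial.Monic.natDegree_mul, Polynomial.natDegree_finsetProd_X_sub_C_eq_card]
  · congr 1
    split_ifs <;> simp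
  · exact Polynomial.monic_prod_of_monic _ _ fun i _ => Polynomial.monic_X_sub_C _
  · split_ifs
    · exact Polynomial.monic_X_add_C _
    · exact Polynomial.monic_one

theorem eval_loopPoly (q : ℝ) (k : ℕ) (A : Finset (ℕ × ℕ)) (m : Pattern) (extra : Bool) (v : ℝ) :
    (loopPoly q k A m extra).eval v = (-1) ^ #(nb k \ A) *
      (∏ a ∈ nb k \ A, (cc q (lam m a.1 a.2) - v)) * if extra then v + cs q 1 else 1 := by
  rw [loopPoly, Polynomial.eval_mul, Polynomial.eval_prod, ← prod_const, ← prod_mul_distrib]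
  congr 1
  · refine prod_congr rfl fun a _ => ?_
    simp
  · split_ifs <;> simp

end

/-! ### Paths which move a row back and forth -/

section

variable {q : ℝ}

namespace AdjacentRows
variable {n : ℕ} {M : ℕ → ℝ} {k k' : ℕ} {m : Pattern} (hq : 0 < q) (hq1 : q ≠ 1)
  (h : AdjacentRows n M k k' m) (e e' : ℝ)
include hq hq1 h

/-- At a move from `1` to `0` the components of the adjacent row other than row `k'` contribute a
zero factor. -/
theorem prod_nb_eq_zero {j : ℕ} {σ : ℤ} (hσ : σ = 1 ∨ σ = -1) (hj : 1 ≤ j) (hjk : j ≤ k / 2)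
    (hy : σ * lam m j k + 1 = 0) {A : Finset (ℕ × ℕ)} (hA : ∀ a ∈ A, a.2 = k') :
    ∏ a ∈ nb k \ A, (cc q (lam m a.1 a.2) - cc q (σ * lam m j k + 1 / 2)) = 0 := by
  obtain ⟨k'', h1, h2⟩ := h.exists_other (by omega)
  obtain ⟨a, ha, ha2, ha3⟩ := h.gt.exists_nb_of_add_one_eq_zero hσ h.le hj hjk hy h1
  refine prod_eq_zero (i := a) (mem_sdiff.2 ⟨ha, fun hc => h2 (ha2 ▸ hA a hc)⟩) ?_
  rw [sub_eq_zero, cc_eq_cc_iff hq hq1, ha3]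

/-- The paths that move a component back and forth, as terms of a Lagrange interpolation formula. -/
theorem pathSum_opp_step {j l : ℕ} {σ υ : ℤ} (hσ : σ = 1 ∨ σ = -1) (hυ : υ = 1 ∨ υ = -1)
    (hj : 1 ≤ j) (hjk : j ≤ k / 2) (hl : 1 ≤ l) (hlk : l ≤ k' / 2)
    (ht : IsGTTableau n M (move m k' (l, υ))) :
    pathSum q e e' k k' m (l, υ) (j, σ) (j, -σ) = -coef q e' k' m (l, υ) *
      ((loopPoly q k {(l, k')} m (¬ Odd k)).eval (node q k m (j, σ)) /
        ∏ s ∈ (mv k).erase (j, σ), (node q k m (j, σ) - node q k m s)) := by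
  have hkk := h.ne
  have hσ' : -σ = 1 ∨ -σ = -1 := by omega
  have hl' := mem_nb_of_adjacent h.adj hl hlk
  have hj' := mem_nb_of_adjacent h.adj.symm hj hjk
  have hT : ∀ m' : Pattern, (∀ a b, (a, b) ≠ (j, k) → lam m' a b = lam m a b) →
      coef q e' k' m' (l, υ) = rest q e' k' {(j, k)} m (l, υ) *
        nf q (υ * lam m l k') (lam m' j k) := by
    intro m' hm'
    rw [coef_of_row₁ e' hkk (l, υ) hj' hm']
    simp only [fac_of_sign hυ]
  have hy : σ * lam m j k ≠ 0 := by
    have h1 := h.gt.half_le_abs_lam h.le hj hjk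
    have h2 : lam m j k ≠ 0 := by intro h0; rw [h0, abs_zero] at h1; linarith
    rcases hσ with rfl | rfl <;> simpa using h2
  have hz := h.gt.exists_int_sub hσ hυ h.adj (by have := h.le; omega) (by have := h.le'; omega)
    hj hjk hl hlk
  have hz' : ∃ z : ℤ, υ * lam m l k' + σ * lam m j k + 1 / 2 = z := by
    obtain ⟨z, hz⟩ := h.gt.exists_int_sub hσ (τ := -υ) (by omega) h.adj (by have := h.le; omega)
      (by have := h.le'; omega) hj hjk hl hlk
    refine ⟨z + 1, ?_⟩
    push_cast at hz ⊢
    linarith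
  have hx := h.gt.abs_cc_sub_cc_nb hq hq1 hσ h.le hj hjk hl'
  have hx1 := ht.abs_cc_sub_cc_nb hq hq1 hσ h.le hj hjk hl'
  simp only [lam_move_self, lam_move_of_ne_row _ _ _ _ hkk] at hx1
  rw [cc_sign_add hυ] at hx1
  rw [← cc_sign hυ] at hx
  have key := local_loop hq hq1 hz hz' hy hx hx1
  have hr := h.gt.rest_mul_rest_opp hq hq1 e hσ h.le hj hjk (A := {(l, k')})
    (by simpa using hl')
  rw [prod_singleton] at hr
  -- the moves `(j, σ)` and its opposite have the same factors of the adjacent rows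
  have hopp : ∀ a, nf q (((-σ : ℤ) : ℝ) * (lam m j k + σ)) a = nf q (σ * lam m j k) a := by
    intro a
    have e1 : ((-σ : ℤ) : ℝ) * (lam m j k + σ) + 1 / 2 = -(σ * lam m j k + 1 / 2) := by
      rcases hσ with rfl | rfl <;> push_cast <;> ring
    rw [nf, nf, e1, cc_neg]
  have hback : move (move m k (j, σ)) k (j, -σ) = m := move_move_opp m k (j, σ)
  have hE : pathSum q e e' k k' m (l, υ) (j, σ) (j, -σ) =
      coef q e' k' m (l, υ) * (rest q e k {(l, k')} m (j, σ) *
        rest q e k {(l, k')} (move m k (j, σ)) (j, -σ)) *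
        (nbSign j k (l, k') * sn q 1 * sn q (2 * (σ * lam m j k) + 2)) := by
    rw [pathSum, hback, hT m (by simp),
      hT (move m k (j, σ)) (fun a b h1 => lam_move_of_pair_ne _ _ (j, σ) h1)]
    simp only [coef_move_other e hkk _ _ _ hl', coef_eq e _ _ hl', fac_of_sign hσ, fac_of_sign hσ']
    simp only [lam_move_self, lam_move_of_ne_row _ _ _ _ hkk.symm]
    simp only [hopp]
    simp only [nf_sign_add hυ, nf_sign_add hσ]
    simp only [← nf_sign_left hυ _ (lam m l k'), ← nf_sign_left hσ _ (lam m j k)]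
    linear_combination rest q e' k' {(j, k)} m (l, υ) * (rest q e k {(l, k')} m (j, σ) *
        rest q e k {(l, k')} (move m k (j, σ)) (j, -σ)) * key
  have hcard : (-1 : ℝ) ^ #(nb k \ {(l, k')}) = 1 := by
    rw [sdiff_singleton_eq_erase, card_erase_of_mem hl', card_nb]
    exact Even.neg_one_pow ⟨(k - 1) / 2, by omega⟩
  have hsign := nbSign_mul_self j k (l, k')
  rw [hE, hr, eval_loopPoly, hcard, node_step k m j hσ, ← node_step k m j hσ,
    prod_node_sub_step hq k m hσ hj hjk, node_step k m j hσ]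
  set N := ∏ a ∈ nb k \ {(l, k')}, (cc q (lam m a.1 a.2) - cc q (σ * lam m j k + 1 / 2)) with hN
  set D := ∏ i ∈ (Icc 1 (k / 2)).erase j, (cc q (lam m i k) - cc q (lam m j k)) *
        (cc q (lam m i k) - cc q (lam m j k + σ)) with hD
  -- `wt` has a pole at the opposite move if `σ * lam m j k = -1`, but then both sides vanish
  by_cases hy1 : σ * lam m j k + 1 = 0
  · rw [hN, h.prod_nb_eq_zero hq hq1 hσ hj hjk hy1 (by simp)]
    simp
  by_cases hk : Odd k
  · have hw := wt_mul_wt_of_odd hq hq1 hk hy hy1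
    rw [if_pos hk, if_neg (by simpa using hk), div_eq_mul_inv, mul_right_comm _ D, mul_inv]
    linear_combination coef q e' k' m (l, υ) * D⁻¹ * N *
      (nbSign j k (l, k') * nbSign j k (l, k')) * hw - coef q e' k' m (l, υ) * D⁻¹ * N *
        (sn q 1 * sn q (2 * (σ * lam m j k)) * (cc q (σ * lam m j k + 1 / 2) + 2))⁻¹ * hsign
  · have hw := wt_mul_wt_of_even hq hq1 hk hy hy1
    have g1 : sn q (2 * (σ * lam m j k) + 2) = sn q (σ * lam m j k + 1) *
        cs q (σ * lam m j k + 1) := by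
      rw [← sn_two_mul hq]; congr 1; ring
    have g2 : cc q (σ * lam m j k + 1 / 2) + cs q 1 =
        cs q (σ * lam m j k + 1) * cs q (σ * lam m j k) := by
      rw [cs_mul_cs hq, cc]; congr 2 <;> ring
    have g3 := sn_two_mul hq (σ * lam m j k)
    have h1 := sn_one_ne_zero hq hq1
    have h2 : sn q (σ * lam m j k) ≠ 0 := by rwa [Ne, sn_eq_zero_iff hq hq1]
    have h3 := (cs_pos hq (σ * lam m j k)).ne'
    have g4 : (sn q 1 * sn q (σ * lam m j k))⁻¹ * cs q (σ * lam m j k + 1) =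
        (sn q 1 * sn q (2 * (σ * lam m j k)))⁻¹ *
          (cs q (σ * lam m j k + 1) * cs q (σ * lam m j k)) := by
      rw [g3]
      generalize cs q (σ * lam m j k + 1) = c at *
      field_simp
    rw [if_neg hk, if_pos (by simpa using hk), mul_one, div_eq_mul_inv, mul_inv, g1, g2]
    linear_combination coef q e' k' m (l, υ) * D⁻¹ * N * cs q (σ * lam m j k + 1) *
      (nbSign j k (l, k') * nbSign j k (l, k')) * hw - coef q e' k' m (l, υ) * D⁻¹ * N *
        (sn q 1 * sn q (σ * lam m j k))⁻¹ * cs q (σ * lam m j k + 1) * hsign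
      - coef q e' k' m (l, υ) * D⁻¹ * N * g4

theorem pathSum_loop_loop (he : e * e = 1) (hk : Odd k) {l : ℕ} {υ : ℤ} (hυ : υ = 1 ∨ υ = -1)
    (hl : 1 ≤ l) (hlk : l ≤ k' / 2) :
    pathSum q e e' k k' m (l, υ) (0, 0) (0, 0) = -coef q e' k' m (l, υ) *
      ((loopPoly q k {(l, k')} m (¬ Odd k)).eval (node q k m (0, 0)) /
        ∏ s ∈ (mv k).erase (0, 0), (node q k m (0, 0) - node q k m s)) := by
  have hkk := h.ne
  have hl' := mem_nb_of_adjacent h.adj hl hlk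
  have key := local_loop_loop hq (υ * lam m l k')
  have hcard : (-1 : ℝ) ^ #(nb k \ {(l, k')}) = 1 := by
    rw [sdiff_singleton_eq_erase, card_erase_of_mem hl', card_nb]
    exact Even.neg_one_pow ⟨(k - 1) / 2, by omega⟩
  have h1 := sn_one_ne_zero hq hq1
  have hE : pathSum q e e' k k' m (l, υ) (0, 0) (0, 0) =
      -coef q e' k' m (l, υ) * (rest q e k {(l, k')} m (0, 0) * sn q 1) ^ 2 := by
    simp only [pathSum, move_loop]
    simp only [coef_move_other e hkk _ _ _ hl', coef_eq e _ _ hl', fac_zero]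
    simp only [cs_sign_add hυ]
    simp only [← cs_sign hυ (lam m l k')]
    linear_combination coef q e' k' m (l, υ) * rest q e k {(l, k')} m (0, 0) ^ 2 * key
  rw [hE, eval_loopPoly, hcard, prod_node_sub_loop hq k m hk, node_loop, if_neg (by simpa using hk),
    rest, base, if_pos rfl]
  simp only [fac_zero, sub_neg_eq_add, cc_add_two hq]
  rw [prod_pow, prod_pow, one_mul, mul_one, prod_inv_distrib, ← div_pow]
  congr 1
  have he2 : e ^ 2 = 1 := by rw [sq, he]
  calc _ = e ^ 2 * (((sn q 1)⁻¹ * sn q 1) * ((∏ a ∈ nb k \ {(l, k')}, cs q (lam m a.1 a.2)) /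
      ∏ i ∈ Icc 1 (k / 2), (cc q (lam m i k) + cc q (1 / 2)))) ^ 2 := by ring
    _ = _ := by rw [he2, inv_mul_cancel₀ h1, one_mul, one_mul]

theorem pathSum_diag_opp (hk : ¬ Odd k) {j : ℕ} {σ : ℤ} (hσ : σ = 1 ∨ σ = -1)
    (hj : 1 ≤ j) (hjk : j ≤ k / 2) :
    pathSum q e e' k k' m (0, 0) (j, σ) (j, -σ) = -coef q e' k' m (0, 0) *
      ((loopPoly q k ∅ m false).eval (node q k m (j, σ)) /
        ∏ s ∈ (mv k).erase (j, σ), (node q k m (j, σ) - node q k m s)) := by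
  have hkk := h.ne
  have hj' := mem_nb_of_adjacent h.adj.symm hj hjk
  have hT : ∀ m' : Pattern, (∀ a b, (a, b) ≠ (j, k) → lam m' a b = lam m a b) →
      coef q e' k' m' (0, 0) = rest q e' k' {(j, k)} m (0, 0) * cs q (lam m' j k) := by
    intro m' hm'
    rw [coef_of_row₁ e' hkk (0, 0) hj' hm']
    simp only [fac_zero]
  have hy : σ * lam m j k ≠ 0 := by
    have h1 := h.gt.half_le_abs_lam h.le hj hjk
    have h2 : lam m j k ≠ 0 := by intro h0; rw [h0, abs_zero] at h1; linarith
    rcases hσ with rfl | rfl <;> simpa using h2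
  have key := local_loop_diag hq (σ * lam m j k)
  have hr := h.gt.rest_mul_rest_opp hq hq1 e hσ h.le hj hjk (A := ∅) (by simp)
  rw [prod_empty, one_mul] at hr
  have hback : move (move m k (j, σ)) k (j, -σ) = m := move_move_opp m k (j, σ)
  have hE : pathSum q e e' k k' m (0, 0) (j, σ) (j, -σ) =
      rest q e' k' {(j, k)} m (0, 0) * (coef q e k m (j, σ) *
        coef q e k (move m k (j, σ)) (j, -σ)) * (-sn q 1 * sn q (σ * lam m j k + 1)) := by
    simp only [pathSum, move_loop, hback]
    rw [hT m (by simp),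
      hT (move m k (j, σ)) (fun a b h1 => lam_move_of_pair_ne _ _ (j, σ) h1)]
    simp only [lam_move_self, cs_sign_add hσ]
    simp only [← cs_sign hσ (lam m j k)]
    linear_combination rest q e' k' {(j, k)} m (0, 0) * (coef q e k m (j, σ) *
        coef q e k (move m k (j, σ)) (j, -σ)) * key
  have hcard : (-1 : ℝ) ^ #(nb k \ ∅) = -1 := by
    rw [sdiff_empty, card_nb]
    exact Odd.neg_one_pow ⟨(k - 1) / 2, by omega⟩
  have g3 := sn_two_mul hq (σ * lam m j k)
  rw [hE, coef, coef, hr, eval_loopPoly, hcard, prod_node_sub_step hq k m hσ hj hjk,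
    node_step k m j hσ, hT m (by simp), if_neg (by simp), if_neg hk, mul_one, mul_one, g3]
  set N := ∏ a ∈ nb k \ ∅, (cc q (lam m a.1 a.2) - cc q (σ * lam m j k + 1 / 2)) with hN
  set D := ∏ i ∈ (Icc 1 (k / 2)).erase j, (cc q (lam m i k) - cc q (lam m j k)) *
        (cc q (lam m i k) - cc q (lam m j k + σ)) with hD
  -- `wt` has a pole at the opposite move if `σ * lam m j k = -1`, but then both sides vanish
  by_cases hy1 : σ * lam m j k + 1 = 0
  · rw [hN, h.prod_nb_eq_zero hq hq1 hσ hj hjk hy1 (by simp)]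
    simp
  have hw := wt_mul_wt_of_even hq hq1 hk hy hy1
  have h1 := sn_one_ne_zero hq hq1
  have h2 : sn q (σ * lam m j k) ≠ 0 := by rwa [Ne, sn_eq_zero_iff hq hq1]
  have h3 := (cs_pos hq (σ * lam m j k)).ne'
  have g4 : (sn q 1 * sn q (σ * lam m j k))⁻¹ =
      cs q (lam m j k) * (sn q 1 * (sn q (σ * lam m j k) * cs q (σ * lam m j k)))⁻¹ := by
    rw [← cs_sign hσ (lam m j k)]
    field_simp
  rw [div_eq_mul_inv, mul_inv]
  linear_combination -(rest q e' k' {(j, k)} m (0, 0)) * D⁻¹ * N * hw +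
    rest q e' k' {(j, k)} m (0, 0) * D⁻¹ * N * g4

/-- The paths which move row `k` back and forth add up to minus the matrix element of the move of
row `k'`, by an interpolation identity. -/
theorem sum_pathSum_opp (he : e * e = 1) {t : ℕ × ℤ} (ht : t ∈ mv k')
    (hmt : IsGTTableau n M (move m k' t)) :
    ∑ s ∈ mv k, pathSum q e e' k k' m t s (opp s) = -coef q e' k' m t := by
  have hkk := h.ne
  have hadj := h.adj
  obtain ⟨l, υ⟩ := t
  rw [mem_mv] at ht
  simp only [Prod.mk.injEq] at ht
  rcases ht with ⟨hl, hlk, hυ⟩ | ⟨hodd, rfl, rfl⟩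
  · have hl' := mem_nb_of_adjacent h.adj hl hlk
    have hcard : #(nb k \ {(l, k')}) = (k - 1) / 2 * 2 := by
      rw [sdiff_singleton_eq_erase, card_erase_of_mem hl', card_nb]; omega
    have hsum := sum_eval_div_prod_sub (mv k) (node q k m)
      (monic_loopPoly q k {(l, k')} m (¬ Odd k)) (by
        rw [natDegree_loopPoly, hcard, card_mv]
        by_cases hk : Odd k
        · rw [if_neg (by simpa using hk), if_pos hk]; rw [Nat.odd_iff] at hk; omega
        · rw [if_pos (by simpa using hk), if_neg hk]; rw [Nat.odd_iff] at hk; omega)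
      (Dvd.dvd.mul_right (h.gt.prod_X_sub_C_node_dvd hq hq1 h.le hmt
        (fun i => lam_move_of_ne_row _ _ _ _ hkk) (by
          intro a ha
          rw [mem_singleton] at ha
          subst ha
          rw [lam_move_self, Ne, add_eq_left]
          rcases hυ with rfl | rfl <;> simp)) _)
    rw [← mul_one (-coef q e' k' m (l, υ)), ← hsum, mul_sum]
    refine sum_congr rfl fun s hs => ?_
    obtain ⟨j, σ⟩ := s
    rw [mem_mv] at hs
    simp only [Prod.mk.injEq] at hs
    rcases hs with ⟨hj, hjk, hσ⟩ | ⟨hk, rfl, rfl⟩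
    · exact h.pathSum_opp_step hq hq1 e e' hσ hυ hj hjk hl hlk hmt
    · exact h.pathSum_loop_loop hq hq1 e e' he hk hυ hl hlk
  · have hk : ¬ Odd k := by rw [Nat.odd_iff] at *; omega
    have hsum := sum_eval_div_prod_sub (mv k) (node q k m)
      (monic_loopPoly q k ∅ m false) (by
        rw [natDegree_loopPoly, sdiff_empty, card_nb, card_mv, if_neg hk]
        have := h.pos
        rw [Nat.odd_iff] at hk
        simp; omega)
      (Dvd.dvd.mul_right (h.gt.prod_X_sub_C_node_dvd hq hq1 h.le h.gt (fun i => rfl) (by simp)) _)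
    rw [← mul_one (-coef q e' k' m (0, 0)), ← hsum, mul_sum]
    refine sum_congr rfl fun s hs => ?_
    obtain ⟨j, σ⟩ := s
    rw [mem_mv] at hs
    simp only [Prod.mk.injEq] at hs
    rcases hs with ⟨hj, hjk, hσ⟩ | ⟨hk', rfl, rfl⟩
    · exact h.pathSum_diag_opp hq hq1 e e' hk hσ hj hjk
    · exact absurd hk' hk

end AdjacentRows

end

/-! ### Moves which leave the set of tableaux -/

section

variable {q : ℝ}

/-- A component `y` moves towards a component `a` next to it without crossing it. -/
theorem add_half_le_of_abs_ne {a y : ℝ} {σ : ℤ} (hσ : σ = 1 ∨ σ = -1) (hy : 1 / 2 ≤ |y|)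
    (ha : |y| + 1 / 2 ≤ a) (hz : ∃ z : ℤ, a - |y| - 1 / 2 = z) (hne : |a| ≠ |σ * y + 1 / 2|) :
    |y + σ| + 1 / 2 ≤ a := by
  rw [← mul_one (σ : ℝ), ← abs_sign_mul_add hσ]
  have h1 : |(σ : ℝ) * y| = |y| := by rcases hσ with rfl | rfl <;> simp
  rw [← h1] at hy ha hz
  clear h1
  generalize (σ : ℝ) * y = x at *
  rw [abs_of_nonneg (show 0 ≤ a by linarith)] at hne
  rcases le_abs.1 hy with h2 | h2
  · rw [abs_of_nonneg (show 0 ≤ x by linarith)] at *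
    rw [abs_of_nonneg (by linarith)] at *
    obtain ⟨z, hz⟩ := hz
    have h3 : 0 < z := by
      have h4 : (0 : ℝ) < z := by
        rw [← hz]
        exact lt_of_le_of_ne (by linarith) fun h5 => hne (by linarith)
      exact_mod_cast h4
    have h4 : (1 : ℝ) ≤ z := by exact_mod_cast h3
    linarith
  · have h3 : |x + 1| ≤ |x| := by
      rw [abs_of_nonpos (show x ≤ 0 by linarith), abs_le]
      constructor <;> linarith
    linarith

/-- The counterpart of `add_half_le_of_abs_ne` for a component `a` inside of `y`. -/
theorem le_add_of_abs_ne {a y : ℝ} {σ : ℤ} (hσ : σ = 1 ∨ σ = -1)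
    (ha : |a| + 1 / 2 ≤ y) (hz : ∃ z : ℤ, y - |a| - 1 / 2 = z) (hne : |a| ≠ |σ * y + 1 / 2|) :
    |a| + 1 / 2 ≤ y + σ := by
  have h0 := abs_nonneg a
  rcases hσ with rfl | rfl
  · push_cast; linarith
  · push_cast at *
    rw [abs_of_nonpos (show -1 * y + 1 / 2 ≤ 0 by linarith)] at hne
    obtain ⟨z, hz⟩ := hz
    have h3 : 0 < z := by
      have h4 : (0 : ℝ) < z := by
        rw [← hz]
        exact lt_of_le_of_ne (by linarith) fun h5 => hne (by linarith)
      exact_mod_cast h4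
    have h4 : (1 : ℝ) ≤ z := by exact_mod_cast h3
    linarith

namespace IsGTTableau
variable {n : ℕ} {M : ℕ → ℝ} {m : Pattern} (h : IsGTTableau n M m)
include h

theorem exists_int_sub_abs {j l k k' : ℕ}
    (hk : k' = k + 1 ∨ k = k' + 1) (hkn : k ≤ n) (hkn' : k' ≤ n) (hj : 1 ≤ j) (hjk : j ≤ k / 2)
    (hl : 1 ≤ l) (hlk : l ≤ k' / 2) : ∃ z : ℤ, lam m j k - |lam m l k'| - 1 / 2 = z := by
  rcases abs_choice (lam m l k') with h1 | h1
  · obtain ⟨z, hz⟩ := h.exists_int_sub (σ := 1) (τ := 1) (by simp) (by simp) hk hkn hkn' hj hjk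
      hl hlk
    exact ⟨z, by rw [h1, ← hz]; push_cast; ring⟩
  · obtain ⟨z, hz⟩ := h.exists_int_sub (σ := 1) (τ := -1) (by simp) (by simp) hk hkn hkn' hj hjk
      hl hlk
    exact ⟨z, by rw [h1, ← hz]; push_cast; ring⟩

/-- A move which crosses no component of an adjacent row leads to a tableau. -/
theorem move_step {j k : ℕ} {σ : ℤ} (hσ : σ = 1 ∨ σ = -1) (hkn : k + 1 ≤ n) (hj : 1 ≤ j)
    (hjk : j ≤ k / 2)
    (hne : ∀ a ∈ nb k, |lam m a.1 a.2| ≠ |σ * lam m j k + 1 / 2|) :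
    IsGTTableau n M (move m k (j, σ)) := by
  have hI := h.interlaces
  have hy := h.half_le_abs_lam hkn hj hjk
  rw [isGTTableau_iff]
  refine ⟨⟨?_, ?_, ?_⟩, ?_, ?_⟩
  · intro j' k' h1
    rw [move, shift, if_neg (by rintro ⟨rfl, rfl⟩; exact h1 ⟨by omega, by omega, hj, hjk⟩)]
    exact h.supp j' k' h1
  · intro j' k' h1 h2 h3 h4
    obtain ⟨a, ha⟩ := h.half j' k' h1 h2 h3 h4
    rw [move, shift]
    split_ifs
    · exact ⟨a + σ, by rw [ha]; push_cast; ring⟩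
    · exact ⟨a, ha⟩
  · intro j' h1 h2
    rw [move, shift, if_neg (by rintro ⟨_, h3⟩; omega)]
    exact h.top j' h1 h2
  · intro k' j' h1 h2 h3 h4
    have h5 := hI.upper k' j' h1 h2 h3 h4
    by_cases h6 : j' = j ∧ k' = k
    · obtain ⟨rfl, rfl⟩ := h6
      rw [lam_move_self, lam_move_of_ne_row _ _ _ _ (by omega)]
      exact add_half_le_of_abs_ne hσ hy h5 (h.exists_int_sub_abs (by omega) (by omega) (by omega)
        h3 (by omega) h3 h4) (hne (j', k' + 1) (mem_nb.2 ⟨h3, by simp; omega⟩))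
    · by_cases h7 : j' = j ∧ k' + 1 = k
      · obtain ⟨rfl, rfl⟩ := h7
        rw [lam_move_self, lam_move_of_ne_row _ _ _ _ (by omega)]
        exact le_add_of_abs_ne hσ h5 (h.exists_int_sub_abs (by omega) (by omega) (by omega)
          h3 (by omega) h3 h4) (hne (j', k') (mem_nb.2 ⟨h3, by simp; omega⟩))
      · rw [lam_move_of_pair_ne _ _ _ (by simpa using h6),
          lam_move_of_pair_ne _ _ _ (by simpa using h7)]
        exact h5
  · intro k' j' h1 h2 h3 h4
    have h5 := hI.lower k' j' h1 h2 h3 h4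
    by_cases h6 : j' = j ∧ k' = k
    · obtain ⟨rfl, rfl⟩ := h6
      rw [lam_move_self, lam_move_of_ne_row _ _ _ _ (by omega)]
      exact le_add_of_abs_ne hσ h5 (h.exists_int_sub_abs (by omega) (by omega) (by omega)
        h3 (by omega) (by omega) h4) (hne (j' + 1, k' + 1) (mem_nb.2 ⟨by simp, by simp; omega⟩))
    · by_cases h7 : j' + 1 = j ∧ k' + 1 = k
      · obtain ⟨rfl, rfl⟩ := h7
        rw [lam_move_self, lam_move_of_ne_row _ _ _ _ (by omega)]
        exact add_half_le_of_abs_ne hσ hy h5 (h.exists_int_sub_abs (by omega) (by omega) (by omega)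
          h3 (by omega) (by omega) h4) (hne (j', k') (mem_nb.2 ⟨h3, by simp; omega⟩))
      · rw [lam_move_of_pair_ne _ _ _ (by simpa using h7),
          lam_move_of_pair_ne _ _ _ (by simpa using h6)]
        exact h5

/-- The matrix elements of the moves which leave the set of tableaux vanish. -/
theorem coef_eq_zero (e : ℝ) {k : ℕ} {s : ℕ × ℤ} (hkn : k + 1 ≤ n) (hs : s ∈ mv k)
    (hm : ¬ IsGTTableau n M (move m k s)) : coef q e k m s = 0 := by
  obtain ⟨j, σ⟩ := s
  rw [mem_mv] at hs
  rcases hs with ⟨hj, hjk, hσ⟩ | ⟨_, h1⟩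
  · simp only at hj hjk hσ
    have h1 := mt (h.move_step hσ hkn hj hjk) hm
    push Not at h1
    obtain ⟨a, ha, h2⟩ := h1
    rw [coef_eq e m _ ha]
    simp only
    rw [fac_of_sign hσ, nf_eq_zero h2, mul_zero]
  · rw [h1, move_loop] at hm
    exact absurd h hm

end IsGTTableau

end

/-! ### Comparison with the matrix elements of the representations -/

section

variable {q : ℝ}

theorem qnum_eq (q a : ℝ) : qnum q a = sn q a * (sn q 1)⁻¹ := by
  rw [qnum, sn_one, sn, div_eq_mul_inv]

theorem qnumPlus_eq (q a : ℝ) : qnumPlus q a = cs q a * (sn q 1)⁻¹ := by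
  rw [qnumPlus, sn_one, cs, div_eq_mul_inv]

theorem lcoord_even (m : Pattern) (j p : ℕ) : lcoord m j (2 * p) = lam m j (2 * p) := by
  rw [lcoord, lam, if_neg (by simp), Nat.mul_div_cancel_left _ two_pos]
  push_cast; ring

theorem lcoord_odd (m : Pattern) (j p : ℕ) :
    lcoord m j (2 * p + 1) = lam m j (2 * p + 1) + 1 / 2 := by
  rw [lcoord, lam, if_pos (by simp), show (2 * p + 1) / 2 = p by omega]
  push_cast; ring

theorem coeffA_eq (hq : 0 < q) (hq1 : q ≠ 1) {p j : ℕ} (hj : 1 ≤ j) (hjp : j ≤ p) (m : Pattern) :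
    coeffA q p j m = |sn q 1|⁻¹ *
      √((∏ a ∈ nb (2 * p), (cc q (lam m a.1 a.2) - cc q (lam m j (2 * p) + 1 / 2))) /
        ∏ i ∈ (Icc 1 p).erase j, (cc q (lam m i (2 * p)) - cc q (lam m j (2 * p))) *
          (cc q (lam m i (2 * p)) - cc q (lam m j (2 * p) + 1))) := by
  have hκ := sn_one_ne_zero hq hq1
  obtain ⟨r, rfl⟩ : ∃ r, p = r + 1 := ⟨p - 1, by omega⟩
  have e1 : ∀ a y : ℝ, qnum q (a + 1 / 2 + y) * qnum q (a + 1 / 2 - y - 1) =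
      (cc q a - cc q (y + 1 / 2)) * (sn q 1 ^ 2)⁻¹ := fun a y => by
    rw [qnum_eq, qnum_eq, cc_sub_cc hq, show a + 1 / 2 + y = a + (y + 1 / 2) by ring,
      show a + 1 / 2 - y - 1 = a - (y + 1 / 2) by ring]
    field_simp
  have e2 : ∀ a y : ℝ, qnum q (a + y) * qnum q (a - y) * qnum q (a + y + 1) *
      qnum q (a - y - 1) = (cc q a - cc q y) * (cc q a - cc q (y + 1)) * (sn q 1 ^ 4)⁻¹ :=
    fun a y => by
      rw [qnum_eq, qnum_eq, qnum_eq, qnum_eq, cc_sub_cc hq, cc_sub_cc hq,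
        ← add_assoc, ← sub_sub]
      field_simp
  have hc : #((Icc 1 (r + 1)).erase j) = r := by
    rw [card_erase_of_mem (by simp; omega)]; simp
  have key : ∀ X Y Z : ℝ, X * (sn q 1 ^ 2)⁻¹ ^ (r + 1) * (Y * (sn q 1 ^ 2)⁻¹ ^ r) /
      (Z * (sn q 1 ^ 4)⁻¹ ^ r) = (sn q 1 ^ 2)⁻¹ * (X * Y / Z) := fun X Y Z => by
    rw [← mul_div_assoc, ← mul_div_mul_right _ Z (pow_ne_zero r (inv_ne_zero (pow_ne_zero 4 hκ)))]
    ring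
  rw [coeffA, ← Real.sqrt_sq_eq_abs, ← Real.sqrt_inv, ← Real.sqrt_mul (by positivity), prod_nb]
  simp only [show 2 * (r + 1) - 1 = 2 * r + 1 by omega, show (2 * r + 1) / 2 = r by omega,
    show (2 * (r + 1) + 1) / 2 = r + 1 by omega, Nat.add_sub_cancel, lcoord_even, lcoord_odd,
    e1, e2]
  rw [prod_mul_distrib, prod_mul_distrib, prod_mul_distrib (f := fun i => _ * _)]
  simp only [prod_const, hc, Nat.card_Icc, Nat.add_sub_cancel]
  exact congrArg _ (key _ _ _)

theorem coeffB_eq (hq : 0 < q) (hq1 : q ≠ 1) {p j : ℕ} (hj : 1 ≤ j) (hjp : j ≤ p) (m : Pattern) :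
    coeffB q (p + 1) j m = (|sn q 1| * sn q 1 ^ 2)⁻¹ *
      √((∏ a ∈ nb (2 * p + 1), (cc q (lam m a.1 a.2) - cc q (lam m j (2 * p + 1) + 1 / 2))) /
        ∏ i ∈ (Icc 1 p).erase j, (cc q (lam m i (2 * p + 1)) - cc q (lam m j (2 * p + 1))) *
          (cc q (lam m i (2 * p + 1)) - cc q (lam m j (2 * p + 1) + 1))) := by
  have hκ := sn_one_ne_zero hq hq1
  obtain ⟨r, rfl⟩ : ∃ r, p = r + 1 := ⟨p - 1, by omega⟩
  have e1 : ∀ a y : ℝ, qnum q (a + (y + 1 / 2)) * qnum q (a - (y + 1 / 2)) =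
      (cc q a - cc q (y + 1 / 2)) * (sn q 1 ^ 2)⁻¹ := fun a y => by
    rw [qnum_eq, qnum_eq, cc_sub_cc hq]
    field_simp
  have e2 : ∀ a y : ℝ, qnum q (a + 1 / 2 + (y + 1 / 2)) * qnum q (a + 1 / 2 - (y + 1 / 2)) *
      qnum q (a + 1 / 2 + (y + 1 / 2) - 1) * qnum q (a + 1 / 2 - (y + 1 / 2) - 1) =
      (cc q a - cc q y) * (cc q a - cc q (y + 1)) * (sn q 1 ^ 4)⁻¹ :=
    fun a y => by
      rw [qnum_eq, qnum_eq, qnum_eq, qnum_eq, cc_sub_cc hq, cc_sub_cc hq,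
        show a + 1 / 2 + (y + 1 / 2) = a + (y + 1) by ring,
        show a + 1 / 2 - (y + 1 / 2) = a - y by ring,
        show a + (y + 1) - 1 = a + y by ring, ← sub_sub]
      field_simp
  have hc : #((Icc 1 (r + 1)).erase j) = r := by
    rw [card_erase_of_mem (by simp; omega)]; simp
  have key : ∀ X Y Z : ℝ, X * (sn q 1 ^ 2)⁻¹ ^ (r + 1 + 1) * (Y * (sn q 1 ^ 2)⁻¹ ^ (r + 1)) /
      (Z * (sn q 1 ^ 4)⁻¹ ^ r) = (sn q 1 ^ 6)⁻¹ * (X * Y / Z) := fun X Y Z => by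
    rw [← mul_div_assoc, ← mul_div_mul_right _ Z (pow_ne_zero r (inv_ne_zero (pow_ne_zero 4 hκ)))]
    ring
  have hs : |sn q 1| * sn q 1 ^ 2 = √(sn q 1 ^ 6) := by
    rw [show sn q 1 ^ 6 = (|sn q 1| * sn q 1 ^ 2) ^ 2 by rw [mul_pow, sq_abs]; ring,
      Real.sqrt_sq (by positivity)]
  rw [coeffB, hs, ← Real.sqrt_inv, ← Real.sqrt_mul (by positivity), prod_nb]
  simp only [show 2 * (r + 1 + 1) - 1 = 2 * (r + 1) + 1 by omega,
    show 2 * (r + 1 + 1) - 2 = 2 * (r + 1) by omega,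
    show (2 * (r + 1 + 1)) / 2 = r + 1 + 1 by omega, Nat.add_sub_cancel, lcoord_even,
    lcoord_odd, show 2 * (r + 1) / 2 = r + 1 by omega,
    show 2 * (r + 1) + 1 + 1 = 2 * (r + 1 + 1) by ring, e2]
  simp only [e1]
  rw [prod_mul_distrib, prod_mul_distrib, prod_mul_distrib (f := fun i => _ * _)]
  simp only [prod_const, hc, Nat.card_Icc, Nat.add_sub_cancel]
  exact congrArg _ (key _ _ _)

theorem coeffC_eq (hq : 0 < q) (hq1 : q ≠ 1) (e : ℝ) (p : ℕ) (m : Pattern) :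
    e * coeffC q (p + 1) m = coef q e (2 * p + 1) m (0, 0) := by
  have hκ := sn_one_ne_zero hq hq1
  have e1 : ∀ a : ℝ, qnumPlus q (a + 1 / 2) * qnumPlus q (a + 1 / 2 - 1) =
      (cc q a + cc q (1 / 2)) * (sn q 1 ^ 2)⁻¹ := fun a => by
    rw [qnumPlus_eq, qnumPlus_eq, cc_add_cc hq, show a + 1 / 2 - 1 = a - 1 / 2 by ring]
    field_simp
  have key : ∀ X Y Z : ℝ, e * (X * (sn q 1)⁻¹ ^ (p + 1) * (Y * (sn q 1)⁻¹ ^ p) /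
      (Z * (sn q 1 ^ 2)⁻¹ ^ p)) = e * (sn q 1)⁻¹ * Z⁻¹ * (X * Y) := fun X Y Z => by
    have h1 : (sn q 1)⁻¹ ^ (p + 1) * (sn q 1)⁻¹ ^ p = (sn q 1)⁻¹ * (sn q 1 ^ 2)⁻¹ ^ p := by ring
    rw [mul_mul_mul_comm, h1, ← mul_assoc,
      mul_div_mul_right _ Z (pow_ne_zero p (inv_ne_zero (pow_ne_zero 2 hκ)))]
    ring
  rw [coeffC, coef, rest, base, if_pos rfl, sdiff_empty, prod_nb]
  simp only [show 2 * (p + 1) - 1 = 2 * p + 1 by omega,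
    show 2 * (p + 1) - 2 = 2 * p by omega, show (2 * p + 1) / 2 = p by omega,
    Nat.add_sub_cancel, lcoord_even, lcoord_odd, show 2 * p + 1 + 1 = 2 * (p + 1) by ring,
    Nat.mul_div_cancel_left _ two_pos, e1, fac_zero, prod_inv_distrib]
  simp only [qnumPlus_eq, prod_mul_distrib, prod_const, Nat.card_Icc, Nat.add_sub_cancel]
  exact key _ _ _

namespace IsGTTableau
variable {n : ℕ} {M : ℕ → ℝ} {m : Pattern} (h : IsGTTableau n M m)
include h

/-- On tableaux the radicand is nonnegative as a whole, so that its square root may be taken factor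
by factor. -/
theorem coef_step_eq (hq : 0 < q) (hq1 : q ≠ 1) (e : ℝ) {j k : ℕ} {σ : ℤ}
    (hσ : σ = 1 ∨ σ = -1) (hkn : k + 1 ≤ n) (hj : 1 ≤ j) (hjk : j ≤ k / 2) :
    coef q e k m (j, σ) = wt q k (σ * lam m j k) *
      √((∏ a ∈ nb k, (cc q (lam m a.1 a.2) - cc q (σ * lam m j k + 1 / 2))) /
        ∏ i ∈ (Icc 1 (k / 2)).erase j, (cc q (lam m i k) - cc q (lam m j k)) *
          (cc q (lam m i k) - cc q (lam m j k + σ))) := by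
  have h1 : ∏ a ∈ nb k, (cc q (lam m a.1 a.2) - cc q (σ * lam m j k + 1 / 2)) =
      (∏ a ∈ nb k, nf q (σ * lam m j k) (lam m a.1 a.2)) ^ 2 := by
    refine (one_mul _).symm.trans ?_
    rw [← prod_nbSign (k := k) hj (by omega), ← prod_mul_distrib, ← prod_pow]
    refine prod_congr rfl fun a ha => ?_
    rw [prod_nbSign (k := k) hj (by omega), sq, nf_mul_self,
      h.abs_cc_sub_cc_nb hq hq1 hσ hkn hj hjk ha]
  have h2 : ∏ i ∈ (Icc 1 (k / 2)).erase j, (cc q (lam m i k) - cc q (lam m j k)) *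
      (cc q (lam m i k) - cc q (lam m j k + σ)) =
      (∏ i ∈ (Icc 1 (k / 2)).erase j, √(|cc q (lam m i k) - cc q (lam m j k)| *
        |cc q (lam m i k) - cc q (lam m j k + σ)|)) ^ 2 := by
    rw [← prod_pow]
    refine prod_congr rfl fun i hi => ?_
    obtain ⟨hij, hi⟩ := mem_erase.1 hi
    obtain ⟨hi, hik⟩ := mem_Icc.1 hi
    rw [Real.sq_sqrt (by positivity), ← abs_mul,
      abs_of_nonneg (h.cc_sub_mul_cc_sub_nonneg hq hq1 hσ hkn hi hik hj hjk hij)]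
  have h3 : ∀ a, 0 ≤ nf q (σ * lam m j k) a := fun a => Real.sqrt_nonneg _
  rw [h1, h2, ← div_pow, Real.sqrt_sq (div_nonneg (prod_nonneg fun a _ => h3 _)
    (prod_nonneg fun a _ => Real.sqrt_nonneg _)), coef, rest, base,
    if_neg (show σ ≠ 0 by omega), sdiff_empty, prod_inv_distrib]
  simp only [fac_of_sign hσ]
  ring

theorem oddUp_eq (hq : 0 < q) (hq1 : q ≠ 1) (e : ℝ) {j p : ℕ} (hpn : 2 * p + 1 ≤ n)
    (hj : 1 ≤ j) (hjp : j ≤ p) : oddUp q p j m = coef q e (2 * p) m (j, 1) := by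
  rw [h.coef_step_eq hq hq1 e (by simp) hpn hj (by omega), oddUp, coeffA_eq hq hq1 hj hjp,
    lcoord_even, wt, if_neg (by simp), Nat.mul_div_cancel_left _ two_pos, Int.cast_one, one_mul]
  change _ / sn q _ = _
  field_simp

theorem oddDown_eq (hq : 0 < q) (hq1 : q ≠ 1) (e : ℝ) {j p : ℕ} (hpn : 2 * p + 1 ≤ n)
    (hj : 1 ≤ j) (hjp : j ≤ p) : oddDown q p j m = -coef q e (2 * p) m (j, -1) := by
  rw [h.coef_step_eq hq hq1 e (by simp) hpn hj (by omega), oddDown, coeffA_eq hq hq1 hj hjp,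
    lcoord_even, wt, if_neg (by simp), Nat.mul_div_cancel_left _ two_pos, lam_shift_self]
  push_cast
  rw [neg_one_mul, sn_neg, sub_eq_add_neg]
  change _ / sn q _ = _
  have e1 : ∀ a ∈ nb (2 * p), cc q (lam (shift m j (2 * p) (-1)) a.1 a.2) -
      cc q (lam m j (2 * p) + -1 + 1 / 2) =
      cc q (lam m a.1 a.2) - cc q (-lam m j (2 * p) + 1 / 2) := fun a ha => by
    rw [lam_shift_of_ne_row _ _ _ _ _ (by have := mem_nb.1 ha; omega), ← cc_neg q (_ + _)]
    congr 2; ring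
  have e2 : ∀ i ∈ (Icc 1 p).erase j, (cc q (lam (shift m j (2 * p) (-1)) i (2 * p)) -
      cc q (lam m j (2 * p) + -1)) * (cc q (lam (shift m j (2 * p) (-1)) i (2 * p)) -
      cc q (lam m j (2 * p) + -1 + 1)) = (cc q (lam m i (2 * p)) - cc q (lam m j (2 * p))) *
      (cc q (lam m i (2 * p)) - cc q (lam m j (2 * p) + -1)) := fun i hi => by
    rw [lam_shift_of_ne _ _ _ _ (ne_of_mem_erase hi), mul_comm, neg_add_cancel_right]
  rw [prod_congr rfl e1, prod_congr rfl e2]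
  field_simp

theorem evenUp_eq (hq : 0 < q) (hq1 : q ≠ 1) (e : ℝ) {j p : ℕ} (hpn : 2 * p + 1 + 1 ≤ n)
    (hj : 1 ≤ j) (hjp : j ≤ p) : evenUp q (p + 1) j m = coef q e (2 * p + 1) m (j, 1) := by
  have hκ := sn_one_ne_zero hq hq1
  rw [h.coef_step_eq hq hq1 e (by simp) hpn hj (by omega), evenUp, coeffB_eq hq hq1 hj hjp,
    show 2 * (p + 1) - 1 = 2 * p + 1 by omega,
    lcoord_odd, wt, if_pos (by simp), show (2 * p + 1) / 2 = p by omega, Int.cast_one, one_mul,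
    qnum_eq, qnumPlus_eq, show 2 * (lam m j (2 * p + 1) + 1 / 2) - 1 = 2 * lam m j (2 * p + 1) by
      ring]
  field_simp

theorem evenDown_eq (hq : 0 < q) (hq1 : q ≠ 1) (e : ℝ) {j p : ℕ} (hpn : 2 * p + 1 + 1 ≤ n)
    (hj : 1 ≤ j) (hjp : j ≤ p) : evenDown q (p + 1) j m = -coef q e (2 * p + 1) m (j, -1) := by
  have hκ := sn_one_ne_zero hq hq1
  rw [h.coef_step_eq hq hq1 e (by simp) hpn hj (by omega), evenDown, coeffB_eq hq hq1 hj hjp,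
    show 2 * (p + 1) - 1 = 2 * p + 1 by omega,
    lcoord_odd, wt, if_pos (by simp), show (2 * p + 1) / 2 = p by omega, lam_shift_self,
    qnum_eq, qnumPlus_eq, show 2 * (lam m j (2 * p + 1) + 1 / 2) - 1 = 2 * lam m j (2 * p + 1) by
      ring]
  push_cast
  rw [neg_one_mul, mul_neg, sn_neg, sub_eq_add_neg (lam m j (2 * p + 1) + 1 / 2),
    ← cs_neg q (-lam m j (2 * p + 1) + 1 / 2)]
  have e1 : ∀ a ∈ nb (2 * p + 1), cc q (lam (shift m j (2 * p + 1) (-1)) a.1 a.2) -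
      cc q (lam m j (2 * p + 1) + -1 + 1 / 2) =
      cc q (lam m a.1 a.2) - cc q (-lam m j (2 * p + 1) + 1 / 2) := fun a ha => by
    rw [lam_shift_of_ne_row _ _ _ _ _ (by have := mem_nb.1 ha; omega),
      ← cc_neg q (lam m j (2 * p + 1) + -1 + 1 / 2)]
    congr 2; ring
  have e2 : ∀ i ∈ (Icc 1 p).erase j, (cc q (lam (shift m j (2 * p + 1) (-1)) i (2 * p + 1)) -
      cc q (lam m j (2 * p + 1) + -1)) * (cc q (lam (shift m j (2 * p + 1) (-1)) i (2 * p + 1)) -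
      cc q (lam m j (2 * p + 1) + -1 + 1)) =
      (cc q (lam m i (2 * p + 1)) - cc q (lam m j (2 * p + 1))) *
      (cc q (lam m i (2 * p + 1)) - cc q (lam m j (2 * p + 1) + -1)) := fun i hi => by
    rw [lam_shift_of_ne _ _ _ _ (ne_of_mem_erase hi), mul_comm, neg_add_cancel_right]
  rw [prod_congr rfl e1, prod_congr rfl e2,
    show -(-lam m j (2 * p + 1) + 1 / 2) = lam m j (2 * p + 1) + 1 / 2 + -1 by ring]
  field_simp

end IsGTTableau

end

/-! ### The relations for the classical type operators -/

section

variable {q : ℝ}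

/-- By the universal properties of the free algebra and of its quotient. -/
theorem SatisfiesRelations.definesRepresentation {V : Type*} [AddCommGroup V] [Module ℂ V] {n : ℕ}
    {T : ℕ → Module.End ℂ V} (h : SatisfiesRelations q n T) : DefinesRepresentation q n T := by
  have hrel : ∀ ⦃x y⦄, Rel q n x y →
      FreeAlgebra.lift ℂ (fun i : GenIndex n => T i.1) x =
        FreeAlgebra.lift ℂ (fun i : GenIndex n => T i.1) y := by
    intro x y hxy
    have hT : ∀ a : GenIndex n, FreeAlgebra.lift ℂ (fun i : GenIndex n => T i.1) (freeGen a) =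
        T a.1 := fun a => FreeAlgebra.lift_ι_apply _ _
    induction hxy with
    | rel₁ a b hab =>
      have := h.rel₁ a.1 (by have := b.2.1; omega) a.2.2
      simp only [map_add, map_sub, map_mul, map_pow, map_smul, map_neg, hT]
      rwa [hab, Nat.add_sub_cancel, ← hab] at this
    | rel₂ a b hab =>
      have := h.rel₂ a.1 (by have := b.2.1; omega) a.2.2
      simp only [map_add, map_sub, map_mul, map_pow, map_smul, map_neg, hT]
      rwa [hab, Nat.add_sub_cancel, ← hab] at this
    | rel₃ a b hab =>
      have := h.rel₃ a.1 b.1 a.2.1 a.2.2 b.2.1 b.2.2 hab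
      simpa only [map_sub, map_mul, map_zero, hT] using this
  refine ⟨RingQuot.liftAlgHom ℂ ⟨FreeAlgebra.lift ℂ fun i : GenIndex n => T i.1, hrel⟩, ?_, ?_⟩
  · intro i
    simp only [Uq.gen, RingQuot.liftAlgHom_mkAlgHom_apply]
    exact FreeAlgebra.lift_ι_apply _ _
  · intro ρ hρ
    refine RingQuot.ringQuot_ext' _ _ _ (FreeAlgebra.hom_ext (funext fun i => ?_))
    simp only [Function.comp_apply, AlgHom.comp_apply]
    refine (hρ i).trans ?_
    change _ = RingQuot.liftAlgHom ℂ
      ⟨FreeAlgebra.lift ℂ fun i : GenIndex n => T i.1, hrel⟩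
      (RingQuot.mkAlgHom ℂ (Rel q n) (freeGen i))
    rw [RingQuot.liftAlgHom_mkAlgHom_apply]
    exact (FreeAlgebra.lift_ι_apply (R := ℂ) (fun i : GenIndex n => T i.1) i).symm

theorem ket_of_pos {P : Pattern → Prop} {m : Pattern} (h : P m) :
    ket P m = Finsupp.single ⟨m, h⟩ 1 := dif_pos h

theorem ket_of_neg {P : Pattern → Prop} {m : Pattern} (h : ¬ P m) : ket P m = 0 := dif_neg h

theorem ext_ket {P : Pattern → Prop} {V : Type*} [AddCommGroup V] [Module ℂ V]
    {f g : ({m : Pattern // P m} →₀ ℂ) →ₗ[ℂ] V}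
    (h : ∀ m, P m → f (ket P m) = g (ket P m)) : f = g := by
  refine Finsupp.lhom_ext fun a b => ?_
  rw [← Finsupp.smul_single_one, map_smul, map_smul]
  congr 1
  have := h a.1 a.2
  rwa [ket_of_pos a.2] at this

theorem linearCombination_ket {P : Pattern → Prop} {V : Type*} [AddCommGroup V] [Module ℂ V]
    (F : Pattern → V) {m : Pattern} (h : P m) :
    Finsupp.linearCombination ℂ (fun ξ : {m : Pattern // P m} => F ξ.1) (ket P m) = F m := by
  rw [ket_of_pos h, Finsupp.linearCombination_single, one_smul]

theorem sgn_mul_ofReal (e : ℤˣ) (x : ℝ) : sgn e * (x : ℂ) = (((e : ℤ) : ℝ) * x : ℝ) := by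
  simp [sgn]

theorem coef_move_of_far (e : ℝ) {k k' : ℕ} (h : k + 1 < k' ∨ k' + 1 < k) (m : Pattern)
    (s t : ℕ × ℤ) : coef q e k (move m k' t) s = coef q e k m s :=
  rest_congr e (fun i => lam_move_of_ne_row _ _ _ _ (by omega))
    (fun a ha _ => lam_move_of_ne_row _ _ _ _ (by have := mem_nb.1 ha; omega)) s

section
variable {n : ℕ} {M : ℕ → ℝ} (hq : 0 < q) (hq1 : q ≠ 1) (ε : ℕ → ℤˣ)
include hq hq1

/-- The operators `T'` in terms of the moves. -/
theorem opT'_ket {m : Pattern} (h : IsGTTableau n M m) {k : ℕ} (hk : 1 ≤ k) (hkn : k + 1 ≤ n) :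
    opT' q n ε M (k + 1) (ket (IsGTTableau n M) m) =
      ∑ s ∈ mv k, (coef q ((ε (k + 1) : ℤ) : ℝ) k m s : ℂ) •
        ket (IsGTTableau n M) (move m k s) := by
  rw [opT', linearCombination_ket (fun m => if Odd (k + 1) then
    oddAction' q (IsGTTableau n M) ((k + 1) / 2) m
    else evenAction q ε (IsGTTableau n M) ((k + 1) / 2) m) h, sum_mv]
  rcases Nat.even_or_odd' k with ⟨p, rfl | rfl⟩
  · rw [if_pos (by simp), if_neg (by simp), add_zero, show (2 * p + 1) / 2 = p by omega,
      Nat.mul_div_cancel_left _ two_pos, oddAction', sum_add_distrib, sub_eq_add_neg,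
      ← sum_neg_distrib]
    congr 1 <;> refine sum_congr rfl fun j hj => ?_ <;> rw [mem_Icc] at hj
    · rw [h.oddUp_eq hq hq1 (((ε (2 * p + 1) : ℤ) : ℝ)) hkn hj.1 hj.2]
      simp [move]
    · rw [h.oddDown_eq hq hq1 (((ε (2 * p + 1) : ℤ) : ℝ)) hkn hj.1 hj.2]
      simp [move]
  · rw [if_neg (by simp [Nat.not_odd_iff_even, Nat.even_add_one]), if_pos (by simp),
      show 2 * p + 1 + 1 = 2 * (p + 1) by ring, Nat.mul_div_cancel_left _ two_pos,
      show (2 * p + 1) / 2 = p by omega, evenAction, sum_add_distrib, sub_eq_add_neg,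
      ← sum_neg_distrib, sgn_mul_ofReal, coeffC_eq hq hq1, move_loop, Nat.add_sub_cancel,
      show 2 * (p + 1) - 1 = 2 * p + 1 by omega]
    congr 2 <;> refine sum_congr rfl fun j hj => ?_ <;> rw [mem_Icc] at hj
    · rw [h.evenUp_eq hq hq1 (((ε (2 * (p + 1)) : ℤ) : ℝ)) (by omega) hj.1 hj.2]
      simp [move]
    · rw [h.evenDown_eq hq hq1 (((ε (2 * (p + 1)) : ℤ) : ℝ)) (by omega) hj.1 hj.2]
      simp [move]

/-- The intermediate arrays which are not tableaux need not be excluded, as the matrix elements that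
lead to them vanish. -/
theorem opT'_opT'_ket {m : Pattern} (h : IsGTTableau n M m) {a b : ℕ} (ha : 1 ≤ a)
    (han : a + 1 ≤ n) (hb : 1 ≤ b) (hbn : b + 1 ≤ n) :
    opT' q n ε M (b + 1) (opT' q n ε M (a + 1) (ket (IsGTTableau n M) m)) =
      ∑ x ∈ mv a, ∑ y ∈ mv b, (coef q ((ε (a + 1) : ℤ) : ℝ) a m x *
        coef q ((ε (b + 1) : ℤ) : ℝ) b (move m a x) y : ℂ) •
        ket (IsGTTableau n M) (move (move m a x) b y) := by
  rw [opT'_ket hq hq1 ε h ha han, map_sum]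
  refine sum_congr rfl fun x hx => ?_
  rw [map_smul]
  by_cases hm : IsGTTableau n M (move m a x)
  · rw [opT'_ket hq hq1 ε hm hb hbn, smul_sum]
    exact sum_congr rfl fun y _ => smul_smul _ _ _
  · rw [h.coef_eq_zero _ han hx hm]; simp

theorem opT'_opT'_opT'_ket {m : Pattern} (h : IsGTTableau n M m) {a b c : ℕ} (ha : 1 ≤ a)
    (han : a + 1 ≤ n) (hb : 1 ≤ b) (hbn : b + 1 ≤ n) (hc : 1 ≤ c) (hcn : c + 1 ≤ n) :
    opT' q n ε M (c + 1) (opT' q n ε M (b + 1) (opT' q n ε M (a + 1)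
      (ket (IsGTTableau n M) m))) =
      ∑ x ∈ mv a, ∑ y ∈ mv b, ∑ z ∈ mv c, (coef q ((ε (a + 1) : ℤ) : ℝ) a m x *
        coef q ((ε (b + 1) : ℤ) : ℝ) b (move m a x) y *
        coef q ((ε (c + 1) : ℤ) : ℝ) c (move (move m a x) b y) z : ℂ) •
        ket (IsGTTableau n M) (move (move (move m a x) b y) c z) := by
  rw [opT'_ket hq hq1 ε h ha han, map_sum, map_sum]
  refine sum_congr rfl fun x hx => ?_
  rw [map_smul, map_smul]
  by_cases hm : IsGTTableau n M (move m a x)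
  · rw [opT'_opT'_ket hq hq1 ε hm hb hbn hc hcn, smul_sum]
    simp_rw [smul_sum, smul_smul, mul_assoc]
  · rw [h.coef_eq_zero _ han hx hm]; simp

/-- The contribution of a move `t` of row `k'`: the paths whose two moves of row `k` are not opposite
cancel in pairs, and the others return row `k` to its original state. -/
theorem sum_sum_pathSum_smul_ket {m : Pattern} {k k' : ℕ} (h : AdjacentRows n M k k' m)
    {e : ℝ} (e' : ℝ) (he : e * e = 1) {t : ℕ × ℤ} (ht : t ∈ mv k') :
    ∑ s₁ ∈ mv k, ∑ s₂ ∈ mv k, (pathSum q e e' k k' m t s₁ s₂ : ℂ) •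
      ket (IsGTTableau n M) (move (move (move m k s₁) k s₂) k' t) =
    -((coef q e' k' m t : ℂ) • ket (IsGTTableau n M) (move m k' t)) := by
  set F : ℕ × ℤ → ℕ × ℤ → GTSpace n M := fun s₁ s₂ => (pathSum q e e' k k' m t s₁ s₂ : ℂ) •
      ket (IsGTTableau n M) (move (move (move m k s₁) k s₂) k' t) with hF
  set G : ℕ × ℤ → ℕ × ℤ → GTSpace n M := fun s₁ s₂ => if s₂ = opp s₁ then 0 else F s₁ s₂ with hG
  have h1 : ∀ s₁ ∈ mv k, ∑ s₂ ∈ mv k, F s₁ s₂ = F s₁ (opp s₁) + ∑ s₂ ∈ mv k, G s₁ s₂ := by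
    intro s₁ hs₁
    rw [← add_sum_erase _ _ (opp_mem_mv hs₁), ← add_sum_erase _ (G s₁) (opp_mem_mv hs₁)]
    simp only [hG, if_true, zero_add]
    congr 1
    exact sum_congr rfl fun s₂ hs₂ => (if_neg (ne_of_mem_erase hs₂)).symm
  have h2 : ∀ s₁ ∈ mv k, ∀ s₂ ∈ mv k, G s₁ s₂ + G s₂ s₁ = 0 := by
    intro s₁ hs₁ s₂ hs₂
    have h3 : s₂ = opp s₁ ↔ s₁ = opp s₂ := by
      constructor <;> rintro rfl <;> rw [opp_opp]
    by_cases h4 : s₂ = opp s₁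
    · simp only [hG]; rw [if_pos h4, if_pos (h3.1 h4), add_zero]
    · simp only [hG]; rw [if_neg h4, if_neg (fun h5 => h4 (h3.2 h5))]
      simp only [hF]
      rw [move_comm m k s₂ k s₁, ← add_smul, ← Complex.ofReal_add,
        h.pathSum_add_pathSum hq hq1 e e' hs₁ hs₂ ht h4, Complex.ofReal_zero, zero_smul]
  have h5 : ∑ s₁ ∈ mv k, ∑ s₂ ∈ mv k, G s₁ s₂ = 0 := by
    have h6 : (∑ s₁ ∈ mv k, ∑ s₂ ∈ mv k, G s₁ s₂) + ∑ s₁ ∈ mv k, ∑ s₂ ∈ mv k, G s₁ s₂ = 0 := by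
      nth_rewrite 2 [sum_comm]
      rw [← sum_add_distrib]
      refine sum_eq_zero fun s₁ hs₁ => ?_
      rw [← sum_add_distrib]
      exact sum_eq_zero fun s₂ hs₂ => h2 s₁ hs₁ s₂ hs₂
    rw [← two_smul ℂ] at h6
    exact (smul_eq_zero.1 h6).resolve_left two_ne_zero
  rw [sum_congr rfl h1, sum_add_distrib, h5, add_zero]
  simp only [hF, move_move_opp]
  rw [← sum_smul, ← Complex.ofReal_sum]
  by_cases hmt : IsGTTableau n M (move m k' t)
  · rw [h.sum_pathSum_opp hq hq1 e e' he ht hmt, Complex.ofReal_neg, neg_smul]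
  · rw [ket_of_neg hmt, smul_zero, smul_zero, neg_zero]

/-- Both relations for adjacent generators, according to which of the two rows is above. -/
theorem opT'_adjacent {k k' : ℕ} (hkk : k' = k + 1 ∨ k = k' + 1) (hk : 1 ≤ k) (hk' : 1 ≤ k')
    (hkn : k + 1 ≤ n) (hkn' : k' + 1 ≤ n) :
    opT' q n ε M (k + 1) ^ 2 * opT' q n ε M (k' + 1)
      - ((q + q⁻¹ : ℝ) : ℂ) • (opT' q n ε M (k + 1) * opT' q n ε M (k' + 1) * opT' q n ε M (k + 1))
      + opT' q n ε M (k' + 1) * opT' q n ε M (k + 1) ^ 2 = -opT' q n ε M (k' + 1) := by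
  refine ext_ket fun m hm => ?_
  simp only [sq, LinearMap.add_apply, LinearMap.sub_apply, LinearMap.smul_apply,
    Module.End.mul_apply, LinearMap.neg_apply]
  rw [opT'_opT'_opT'_ket hq hq1 ε hm hk' hkn' hk hkn hk hkn,
    opT'_opT'_opT'_ket hq hq1 ε hm hk hkn hk' hkn' hk hkn,
    opT'_opT'_opT'_ket hq hq1 ε hm hk hkn hk hkn hk' hkn', opT'_ket hq hq1 ε hm hk' hkn',
    sum_comm (s := mv k) (t := mv k')]
  simp_rw [sum_comm (s := mv k) (t := mv k')]
  rw [smul_sum, ← sum_sub_distrib, ← sum_add_distrib,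
    ← sum_neg_distrib]
  refine sum_congr rfl fun t ht => ?_
  rw [← sum_sum_pathSum_smul_ket hq hq1 ⟨hm, hkk, hkn, hkn', hk⟩ _
    (show ((ε (k + 1) : ℤ) : ℝ) * ((ε (k + 1) : ℤ) : ℝ) = 1 by
      rw [← Int.cast_mul, Int.units_coe_mul_self, Int.cast_one]) ht, smul_sum,
    ← sum_sub_distrib, ← sum_add_distrib]
  refine sum_congr rfl fun s₁ _ => ?_
  rw [smul_sum, ← sum_sub_distrib, ← sum_add_distrib]
  refine sum_congr rfl fun s₂ _ => ?_
  rw [pathSum, move_comm m k' t k s₁, move_comm (move m k s₁) k' t k s₂, smul_smul, ← sub_smul,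
    ← add_smul, cs_one]
  congr 1
  push_cast
  ring

theorem opT'_far {k k' : ℕ} (hkk : k + 1 < k' ∨ k' + 1 < k) (hk : 1 ≤ k) (hk' : 1 ≤ k')
    (hkn : k + 1 ≤ n) (hkn' : k' + 1 ≤ n) :
    opT' q n ε M (k + 1) * opT' q n ε M (k' + 1)
      - opT' q n ε M (k' + 1) * opT' q n ε M (k + 1) = 0 := by
  refine ext_ket fun m hm => ?_
  simp only [LinearMap.sub_apply, Module.End.mul_apply, LinearMap.zero_apply]
  rw [opT'_opT'_ket hq hq1 ε hm hk' hkn' hk hkn, opT'_opT'_ket hq hq1 ε hm hk hkn hk' hkn',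
    sum_comm, sub_eq_zero]
  refine sum_congr rfl fun s _ => sum_congr rfl fun t _ => ?_
  rw [coef_move_of_far _ hkk, coef_move_of_far _ hkk.symm, mul_comm, move_comm]

variable (n M) in
theorem opT'_satisfiesRelations : SatisfiesRelations q n (opT' q n ε M) where
  rel₁ i hi hin := by
    obtain ⟨k, rfl⟩ : ∃ k, i = k + 1 + 1 := ⟨i - 2, by omega⟩
    rw [Nat.add_sub_cancel, ← opT'_adjacent hq hq1 ε (k := k) (k' := k + 1) (by omega) (by omega)
      (by omega) (by omega) (by omega)]
    abel
  rel₂ i hi hin := by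
    obtain ⟨k, rfl⟩ : ∃ k, i = k + 1 + 1 := ⟨i - 2, by omega⟩
    exact opT'_adjacent hq hq1 ε (k := k + 1) (k' := k) (by omega) (by omega)
      (by omega) (by omega) (by omega)
  rel₃ i j hi hin hj hjn hij := by
    obtain ⟨k, rfl⟩ : ∃ k, i = k + 1 := ⟨i - 1, by omega⟩
    obtain ⟨k', rfl⟩ : ∃ k, j = k + 1 := ⟨j - 1, by omega⟩
    rw [lt_abs] at hij
    exact opT'_far hq hq1 ε (by omega) (by omega) (by omega) hin hjn

end

end

/-! ### Reflections of tableaux -/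

section

variable {q : ℝ} {n : ℕ} {M : ℕ → ℝ} {m : Pattern}

/-- The sign by which `flip S` multiplies the component `j` of row `k`. -/
def flipSign (S : Finset ℕ) (j k : ℕ) : ℤ := if Even k ∧ j = k / 2 ∧ k / 2 ∈ S then -1 else 1

/-- The move which corresponds to the move `s` of row `k` under `flip S`. -/
def flipMove (S : Finset ℕ) (k : ℕ) (s : ℕ × ℤ) : ℕ × ℤ := (s.1, flipSign S s.1 k * s.2)

theorem flipSign_eq (S : Finset ℕ) (j k : ℕ) : flipSign S j k = 1 ∨ flipSign S j k = -1 := by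
  unfold flipSign; split_ifs <;> simp

theorem flip_apply (S : Finset ℕ) (m : Pattern) (j k : ℕ) :
    flip S m j k = flipSign S j k * m j k := by
  unfold flip flipSign; split_ifs <;> simp

/-- The reflections preserve the distances `|lam|`, since `lam m p (2 * p) = m p (2 * p)`. -/
theorem lam_flip (S : Finset ℕ) (m : Pattern) (j k : ℕ) :
    lam (flip S m) j k = flipSign S j k * lam m j k := by
  rw [lam, lam, flip_apply, flipSign]
  split_ifs with h
  · obtain ⟨⟨p, rfl⟩, rfl, _⟩ := h
    rw [show (p + p) / 2 = p by omega]
    push_cast; ring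
  · push_cast; ring

theorem abs_lam_flip (S : Finset ℕ) (m : Pattern) (j k : ℕ) :
    |lam (flip S m) j k| = |lam m j k| := by
  rw [lam_flip, abs_mul]
  rcases flipSign_eq S j k with h | h <;> simp [h]

theorem flip_move (S : Finset ℕ) (m : Pattern) (k : ℕ) (s : ℕ × ℤ) :
    flip S (move m k s) = move (flip S m) k (flipMove S k s) := by
  funext j' k'
  simp only [move, flip_apply, shift, flipMove]
  split_ifs with h
  · obtain ⟨rfl, rfl⟩ := h
    push_cast; ring
  · rfl

theorem flipMove_flipMove (S : Finset ℕ) (k : ℕ) (s : ℕ × ℤ) :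
    flipMove S k (flipMove S k s) = s := by
  simp only [flipMove, ← mul_assoc]
  rcases flipSign_eq S s.1 k with h | h <;> simp [h]

theorem flipMove_mem_mv {S : Finset ℕ} {k : ℕ} {s : ℕ × ℤ} (hs : s ∈ mv k) :
    flipMove S k s ∈ mv k := by
  rw [mem_mv] at *
  rcases hs with ⟨h1, h2, h3⟩ | ⟨h1, rfl⟩
  · left
    refine ⟨h1, h2, ?_⟩
    simp only [flipMove]
    rcases flipSign_eq S s.1 k with h | h <;> rw [h] <;> omega
  · right; exact ⟨h1, by simp [flipMove]⟩

theorem sum_mv_flipMove {α : Type*} [AddCommMonoid α] (S : Finset ℕ) (k : ℕ) (F : ℕ × ℤ → α) :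
    ∑ s ∈ mv k, F (flipMove S k s) = ∑ s ∈ mv k, F s :=
  sum_nbij' (flipMove S k) (flipMove S k) (fun _ => flipMove_mem_mv) (fun _ => flipMove_mem_mv)
    (fun _ _ => flipMove_flipMove S k _) (fun _ _ => flipMove_flipMove S k _) (fun _ _ => rfl)

theorem cc_lam_flip (S : Finset ℕ) (m : Pattern) (j k : ℕ) :
    cc q (lam (flip S m) j k) = cc q (lam m j k) := by
  rw [lam_flip, cc_sign (flipSign_eq S j k)]

theorem fac_sign {τ : ℤ} (hτ : τ = 1 ∨ τ = -1) (σ : ℤ) (y a : ℝ) :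
    fac q (τ * σ) (τ * y) a = fac q σ y a := by
  rw [fac, fac]
  rcases hτ with rfl | rfl <;> simp

theorem fac_sign_right {τ : ℤ} (hτ : τ = 1 ∨ τ = -1) (σ : ℤ) (y a : ℝ) :
    fac q σ y (τ * a) = fac q σ y a := by
  rw [fac, fac, cs_sign hτ, nf_sign_left hτ]

/-- The matrix elements are invariant under the reflections. -/
theorem coef_flip (e : ℝ) (S : Finset ℕ) (k : ℕ) (m : Pattern) (s : ℕ × ℤ) :
    coef q e k (flip S m) (flipMove S k s) = coef q e k m s := by
  have hτ := flipSign_eq S s.1 k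
  rw [coef, coef, rest, rest]
  congr 1
  · rw [base, base]
    have h0 : flipSign S s.1 k * s.2 = 0 ↔ s.2 = 0 := by
      rcases hτ with h | h <;> rw [h] <;> simp
    have h1 : ((flipSign S s.1 k * s.2 : ℤ) : ℝ) * (flipSign S s.1 k * lam m s.1 k) =
        s.2 * lam m s.1 k := by
      rcases hτ with h | h <;> rw [h] <;> push_cast <;> ring
    have h2 : cc q (flipSign S s.1 k * lam m s.1 k + (flipSign S s.1 k * s.2 : ℤ)) =
        cc q (lam m s.1 k + s.2) := by
      rw [← cc_sign hτ (lam m s.1 k + s.2)]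
      push_cast
      rw [mul_add]
    simp only [flipMove, cc_lam_flip, h0]
    rw [lam_flip, h1, h2]
  · refine prod_congr rfl fun a _ => ?_
    simp only [flipMove]
    rw [lam_flip, lam_flip, fac_sign hτ, fac_sign_right (flipSign_eq S _ _)]

theorem flip_empty (m : Pattern) : flip ∅ m = m := by
  funext j k; simp [flip]

theorem flip_flip (S S' : Finset ℕ) (m : Pattern) :
    flip S (flip S' m) = flip (symmDiff S S') m := by
  funext j k
  simp only [flip, mem_symmDiff]
  by_cases h1 : Even k ∧ j = k / 2
  · by_cases h2 : k / 2 ∈ S <;> by_cases h3 : k / 2 ∈ S' <;> simp [h1, h2, h3]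
  · have h2 : ∀ P : Prop, ¬ (Even k ∧ j = k / 2 ∧ P) := fun P h => h1 ⟨h.1, h.2.1⟩
    simp [h2]

theorem flip_flip_self (S : Finset ℕ) (m : Pattern) : flip S (flip S m) = m := by
  rw [flip_flip, symmDiff_self]; exact flip_empty m

namespace IsGTTableau

theorem flip (h : IsGTTableau n M m) {S : Finset ℕ} (hS : S ⊆ Icc 1 ((n - 1) / 2)) :
    IsGTTableau n M (QSo.flip S m) := by
  have h1 : ∀ j k, j < k / 2 ∨ Odd k ∨ n ≤ k → flipSign S j k = 1 := by
    intro j k hj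
    rw [flipSign, if_neg]
    rintro ⟨h1, rfl, h2⟩
    have h3 := mem_Icc.1 (hS h2)
    rw [← Nat.not_even_iff_odd] at hj
    simp only [h1] at hj
    obtain ⟨p, rfl⟩ := h1
    simp at hj
    omega
  have hI := h.interlaces
  rw [isGTTableau_iff]
  refine ⟨⟨?_, ?_, ?_⟩, ?_, ?_⟩
  · intro j k hjk
    rw [flip_apply, h.supp j k hjk, mul_zero]
  · intro j k h2 h3 h4 h5
    obtain ⟨a, ha⟩ := h.half j k h2 h3 h4 h5
    rw [flip_apply]
    rcases flipSign_eq S j k with h6 | h6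
    · exact ⟨a, by rw [h6, ha]; push_cast; ring⟩
    · exact ⟨-a - 1, by rw [h6, ha]; push_cast; ring⟩
  · intro j hj hjn
    rw [flip_apply, h1 j n (by simp), h.top j hj hjn]
    simp
  · intro k j h2 h3 h4 h5
    rw [abs_lam_flip, lam_flip, h1 j (k + 1) (by
      rcases Nat.even_or_odd' k with ⟨p, rfl | rfl⟩
      · right; left; simp
      · left; omega)]
    simpa using hI.upper k j h2 h3 h4 h5
  · intro k j h2 h3 h4 h5
    rw [abs_lam_flip, lam_flip, h1 j k (by
      rcases Nat.even_or_odd' k with ⟨p, rfl | rfl⟩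
      · left; omega
      · right; left; simp)]
    simpa using hI.lower k j h2 h3 h4 h5

theorem flip_iff {S : Finset ℕ} (hS : S ⊆ Icc 1 ((n - 1) / 2)) :
    IsGTTableau n M (QSo.flip S m) ↔ IsGTTableau n M m :=
  ⟨fun h => by simpa only [flip_flip_self] using h.flip hS, fun h => h.flip hS⟩

theorem isTableau (h : IsGTTableau n M m) (hp : ∀ p, 1 ≤ p → 2 * p + 1 ≤ n → 0 < m p (2 * p)) :
    IsTableau n M m where
  toIsHalfArray := h.toIsHalfArray
  odd_upper := h.odd_upper
  odd_lower := h.odd_lower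
  even_upper := h.even_upper
  even_lower := h.even_lower
  odd_last p h1 h2 := by
    have h3 := hp p h1 h2
    obtain ⟨a, ha⟩ := h.half p (2 * p) (by omega) (by omega) h1 (by omega)
    rw [ha] at h3 ⊢
    have h4 : (0 : ℝ) < ((2 * a + 1 : ℤ) : ℝ) := by push_cast; linarith
    have h5 : 0 < 2 * a + 1 := by exact_mod_cast h4
    have h6 : (0 : ℝ) ≤ (a : ℝ) := by exact_mod_cast (by omega : 0 ≤ a)
    linarith

theorem ne_zero (h : IsGTTableau n M m) {p : ℕ} (h1 : 1 ≤ p) (h2 : 2 * p + 1 ≤ n) :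
    m p (2 * p) ≠ 0 := by
  obtain ⟨a, ha⟩ := h.half p (2 * p) (by omega) (by omega) h1 (by omega)
  intro h0
  rw [h0] at ha
  have h4 : ((2 * a + 1 : ℤ) : ℝ) = ((0 : ℤ) : ℝ) := by push_cast; linarith
  have h5 : 2 * a + 1 = 0 := by exact_mod_cast h4
  omega

end IsGTTableau

theorem IsTableau.pos (h : IsTableau n M m) {p : ℕ} (h1 : 1 ≤ p) (h2 : 2 * p + 1 ≤ n) :
    0 < m p (2 * p) := by linarith [h.odd_last p h1 h2]

theorem IsTableau.isGTTableau (hM : IsNonclassicalWeight n M) (h : IsTableau n M m) :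
    IsGTTableau n M m where
  toIsHalfArray := h.toIsHalfArray
  odd_upper := h.odd_upper
  odd_lower := h.odd_lower
  even_upper := h.even_upper
  even_lower := h.even_lower
  odd_last p h1 h2 := by
    have h3 := h.odd_last p h1 h2
    have h4 := h.odd_upper p p h2 h1 le_rfl
    linarith
  even_last p h1 h2 := by
    obtain ⟨p, rfl⟩ : ∃ r, p = r + 1 := ⟨p - 1, by omega⟩
    have h3 : 0 ≤ m (p + 1) (2 * (p + 1)) := by
      by_cases h4 : 2 * (p + 1) + 1 ≤ n
      · exact (h.pos (by omega) h4).le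
      · have h5 : n = 2 * (p + 1) := by omega
        have h6 := h.top (p + 1) (by omega) (by omega)
        have h7 := hM.last
        rw [h5, show 2 * (p + 1) / 2 = p + 1 by omega] at h7
        rw [h5] at h6
        linarith
    rw [abs_of_nonneg h3]
    exact h.even_lower (p + 1) p h2 (by omega) le_rfl

/-- Every Gel'fand–Tsetlin tableau is the reflection of one with positive `m_{p,2p}`. -/
theorem IsGTTableau.exists_isTableau_flip (h : IsGTTableau n M m) :
    ∃ S ⊆ Icc 1 ((n - 1) / 2), IsTableau n M (QSo.flip S m) := by
  have hS : {p ∈ Icc 1 ((n - 1) / 2) | m p (2 * p) < 0} ⊆ Icc 1 ((n - 1) / 2) := filter_subset _ _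
  refine ⟨_, hS, (h.flip hS).isTableau fun p h1 h2 => ?_⟩
  have h3 := h.ne_zero h1 h2
  rw [flip_apply, flipSign, Nat.mul_div_cancel_left _ two_pos]
  by_cases h4 : m p (2 * p) < 0
  · rw [if_pos ⟨by simp, rfl, mem_filter.2 ⟨mem_Icc.2 ⟨h1, by omega⟩, h4⟩⟩]
    push_cast; linarith
  · rw [if_neg fun hc => h4 (by have := (mem_filter.1 hc.2.2).2; exact this)]
    push_cast
    rw [one_mul]
    exact lt_of_le_of_ne (not_lt.1 h4) h3.symm

/-- Only the trivial reflection preserves the positivity of all `m_{p,2p}`. -/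
theorem IsTableau.eq_empty_of_flip (h : IsTableau n M m) {S : Finset ℕ}
    (hS : S ⊆ Icc 1 ((n - 1) / 2)) (h' : IsTableau n M (QSo.flip S m)) : S = ∅ := by
  by_contra hne
  obtain ⟨p, hp⟩ := nonempty_iff_ne_empty.2 hne
  have h1 := mem_Icc.1 (hS hp)
  have h2 := h'.pos h1.1 (by omega)
  have h3 := h.pos h1.1 (by omega)
  rw [flip_apply, flipSign, Nat.mul_div_cancel_left _ two_pos, if_pos ⟨by simp, rfl, hp⟩] at h2
  push_cast at h2
  linarith

theorem IsNonclassicalWeight.exists_isTableau (hn : 2 ≤ n) (hM : IsNonclassicalWeight n M) :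
    ∃ m, IsTableau n M m := by
  have hpos : ∀ j, 1 ≤ j → j ≤ n / 2 → 1 / 2 ≤ M j := by
    intro j hj hjn
    induction hjn using Nat.decreasingInduction with
    | self => exact hM.last
    | of_succ i hi ih => exact (ih (by omega)).trans (hM.anti i hj hi)
  -- all rows are initial segments of the top row
  set m : Pattern := fun j k => if 2 ≤ k ∧ k ≤ n ∧ 1 ≤ j ∧ j ≤ k / 2 then M j else 0 with hm
  have hm' : ∀ j k, 2 ≤ k → k ≤ n → 1 ≤ j → j ≤ k / 2 → m j k = M j :=
    fun j k h1 h2 h3 h4 => if_pos ⟨h1, h2, h3, h4⟩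
  refine ⟨m, ⟨fun j k h => if_neg h, fun j k h1 h2 h3 h4 => ?_, fun j h1 h2 => ?_⟩, ?_, ?_, ?_,
    ?_, ?_⟩
  · rw [hm' j k h1 h2 h3 h4]; exact hM.half j h3 (by omega)
  · exact hm' j n hn le_rfl h1 h2
  · intro p j h1 h2 h3
    rw [hm' _ _ (by omega) (by omega) h2 (by omega), hm' _ _ (by omega) (by omega) h2 (by omega)]
  · intro p j h1 h2 h3
    rw [hm' _ _ (by omega) (by omega) (by omega) (by omega),
      hm' _ _ (by omega) (by omega) h2 (by omega)]
    exact hM.anti j h2 (by omega)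
  · intro p h1 h2
    rw [hm' _ _ (by omega) (by omega) (by omega) (by omega)]
    exact hpos p h1 (by omega)
  · intro p j h1 h2 h3
    rw [hm' _ _ (by omega) (by omega) h2 (by omega), hm' _ _ (by omega) (by omega) h2 (by omega)]
  · intro p j h1 h2 h3
    rw [hm' _ _ (by omega) (by omega) (by omega) (by omega),
      hm' _ _ (by omega) (by omega) h2 (by omega)]
    exact hM.anti j h2 (by omega)

end

/-! ### The diagonal term of the nonclassical type -/

section

variable {q : ℝ} {n : ℕ} {M : ℕ → ℝ} {m : Pattern}

/-- For `m_{p,2p} = 1/2` the diagonal term of the nonclassical type representation comes from the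
move of `m_{p,2p}` to `-1/2`. -/
theorem IsGTTableau.coeffD_eq (hq : 0 < q) (hq1 : q ≠ 1) (h : IsGTTableau n M m) (e : ℝ) {p : ℕ}
    (hp : 1 ≤ p) (hpn : 2 * p + 1 ≤ n) (hm : m p (2 * p) = 1 / 2) :
    coeffD q p m / (q ^ (1 / 2 : ℝ) - q ^ (-(1 / 2) : ℝ)) = -coef q e (2 * p) m (p, -1) := by
  obtain ⟨r, rfl⟩ : ∃ r, p = r + 1 := ⟨p - 1, by omega⟩
  have hI := h.interlaces
  have hκ := sn_one_ne_zero hq hq1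
  have hlam : lam m (r + 1) (2 * (r + 1)) = 1 / 2 := by
    rw [lam, hm]; push_cast; ring
  obtain ⟨θ, hθ, hθ'⟩ := exists_abs_sn_of_nonneg hq hq1
  -- the radicand is a perfect square, and the sign `θ` of `q - 1` occurs an even number of times
  have hκ' := hθ' 1 zero_le_one
  have hup : ∀ i ∈ Icc 1 (r + 1), 0 ≤ lam m i (2 * (r + 1) + 1) := fun i hi => by
    rw [mem_Icc] at hi
    have := hI.upper (2 * (r + 1)) i (by omega) hpn hi.1 (by omega)
    linarith [abs_nonneg (lam m i (2 * (r + 1)))]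
  have hdown : ∀ i ∈ Icc 1 r, 0 ≤ lam m i (2 * r + 1) := fun i hi => by
    rw [mem_Icc] at hi
    have := hI.lower (2 * r + 1) i (by omega) (by omega) hi.1 (by omega)
    linarith [abs_nonneg (lam m (i + 1) (2 * r + 1 + 1))]
  have herase : (Icc 1 (r + 1)).erase (r + 1) = Icc 1 r := by
    ext i; simp only [mem_erase, mem_Icc]; omega
  have hrow : ∀ i ∈ Icc 1 r, 0 ≤ cc q (lam m i (2 * (r + 1))) - cc q (1 / 2) := fun i hi => by
    rw [mem_Icc] at hi
    rw [sub_nonneg]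
    refine cc_le_cc hq hq1 ?_
    have := h.half_le_abs_lam hpn hi.1 (show i ≤ 2 * (r + 1) / 2 by omega)
    rwa [abs_of_nonneg (by norm_num)]
  have e1 : ∀ a : ℝ, cc q a - cc q 0 = sn q a ^ 2 := fun a => by
    rw [cc_sub_cc hq, add_zero, sub_zero, sq]
  have e2 : ∀ a : ℝ, qnum q (a + 1 / 2) * qnum q (a - 1 / 2) =
      (cc q a - cc q (1 / 2)) * (sn q 1 ^ 2)⁻¹ := fun a => by
    rw [qnum_eq, qnum_eq, cc_sub_cc hq]; field_simp
  have hP : ∏ a ∈ nb (2 * (r + 1)), (cc q (lam m a.1 a.2) - cc q 0) =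
      (∏ a ∈ nb (2 * (r + 1)), |sn q (lam m a.1 a.2)|) ^ 2 := by
    rw [← prod_pow]
    exact prod_congr rfl fun a _ => by rw [e1, sq_abs]
  have hQ : ∏ i ∈ Icc 1 r, (cc q (lam m i (2 * (r + 1))) - cc q (1 / 2)) *
      (cc q (lam m i (2 * (r + 1))) - cc q (1 / 2)) =
      (∏ i ∈ Icc 1 r, (cc q (lam m i (2 * (r + 1))) - cc q (1 / 2))) ^ 2 := by
    rw [sq, prod_mul_distrib]
  have hN : ∏ a ∈ nb (2 * (r + 1)), |sn q (lam m a.1 a.2)| =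
      θ * ((∏ i ∈ Icc 1 (r + 1), sn q (lam m i (2 * (r + 1) + 1))) *
        ∏ i ∈ Icc 1 r, sn q (lam m i (2 * r + 1))) := by
    rw [prod_nb, show (2 * (r + 1) + 1) / 2 = r + 1 by omega,
      show 2 * (r + 1) - 1 = 2 * r + 1 by omega, show (2 * r + 1) / 2 = r by omega,
      prod_congr rfl fun i hi => hθ' _ (hup i hi), prod_congr rfl fun i hi => hθ' _ (hdown i hi),
      prod_mul_distrib, prod_mul_distrib, prod_const, prod_const, Nat.card_Icc, Nat.card_Icc,
      Nat.add_sub_cancel, Nat.add_sub_cancel]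
    have h1 : θ ^ (r + 1) * θ ^ r = θ := by
      rw [pow_succ, mul_right_comm, ← mul_pow, hθ, one_pow, one_mul]
    linear_combination ((∏ i ∈ Icc 1 (r + 1), sn q (lam m i (2 * (r + 1) + 1))) *
        ∏ i ∈ Icc 1 r, sn q (lam m i (2 * r + 1))) * h1
  have key : ∀ X Y Z : ℝ, X * (sn q 1)⁻¹ ^ (r + 1) * (Y * (sn q 1)⁻¹ ^ r) /
      (Z * (sn q 1 ^ 2)⁻¹ ^ r) = (sn q 1)⁻¹ * (X * Y / Z) := fun X Y Z => by
    have h1 : (sn q 1)⁻¹ ^ (r + 1) * (sn q 1)⁻¹ ^ r = (sn q 1)⁻¹ * (sn q 1 ^ 2)⁻¹ ^ r := by ring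
    rw [mul_mul_mul_comm, h1, ← mul_assoc,
      mul_div_mul_right _ Z (pow_ne_zero r (inv_ne_zero (pow_ne_zero 2 hκ)))]
    ring
  have hD : coeffD q (r + 1) m = (sn q 1)⁻¹ *
      ((∏ i ∈ Icc 1 (r + 1), sn q (lam m i (2 * (r + 1) + 1))) *
        (∏ i ∈ Icc 1 r, sn q (lam m i (2 * r + 1))) /
        ∏ i ∈ Icc 1 r, (cc q (lam m i (2 * (r + 1))) - cc q (1 / 2))) := by
    rw [coeffD]
    simp only [show 2 * (r + 1) - 1 = 2 * r + 1 by omega, Nat.add_sub_cancel, lcoord_even,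
      lcoord_odd, add_sub_cancel_right, e2]
    simp only [qnum_eq]
    rw [prod_mul_distrib, prod_mul_distrib, prod_mul_distrib]
    simp only [prod_const, Nat.card_Icc, Nat.add_sub_cancel]
    exact key _ _ _
  have hs : q ^ (1 / 2 : ℝ) - q ^ (-(1 / 2) : ℝ) = sn q (1 / 2) := rfl
  have hs0 : sn q (1 / 2) ≠ 0 := by rw [Ne, sn_eq_zero_iff hq hq1]; norm_num
  have hθ0 : θ ≠ 0 := left_ne_zero_of_mul (hθ.trans_ne one_ne_zero)
  rw [h.coef_step_eq hq hq1 e (by simp) hpn hp (by omega), hlam, hD, hs, wt, if_neg (by simp),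
    Nat.mul_div_cancel_left _ two_pos, herase]
  push_cast
  rw [show (-1 : ℝ) * (1 / 2) + 1 / 2 = 0 by norm_num,
    show (1 / 2 : ℝ) + -1 = -(1 / 2) by norm_num, cc_neg, neg_one_mul, sn_neg, hP, hQ, ← div_pow,
    Real.sqrt_sq (div_nonneg (prod_nonneg fun a _ => abs_nonneg _) (prod_nonneg hrow)), hN, hκ']
  field_simp

/-! ### The reflection operators -/

/-- The operator of the reflections of the components `m_{p,2p}`, `p ∈ S`. -/
def reflect (n : ℕ) (M : ℕ → ℝ) (S : Finset ℕ) : Module.End ℂ (GTSpace n M) :=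
  Finsupp.linearCombination ℂ fun ξ : {m : Pattern // IsGTTableau n M m} =>
    ket (IsGTTableau n M) (flip S ξ.1)

theorem reflect_ket {S : Finset ℕ} (hS : S ⊆ Icc 1 ((n - 1) / 2)) (m : Pattern) :
    reflect n M S (ket (IsGTTableau n M) m) = ket (IsGTTableau n M) (flip S m) := by
  by_cases h : IsGTTableau n M m
  · exact linearCombination_ket (fun m => ket (IsGTTableau n M) (flip S m)) h
  · rw [ket_of_neg h, map_zero, ket_of_neg (mt (IsGTTableau.flip_iff hS).1 h)]

theorem opT'_reflect (hq : 0 < q) (hq1 : q ≠ 1) (ε : ℕ → ℤˣ) {k : ℕ} (hk : 1 ≤ k)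
    (hkn : k + 1 ≤ n) {S : Finset ℕ} (hS : S ⊆ Icc 1 ((n - 1) / 2)) :
    opT' q n ε M (k + 1) * reflect n M S = reflect n M S * opT' q n ε M (k + 1) := by
  refine ext_ket fun m h => ?_
  rw [Module.End.mul_apply, Module.End.mul_apply, reflect_ket hS, opT'_ket hq hq1 ε h hk hkn,
    opT'_ket hq hq1 ε (h.flip hS) hk hkn, map_sum, ← sum_mv_flipMove S k]
  refine sum_congr rfl fun s _ => ?_
  rw [coef_flip, ← flip_move, map_smul, reflect_ket hS]

/-- The positions of the components which are reflected, as numbers. -/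
abbrev toRows {n : ℕ} (S : Finset {p : ℕ // p ∈ Icc 1 ((n - 1) / 2)}) : Finset ℕ :=
  S.map (Function.Embedding.subtype _)

theorem toRows_subset (S : Finset {p : ℕ // p ∈ Icc 1 ((n - 1) / 2)}) :
    toRows S ⊆ Icc 1 ((n - 1) / 2) := fun p hp => by
  obtain ⟨p, -, rfl⟩ := mem_map.1 hp
  exact p.2

theorem toRows_symmDiff (S S' : Finset {p : ℕ // p ∈ Icc 1 ((n - 1) / 2)}) :
    toRows (symmDiff S S') = symmDiff (toRows S) (toRows S') := by
  simp only [toRows, map_eq_image]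
  exact image_symmDiff _ _ (Function.Embedding.injective _)

theorem exists_toRows_eq {S : Finset ℕ} (hS : S ⊆ Icc 1 ((n - 1) / 2)) :
    ∃ S' : Finset {p : ℕ // p ∈ Icc 1 ((n - 1) / 2)}, toRows S' = S :=
  ⟨S.subtype _, subtype_map_of_mem fun _ hp => hS hp⟩

theorem sgn_mul_self (e : ℤˣ) : sgn e * sgn e = 1 := by
  rw [sgn, ← Int.cast_mul, Int.units_coe_mul_self, Int.cast_one]

/-- The eigenvalues of the reflections on the subspace `splitSpace n M δ`. -/
def signChar (δ : OddSigns n) (S : Finset {p : ℕ // p ∈ Icc 1 ((n - 1) / 2)}) : ℂ :=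
  ∏ p ∈ S, -sgn (δ p)

theorem signChar_eq_prod_univ (δ : OddSigns n)
    (S : Finset {p : ℕ // p ∈ Icc 1 ((n - 1) / 2)}) :
    signChar δ S = ∏ p, if p ∈ S then -sgn (δ p) else 1 := by
  rw [signChar, prod_ite_mem, univ_inter]

theorem signChar_symmDiff (δ : OddSigns n)
    (S S' : Finset {p : ℕ // p ∈ Icc 1 ((n - 1) / 2)}) :
    signChar δ (symmDiff S S') = signChar δ S * signChar δ S' := by
  simp only [signChar_eq_prod_univ, ← prod_mul_distrib]
  refine prod_congr rfl fun p _ => ?_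
  have := sgn_mul_self (δ p)
  by_cases h1 : p ∈ S <;> by_cases h2 : p ∈ S' <;> simp [h1, h2, mem_symmDiff, this]

/-- Up to the factor `2 ^ ⌊(n - 1) / 2⌋`, the projection to `splitSpace n M δ`. -/
def splitProj (n : ℕ) (M : ℕ → ℝ) (δ : OddSigns n) : Module.End ℂ (GTSpace n M) :=
  ∑ S, signChar δ S • reflect n M (toRows S)

theorem splitProj_ket (δ : OddSigns n) (m : Pattern) :
    splitProj n M δ (ket (IsGTTableau n M) m) = splitVec n M δ m := by
  rw [splitProj, LinearMap.sum_apply]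
  refine sum_congr rfl fun S _ => ?_
  rw [LinearMap.smul_apply, reflect_ket (toRows_subset S)]
  rfl

theorem splitVec_eq_zero (δ : OddSigns n) (h : ¬ IsGTTableau n M m) : splitVec n M δ m = 0 := by
  rw [← splitProj_ket, ket_of_neg h, map_zero]

theorem splitVec_flip (δ : OddSigns n) (S : Finset {p : ℕ // p ∈ Icc 1 ((n - 1) / 2)})
    (m : Pattern) : splitVec n M δ (flip (toRows S) m) = signChar δ S • splitVec n M δ m := by
  rw [splitVec, splitVec, smul_sum]
  refine (Equiv.sum_comp (symmDiff_left_involutive S).toPerm _).symm.trans ?_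
  refine sum_congr rfl fun S' _ => ?_
  rw [smul_smul]
  change signChar δ (symmDiff S' S) • ket _ (flip (toRows (symmDiff S' S)) (flip _ m)) = _
  rw [flip_flip, ← toRows_symmDiff, symmDiff_symmDiff_cancel_right, signChar_symmDiff, mul_comm]
  rfl

/-- `splitVec n M δ m` is a common eigenvector of the reflections. -/
theorem reflect_splitVec (δ : OddSigns n) (S : Finset {p : ℕ // p ∈ Icc 1 ((n - 1) / 2)})
    (m : Pattern) :
    reflect n M (toRows S) (splitVec n M δ m) = signChar δ S • splitVec n M δ m := by
  rw [← splitVec_flip, splitVec, splitVec, map_sum]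
  refine sum_congr rfl fun S' _ => ?_
  rw [map_smul, reflect_ket (toRows_subset S), flip_flip, flip_flip, symmDiff_comm]

theorem opT'_splitVec (hq : 0 < q) (hq1 : q ≠ 1) (ε : ℕ → ℤˣ) {k : ℕ} (hk : 1 ≤ k)
    (hkn : k + 1 ≤ n) (δ : OddSigns n) (h : IsGTTableau n M m) :
    opT' q n ε M (k + 1) (splitVec n M δ m) =
      ∑ s ∈ mv k, (coef q ((ε (k + 1) : ℤ) : ℝ) k m s : ℂ) • splitVec n M δ (move m k s) := by
  have hcomm : opT' q n ε M (k + 1) * splitProj n M δ =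
      splitProj n M δ * opT' q n ε M (k + 1) := by
    rw [splitProj, mul_sum, sum_mul]
    refine sum_congr rfl fun S _ => ?_
    rw [mul_smul_comm, smul_mul_assoc, opT'_reflect hq hq1 ε hk hkn (toRows_subset S)]
  rw [← splitProj_ket, ← Module.End.mul_apply, hcomm, Module.End.mul_apply,
    opT'_ket hq hq1 ε h hk hkn, map_sum]
  exact sum_congr rfl fun s _ => by rw [map_smul, splitProj_ket]

end

/-! ### The intertwining maps -/

section

variable {q : ℝ} {n : ℕ} {M : ℕ → ℝ} {m : Pattern}

/-- The linear map which takes `|ξ⟩` to `splitVec n M δ ξ`. -/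
def splitMap (n : ℕ) (M : ℕ → ℝ) (δ : OddSigns n) : Space n M →ₗ[ℂ] GTSpace n M :=
  Finsupp.linearCombination ℂ fun ξ : {m : Pattern // IsTableau n M m} => splitVec n M δ ξ.1

/-- The hypothesis excludes tableaux with a negative `m_{p,2p}`. -/
theorem splitMap_ket (δ : OddSigns n) (h : IsGTTableau n M m → IsTableau n M m) :
    splitMap n M δ (ket (IsTableau n M) m) = splitVec n M δ m := by
  by_cases hm : IsTableau n M m
  · exact linearCombination_ket (fun m => splitVec n M δ m) hm
  · rw [ket_of_neg hm, map_zero, splitVec_eq_zero δ (mt h hm)]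

theorem splitMap_evenAction (hq : 0 < q) (hq1 : q ≠ 1) (ε ε' : ℕ → ℤˣ)
    (hM : IsNonclassicalWeight n M) (δ : OddSigns n) {p : ℕ} (hpn : 2 * (p + 1) ≤ n)
    (hε : ε' (2 * (p + 1)) = ε (2 * (p + 1)))
    (h : IsTableau n M m) :
    splitMap n M δ (evenAction q ε' (IsTableau n M) (p + 1) m) =
      opT' q n ε M (2 * p + 1 + 1) (splitVec n M δ m) := by
  have hG := h.isGTTableau hM
  have hmove : ∀ j (σ : ℝ), IsGTTableau n M (shift m j (2 * p + 1) σ) →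
      IsTableau n M (shift m j (2 * p + 1) σ) := fun j σ hg => hg.isTableau fun r h1 h2 => by
    rw [shift, if_neg (by omega)]
    exact h.pos h1 h2
  rw [opT'_splitVec hq hq1 ε (by omega) (by omega) δ hG, sum_mv, if_pos (by simp),
    show 2 * p + 1 + 1 = 2 * (p + 1) by ring, show (2 * p + 1) / 2 = p by omega, evenAction,
    sum_add_distrib, sgn_mul_ofReal, coeffC_eq hq hq1, move_loop, Nat.add_sub_cancel,
    show 2 * (p + 1) - 1 = 2 * p + 1 by omega, map_add, map_sub, map_smul, map_sum, map_sum,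
    splitMap_ket δ fun _ => h, sub_eq_add_neg, ← sum_neg_distrib, hε]
  congr 2 <;> refine sum_congr rfl fun j hj => ?_ <;> rw [mem_Icc] at hj
  · rw [hG.evenUp_eq hq hq1 (((ε (2 * (p + 1)) : ℤ) : ℝ)) (by omega) hj.1 hj.2, map_smul,
      splitMap_ket δ (hmove j _)]
    simp [move]
  · rw [hG.evenDown_eq hq hq1 (((ε (2 * (p + 1)) : ℤ) : ℝ)) (by omega) hj.1 hj.2, map_smul,
      splitMap_ket δ (hmove j _)]
    simp [move]

/-- The terms correspond to each other, except that the move of `m_{p+1,2p+2} = 1/2` to `-1/2`, which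
is the reflection in this component, becomes the diagonal term. -/
theorem splitMap_oddAction (hq : 0 < q) (hq1 : q ≠ 1) (ε ε' : ℕ → ℤˣ)
    (hM : IsNonclassicalWeight n M) (δ : OddSigns n) {p : ℕ}
    (hp : p + 1 ∈ Icc 1 ((n - 1) / 2)) (hδ : ε' (2 * (p + 1) + 1) = δ ⟨p + 1, hp⟩)
    (h : IsTableau n M m) :
    splitMap n M δ (oddAction q ε' (IsTableau n M) (p + 1) m) =
      opT' q n ε M (2 * (p + 1) + 1) (splitVec n M δ m) := by
  have hpn : 2 * (p + 1) + 1 ≤ n := by rw [mem_Icc] at hp; omega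
  have hG := h.isGTTableau hM
  have hup : ∀ j ∈ Icc 1 (p + 1), (oddUp q (p + 1) j m : ℂ) • splitMap n M δ
      (ket (IsTableau n M) (shift m j (2 * (p + 1)) 1)) =
      (coef q ((ε (2 * (p + 1) + 1) : ℤ) : ℝ) (2 * (p + 1)) m (j, 1) : ℂ) •
        splitVec n M δ (move m (2 * (p + 1)) (j, 1)) := fun j hj => by
    rw [mem_Icc] at hj
    rw [hG.oddUp_eq hq hq1 (((ε (2 * (p + 1) + 1) : ℤ) : ℝ)) hpn hj.1 hj.2, splitMap_ket]
    · simp [move]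
    · refine fun hg => hg.isTableau fun r h1 h2 => ?_
      have := h.pos h1 h2
      rw [shift]
      split_ifs <;> linarith
  have hdown : ∀ j ∈ Icc 1 (p + 1), (j = p + 1 → m (p + 1) (2 * (p + 1)) ≠ 1 / 2) →
      -((oddDown q (p + 1) j m : ℂ) • splitMap n M δ
      (ket (IsTableau n M) (shift m j (2 * (p + 1)) (-1)))) =
      (coef q ((ε (2 * (p + 1) + 1) : ℤ) : ℝ) (2 * (p + 1)) m (j, -1) : ℂ) •
        splitVec n M δ (move m (2 * (p + 1)) (j, -1)) := fun j hj hne => by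
    rw [mem_Icc] at hj
    rw [hG.oddDown_eq hq hq1 (((ε (2 * (p + 1) + 1) : ℤ) : ℝ)) hpn hj.1 hj.2, splitMap_ket]
    · simp [move]
    · refine fun hg => hg.isTableau fun r h1 h2 => ?_
      have h3 := h.pos h1 h2
      rw [shift]
      split_ifs with h4
      · obtain ⟨h4, h5⟩ := h4
        obtain rfl : r = p + 1 := by omega
        obtain ⟨a, ha⟩ := hG.half (p + 1) (2 * (p + 1)) (by omega) (by omega) h1 (by omega)
        have h6 : a ≠ 0 := by
          rintro rfl
          exact hne h4.symm (by rw [ha]; norm_num)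
        have h7 : (-1 : ℝ) < a := by linarith
        have h8 : -1 < a := by exact_mod_cast h7
        have h9 : (1 : ℝ) ≤ a := by exact_mod_cast (by omega : 1 ≤ a)
        linarith
      · exact h3
  rw [opT'_splitVec hq hq1 ε (by omega) hpn δ hG, sum_mv, if_neg (by simp), add_zero,
    Nat.mul_div_cancel_left _ two_pos, sum_add_distrib, oddAction, map_sub, map_add, map_sum,
    map_sum]
  simp only [map_smul]
  rw [sum_congr rfl hup]
  by_cases hm : m (p + 1) (2 * (p + 1)) = 1 / 2
  · have hflip : move m (2 * (p + 1)) (p + 1, -1) = flip (toRows {⟨p + 1, hp⟩}) m := by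
      funext j k
      rw [move, shift, flip_apply, flipSign]
      simp only [toRows, map_singleton, Function.Embedding.subtype_apply, mem_singleton]
      by_cases hjk : j = p + 1 ∧ k = 2 * (p + 1)
      · rw [if_pos hjk, if_pos ⟨⟨p + 1, by omega⟩, by omega, by omega⟩, hjk.1, hjk.2, hm]
        push_cast; norm_num
      · rw [if_neg hjk, if_neg (by
          rintro ⟨⟨r, hr⟩, h2, h3⟩
          exact hjk ⟨by omega, by omega⟩)]
        push_cast; ring
    rw [if_pos hm, if_pos hm, map_smul, splitMap_ket δ fun _ => h, Nat.add_sub_cancel,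
      sum_Icc_succ_top (by omega) (fun j => (coef q _ _ m (j, -1) : ℂ) • splitVec n M δ _), hflip,
      splitVec_flip, hδ, signChar, prod_singleton, smul_smul, ← sum_congr rfl fun j hj =>
        hdown j (Icc_subset_Icc_right (Nat.le_succ p) hj)
          (fun h1 => by rw [mem_Icc] at hj; omega), sum_neg_distrib]
    have hD := hG.coeffD_eq hq hq1 ((ε (2 * (p + 1) + 1) : ℤ) : ℝ) (by omega) hpn hm
    rw [eq_neg_iff_add_eq_zero, add_comm, ← eq_neg_iff_add_eq_zero] at hD
    rw [hD]
    push_cast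
    rw [neg_mul_neg, div_mul_eq_mul_div, div_mul_eq_mul_div, mul_comm (sgn _)]
    abel
  · rw [if_neg hm, if_neg hm, map_zero, zero_add, sub_eq_add_neg, ← sum_neg_distrib]
    congr 1
    exact sum_congr rfl fun j hj => hdown j hj fun _ => hm

theorem splitMap_opT (hq : 0 < q) (hq1 : q ≠ 1) (ε : ℕ → ℤˣ) (hM : IsNonclassicalWeight n M)
    (δ : OddSigns n) {k : ℕ} (hk : 2 ≤ k) (hkn : k ≤ n) (v : Space n M) :
    splitMap n M δ (opT q n (mergeSigns n ε δ) M k v) = opT' q n ε M k (splitMap n M δ v) := by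
  suffices h : splitMap n M δ ∘ₗ opT q n (mergeSigns n ε δ) M k =
      opT' q n ε M k ∘ₗ splitMap n M δ from LinearMap.congr_fun h v
  refine ext_ket fun m h => ?_
  rw [LinearMap.comp_apply, LinearMap.comp_apply, splitMap_ket δ fun _ => h, opT,
    linearCombination_ket (fun m => if Odd k then
      oddAction q (mergeSigns n ε δ) (IsTableau n M) (k / 2) m
      else evenAction q (mergeSigns n ε δ) (IsTableau n M) (k / 2) m) h]
  rcases Nat.even_or_odd' k with ⟨p, rfl | rfl⟩
  · obtain ⟨p, rfl⟩ : ∃ r, p = r + 1 := ⟨p - 1, by omega⟩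
    rw [if_neg (by simp), Nat.mul_div_cancel_left _ two_pos]
    exact splitMap_evenAction hq hq1 ε _ hM δ hkn (by rw [mergeSigns, dif_neg (by simp)]) h
  · obtain ⟨p, rfl⟩ : ∃ r, p = r + 1 := ⟨p - 1, by omega⟩
    have hp : p + 1 ∈ Icc 1 ((n - 1) / 2) := by rw [mem_Icc]; omega
    have h2 : (2 * (p + 1) + 1) / 2 = p + 1 := by omega
    rw [if_pos (by simp), h2]
    refine splitMap_oddAction hq hq1 ε _ hM δ hp ?_ h
    rw [mergeSigns, dif_pos ⟨by simp, by rwa [h2]⟩]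
    congr 2

/-! ### The decomposition -/

theorem splitMap_injective (hM : IsNonclassicalWeight n M) (δ : OddSigns n) :
    Function.Injective (splitMap n M δ) := by
  -- among the tableaux with positive `m_{p,2p}` only `ξ` itself occurs in `splitVec n M δ ξ`
  let R : GTSpace n M →ₗ[ℂ] Space n M := Finsupp.lcomapDomain
    (fun ξ : {m : Pattern // IsTableau n M m} => ⟨ξ.1, ξ.2.isGTTableau hM⟩)
    fun ξ η h => Subtype.ext (by simpa using h)
  have hR : ∀ m, IsGTTableau n M m → R (ket (IsGTTableau n M) m) = ket (IsTableau n M) m := by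
    intro m h
    rw [ket_of_pos h]
    ext ξ
    change Finsupp.single (⟨m, h⟩ : {m : Pattern // IsGTTableau n M m}) (1 : ℂ)
      ⟨ξ.1, ξ.2.isGTTableau hM⟩ = _
    by_cases hm : ξ.1 = m
    · subst hm
      rw [ket_of_pos ξ.2, Finsupp.single_eq_same]
      exact Finsupp.single_eq_same.symm
    · rw [Finsupp.single_eq_of_ne (by simpa using hm)]
      by_cases h' : IsTableau n M m
      · rw [ket_of_pos h', Finsupp.single_eq_of_ne (by rintro rfl; exact hm rfl)]
      · rw [ket_of_neg h', Finsupp.zero_apply]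
  have hcomp : R ∘ₗ splitMap n M δ = LinearMap.id := by
    refine ext_ket fun m h => ?_
    have hG := h.isGTTableau hM
    rw [LinearMap.comp_apply, splitMap_ket δ fun _ => h, splitVec, map_sum,
      sum_eq_single ∅, map_smul, prod_empty, one_smul, map_empty, flip_empty, hR m hG]
    · rfl
    · intro S _ hS
      rw [map_smul, hR _ (hG.flip (toRows_subset S)), ket_of_neg, smul_zero]
      intro hc
      exact hS (map_eq_empty.1 (h.eq_empty_of_flip (toRows_subset S) hc))
    · simp
  exact Function.LeftInverse.injective (g := R) fun v => LinearMap.congr_fun hcomp v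

theorem range_splitMap (δ : OddSigns n) :
    LinearMap.range (splitMap n M δ) = splitSpace n M δ :=
  Finsupp.range_linearCombination ℂ

theorem sum_signChar_mul_signChar (δ δ' : OddSigns n) (h : δ ≠ δ') :
    ∑ S, signChar δ' S * signChar δ S = 0 := by
  obtain ⟨p, hp⟩ := Function.ne_iff.1 h
  have h1 : ∑ S, signChar δ' S * signChar δ S = ∏ p, (1 + sgn (δ' p) * sgn (δ p)) := by
    rw [prod_one_add, powerset_univ]
    refine sum_congr rfl fun S _ => ?_
    rw [signChar, signChar, ← prod_mul_distrib]
    exact prod_congr rfl fun p _ => neg_mul_neg _ _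
  rw [h1, prod_eq_zero (mem_univ p)]
  rcases Int.units_eq_one_or (δ p) with h2 | h2 <;>
    rcases Int.units_eq_one_or (δ' p) with h3 | h3 <;> simp_all [sgn]

theorem sum_signChar_mul_self (δ : OddSigns n) :
    ∑ S, signChar δ S * signChar δ S = 2 ^ ((n - 1) / 2) := by
  have h : ∀ S, signChar δ S * signChar δ S = 1 := fun S => by
    rw [signChar, ← prod_mul_distrib]
    exact prod_eq_one fun p _ => by rw [neg_mul_neg, sgn_mul_self]
  simp [h]

theorem splitProj_splitVec (δ δ' : OddSigns n) (m : Pattern) :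
    splitProj n M δ' (splitVec n M δ m) =
      (∑ S, signChar δ' S * signChar δ S) • splitVec n M δ m := by
  rw [splitProj, LinearMap.sum_apply, sum_smul]
  exact sum_congr rfl fun S _ => by
    rw [LinearMap.smul_apply, reflect_splitVec, smul_smul]

theorem splitProj_of_mem {δ δ' : OddSigns n} {v : GTSpace n M} (hv : v ∈ splitSpace n M δ) :
    splitProj n M δ' v = (∑ S, signChar δ' S * signChar δ S) • v := by
  refine LinearMap.eqOn_span (f := splitProj n M δ')
    (g := (∑ S, signChar δ' S * signChar δ S) • LinearMap.id) ?_ hv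
  rintro _ ⟨ξ, rfl⟩
  exact splitProj_splitVec δ δ' ξ.1

theorem splitVec_mem (h : IsGTTableau n M m) (δ : OddSigns n) :
    splitVec n M δ m ∈ splitSpace n M δ := by
  obtain ⟨S, hS, hm⟩ := h.exists_isTableau_flip
  obtain ⟨S, rfl⟩ := exists_toRows_eq hS
  rw [← flip_flip_self (toRows S) m, splitVec_flip]
  exact Submodule.smul_mem _ _ (Submodule.subset_span ⟨⟨_, hm⟩, rfl⟩)

theorem sum_signChar {S : Finset {p : ℕ // p ∈ Icc 1 ((n - 1) / 2)}} (hS : S ≠ ∅) :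
    ∑ δ : OddSigns n, signChar δ S = 0 := by
  obtain ⟨p, hp⟩ := nonempty_iff_ne_empty.2 hS
  simp only [signChar_eq_prod_univ]
  rw [← Fintype.prod_sum fun p (e : ℤˣ) => if p ∈ S then -sgn e else 1]
  refine prod_eq_zero (mem_univ p) ?_
  simp [hp, sgn]

/-- Every basis vector is recovered from its components in the subspaces `splitSpace n M δ`. -/
theorem sum_splitVec (m : Pattern) : ∑ δ : OddSigns n, splitVec n M δ m =
    (Fintype.card (OddSigns n) : ℂ) • ket (IsGTTableau n M) m := by
  simp only [← splitProj_ket]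
  simp only [splitProj, LinearMap.sum_apply, LinearMap.smul_apply]
  rw [sum_comm]
  simp only [← sum_smul]
  rw [sum_eq_single ∅ (fun S _ hS => by rw [sum_signChar hS, zero_smul]) (by simp),
    reflect_ket (toRows_subset ∅)]
  simp [signChar, toRows, flip_empty]

variable (n M) in
theorem splitSpace_isInternal : DirectSum.IsInternal (splitSpace n M) := by
  rw [DirectSum.isInternal_submodule_iff_iSupIndep_and_iSup_eq_top]
  constructor
  · rw [iSupIndep_def]
    intro δ
    rw [Submodule.disjoint_def]
    intro v hv hv'
    have h1 : (⨆ δ', ⨆ _ : δ' ≠ δ, splitSpace n M δ') ≤ LinearMap.ker (splitProj n M δ) :=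
      iSup₂_le fun δ' h x hx => by
        rw [LinearMap.mem_ker, splitProj_of_mem hx, sum_signChar_mul_signChar δ' δ h, zero_smul]
    have h2 := LinearMap.mem_ker.1 (h1 hv')
    rw [splitProj_of_mem hv, sum_signChar_mul_self] at h2
    exact (smul_eq_zero.1 h2).resolve_left (pow_ne_zero _ two_ne_zero)
  · refine eq_top_iff.2 fun v _ => ?_
    induction v using Finsupp.induction_linear with
    | zero => exact zero_mem _
    | add f g hf hg => exact add_mem (hf trivial) (hg trivial)
    | single ξ a =>
      have hc : (Fintype.card (OddSigns n) : ℂ) ≠ 0 := Nat.cast_ne_zero.2 Fintype.card_ne_zero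
      have h1 := sum_splitVec (n := n) (M := M) ξ.1
      rw [← inv_smul_eq_iff₀ hc, ket_of_pos ξ.2] at h1
      rw [← Finsupp.smul_single_one, ← h1]
      exact Submodule.smul_mem _ _ (Submodule.smul_mem _ _ (Submodule.sum_mem _ fun δ _ =>
        Submodule.mem_iSup_of_mem δ (splitVec_mem ξ.2 δ)))

/-- The relations are inherited by operators which are intertwined by an injective map. -/
theorem SatisfiesRelations.of_injective {V W : Type*} [AddCommGroup V] [Module ℂ V]
    [AddCommGroup W] [Module ℂ W] {T : ℕ → Module.End ℂ V} {T' : ℕ → Module.End ℂ W}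
    (h : SatisfiesRelations q n T') (f : V →ₗ[ℂ] W) (hf : Function.Injective f)
    (hT : ∀ k, 2 ≤ k → k ≤ n → ∀ v, f (T k v) = T' k (f v)) : SatisfiesRelations q n T where
  rel₁ i hi hin := by
    refine LinearMap.ext fun v => hf ?_
    have := LinearMap.congr_fun (h.rel₁ i hi hin) (f v)
    simpa [sq, hT i (by omega) hin, hT (i - 1) (by omega) (by omega)] using this
  rel₂ i hi hin := by
    refine LinearMap.ext fun v => hf ?_
    have := LinearMap.congr_fun (h.rel₂ i hi hin) (f v)
    simpa [sq, hT i (by omega) hin, hT (i - 1) (by omega) (by omega)] using this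
  rel₃ i j hi hin hj hjn hij := by
    refine LinearMap.ext fun v => hf ?_
    have := LinearMap.congr_fun (h.rel₃ i j hi hin hj hjn hij) (f v)
    simpa [hT i hi hin, hT j hj hjn] using this

theorem opT_satisfiesRelations (hq : 0 < q) (hq1 : q ≠ 1) (ε : ℕ → ℤˣ)
    (hM : IsNonclassicalWeight n M) : SatisfiesRelations q n (opT q n ε M) := by
  set δ : OddSigns n := fun p => ε (2 * p.1 + 1) with hδ
  have hε : mergeSigns n ε δ = ε := by
    funext i
    rw [mergeSigns]
    split_ifs with h
    · obtain ⟨⟨p, rfl⟩, -⟩ := h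
      simp only [hδ]
      congr 2
      omega
    · rfl
  refine (opT'_satisfiesRelations n M hq hq1 ε).of_injective (splitMap n M δ)
    (splitMap_injective hM δ) fun k hk hkn v => ?_
  have := splitMap_opT hq hq1 ε hM δ hk hkn v
  rwa [hε] at this

end

end QSo

end

theorem mainTheorem2 (n : ℕ) (hn : 2 ≤ n) (q : ℝ) (hq : 0 < q) (hq1 : q ≠ 1)
    (ε : ℕ → ℤˣ) (M : ℕ → ℝ) :
    -- the operators `T_{ε,m_n}(I_{k,k-1})` satisfy the defining relations
    (QSo.IsNonclassicalWeight n M →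
      QSo.SatisfiesRelations q n (QSo.opT q n ε M) ∧
      QSo.DefinesRepresentation q n (QSo.opT q n ε M)) ∧
    -- so do the operators `T'_{m_n}(I_{k,k-1})`
    (QSo.IsClassicalHalfWeight n M →
      QSo.SatisfiesRelations q n (QSo.opT' q n ε M) ∧
      QSo.DefinesRepresentation q n (QSo.opT' q n ε M)) ∧
    -- `T'_{m_n}` splits into `2^⌊(n-1)/2⌋` nonzero invariant subspaces, on which its operators
    -- act as the operators `T_{ε,m_n}(I_{k,k-1})`
    (QSo.IsNonclassicalWeight n M →
      Fintype.card (QSo.OddSigns n) = 2 ^ ((n - 1) / 2) ∧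
      DirectSum.IsInternal (QSo.splitSpace n M) ∧
      ∀ δ : QSo.OddSigns n,
        QSo.splitSpace n M δ ≠ ⊥ ∧
        (∀ k, 2 ≤ k → k ≤ n → ∀ v ∈ QSo.splitSpace n M δ,
          QSo.opT' q n ε M k v ∈ QSo.splitSpace n M δ) ∧
        ∃ Φ : QSo.Space n M ≃ₗ[ℂ] QSo.splitSpace n M δ,
          (∀ ξ : {m : QSo.Pattern // QSo.IsTableau n M m},
            (Φ (Finsupp.single ξ 1) : QSo.GTSpace n M) = QSo.splitVec n M δ ξ.1) ∧
          ∀ k, 2 ≤ k → k ≤ n → ∀ v : QSo.Space n M,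
            (Φ (QSo.opT q n (QSo.mergeSigns n ε δ) M k v) : QSo.GTSpace n M) =
              QSo.opT' q n ε M k (Φ v : QSo.GTSpace n M)) := by
  refine ⟨fun hM => ?_, fun _ => ?_, fun hM => ⟨?_, QSo.splitSpace_isInternal n M, fun δ => ?_⟩⟩
  · have h := QSo.opT_satisfiesRelations hq hq1 ε hM
    exact ⟨h, h.definesRepresentation⟩
  · have h := QSo.opT'_satisfiesRelations n M hq hq1 ε
    exact ⟨h, h.definesRepresentation⟩
  · simp
  · have hinj := QSo.splitMap_injective hM δ
    have hrange := QSo.range_splitMap (n := n) (M := M) δ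
    have hmem : ∀ v, QSo.splitMap n M δ v ∈ QSo.splitSpace n M δ := fun v => by
      rw [← hrange]; exact LinearMap.mem_range_self _ v
    refine ⟨?_, fun k hk hkn v hv => ?_,
      (LinearEquiv.ofInjective _ hinj).trans (LinearEquiv.ofEq _ _ hrange), fun ξ => ?_,
      fun k hk hkn v => ?_⟩
    · obtain ⟨m, hm⟩ := hM.exists_isTableau hn
      refine (Submodule.ne_bot_iff _).2
        ⟨_, hmem (Finsupp.single ⟨m, hm⟩ 1), fun h => ?_⟩
      rw [map_eq_zero_iff _ hinj, Finsupp.single_eq_zero] at h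
      exact one_ne_zero h
    · rw [← hrange] at hv
      obtain ⟨w, rfl⟩ := hv
      rw [← QSo.splitMap_opT hq hq1 ε hM δ hk hkn]
      exact hmem _
    · exact (Finsupp.linearCombination_single ℂ 1 ξ).trans (one_smul ℂ _)
    · exact QSo.splitMap_opT hq hq1 ε hM δ hk hkn v
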